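/- **Setting.** For integers $0<p<N$ let $\Omega_{N,p}$ be the set of configurations $\eta\in\{0,1\}^{\mathbb Z/N\mathbb Z}$ with $\sum_x\eta_x=p$. For $\gamma\in\mathbb R$ let $M_\gamma$ be the matrix of the operator $$L_\gamma g(\eta)=\sum_{x}\eta_{x+1}(1-\eta_x)\big(e^{\gamma}g(\eta^{x,x+1})-g(\eta)\big)$$ on functions on $\Omega_{N,p}$, where $\eta^{x,x+1}$ is $\eta$ with $\eta_x$ and $\eta_{x+1}$ exchanged (the tilted generator of the totally asymmetric simple exclusion process on a ring). Let $\lambda_1(\gamma)=\lambda_1(\gamma;N,p)$ be the eigenvalue of $M_\gamma$ with the largest real part. For $C\in\mathbb C$ label the $N$ roots $u_1(C),\dots,u_N(C)$ of $(1-u)^p(1+u)^{N-p}=C$ as follows, with $\arg\in(-\pi,\pi]$ and $F(u)=\frac p\pi\arg(u-1)+\frac{N-p}\pi\arg(u+1)$. If $C\notin[0,\infty)$, $u_j(C)$ is the unique root such that $F(u_j)$ lies, modulo $2N$, in $(-p+2(j-1),-p+2j]$. If $C>0$, $u_j(C)=\lim_{\delta\uparrow0}u_j(Ce^{i\delta})$.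 Finally $u_j(0)=1$ for $j\le p$ and $u_j(0)=-1$ for $j>p$. For a set $A\subseteq\{1,\dots,N\}$ with $|A|=p$, the consistency equation in the unknown $C\in\mathbb C$ is $$2^Ne^{\gamma N}\prod_{j\in A}\frac{u_j(C)-1}{u_j(C)+1}+C=0\qquad(u_j(C)\ne-1\text{ for }j\in A),\tag{1}$$ and for $A=\{1,\dots,p-1,N\}$ its logarithmic form is $$\frac1p\log\frac{u_N(C)+1}{u_p(C)+1}+G_N(C)=\gamma,\qquad G_N(C)=\frac1p\sum_{j=1}^p\log(1+u_j(C))-\log2,\tag{2}$$ with principal logarithms. **Proposition.** Fix $\gamma<0$ and a rational $\rho\in(0,1)$, and let $N\to\infty$ along the pairs $(N,p)$ with $p=\rho N$. (a) For all large $N$, equation (1) with $A=\{1,\dots,p-1,N\}$ and equation (2) each have exactly one solution in $\mathbb C$; it is the same number $C^*_{N,\gamma}$ for both, and it is real and positive. It tends to zero exponentially fast ($C^*_{N,\gamma}=O(e^{-cN})$ for some $c>0$), and $$C^*_{N,\gamma}=2^Ne^{N^2\gamma\rho(1-\rho)}+o\big(2^Ne^{N^2\gamma\rho(1-\rho)}\big).$$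 (b) Assume that for all large $N$ the largest eigenvalue is achieved by the selection $A=\{1,\dots,p-1,N\}$, that is, $\lambda_1(\gamma)=\frac12\sum_{j\in A}(u_j(C)-1)$ for some solution $C$ of (1) with this $A$. Then $$\lambda_1(\gamma)=-1+e^{N\gamma\rho}+e^{N\gamma(1-\rho)}+o\big(e^{N\gamma\rho}+e^{N\gamma(1-\rho)}\big).$$ -/

import Mathlib

open Filter Asymptotics
open scoped Topology

noncomputable section

namespace TASEP

/-! ### The tilted generator of the periodic TASEP -/

/-- Configurations of `p` particles on the ring of `N` sites; `true` means occupied. -/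
abbrev Config (N p : ℕ) : Type :=
  {η : Fin N → Bool // (Finset.univ.filter fun x => η x = true).card = p}

/-- The right neighbour `x + 1` of the site `x` on the ring. -/
def next {N : ℕ} (x : Fin N) : Fin N := finRotate N x

/-- The occupation numbers `η^{x,x+1}`: those of `η` with `η_x` and `η_{x+1}` exchanged. -/
def exchange {N : ℕ} (η : Fin N → Bool) (x : Fin N) : Fin N → Bool :=
  fun y => η (Equiv.swap x (next x) y)

/-- The matrix `M_γ` of the operator
`L_γ g(η) = ∑ₓ η_{x+1} (1 - η_x) (e^γ g(η^{x,x+1}) - g(η))`. -/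
def tiltedMatrix (N p : ℕ) (γ : ℝ) : Matrix (Config N p) (Config N p) ℂ :=
  fun η η' => ∑ x : Fin N,
    if η.1 (next x) = true ∧ η.1 x = false then
      (if η'.1 = exchange η.1 x then Complex.exp γ else 0) - (if η' = η then 1 else 0)
    else 0

/-- `l` is an eigenvalue of `M_γ` with the largest real part. -/
def IsLargestEigenvalue (N p : ℕ) (γ : ℝ) (l : ℂ) : Prop :=
  Module.End.HasEigenvalue (Matrix.toLin' (tiltedMatrix N p γ)) l ∧
    ∀ μ : ℂ, Module.End.HasEigenvalue (Matrix.toLin' (tiltedMatrix N p γ)) μ → μ.re ≤ l.re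

/-! ### The labelled roots `u_1(C), …, u_N(C)` of `(1 - u)^p (1 + u)^(N - p) = C` -/

/-- `F(u) = (p/π) arg(u - 1) + ((N - p)/π) arg(u + 1)`. -/
def rootPhase (N p : ℕ) (u : ℂ) : ℝ :=
  (p : ℝ) / Real.pi * Complex.arg (u - 1) + ((N : ℝ) - p) / Real.pi * Complex.arg (u + 1)

/-- `x` lies, modulo `2N`, in the interval `(-p + 2(j - 1), -p + 2j]`. -/
def InPhaseInterval (N p j : ℕ) (x : ℝ) : Prop :=
  ∃ k : ℤ, x + 2 * (N : ℝ) * k ∈ Set.Ioc (-(p : ℝ) + 2 * ((j : ℝ) - 1)) (-(p : ℝ) + 2 * j)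

/-- For `C` outside `[0, ∞)`: the root whose phase lies in the `j`-th interval. -/
def slitRoot (N p j : ℕ) (C : ℂ) : ℂ :=
  Classical.epsilon fun u : ℂ =>
    (1 - u) ^ p * (1 + u) ^ (N - p) = C ∧ InPhaseInterval N p j (rootPhase N p u)

open Classical in
/-- The root `u_j(C)`, `1 ≤ j ≤ N`. On `(0, ∞)` it is the continuous extension from the lower
half-plane; at `C = 0` there are the `p`-fold root `1` and the `(N - p)`-fold root `-1`. -/
def root (N p j : ℕ) (C : ℂ) : ℂ :=
  if C = 0 then (if j ≤ p then 1 else -1)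
  else if 0 < C.re ∧ C.im = 0 then
    limUnder (𝓝[<] (0 : ℝ)) fun δ : ℝ => slitRoot N p j (C * Complex.exp (δ * Complex.I))
  else slitRoot N p j C

/-! ### Bethe equations for a selected set of roots -/

/-- The consistency condition for the selection `A`, with all its fractions well defined. -/
def Consistency (N p : ℕ) (γ : ℝ) (A : Finset ℕ) (C : ℂ) : Prop :=
  (∀ j ∈ A, root N p j C + 1 ≠ 0) ∧
    2 ^ N * Complex.exp (γ * N) * ∏ j ∈ A, (root N p j C - 1) / (root N p j C + 1) + C = 0

/-- The eigenvalue `(1/2) ∑_{j ∈ A} (u_j(C) - 1)` produced by the selection `A`. -/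
def betheEigenvalue (N p : ℕ) (A : Finset ℕ) (C : ℂ) : ℂ :=
  1 / 2 * ∑ j ∈ A, (root N p j C - 1)

/-- The selection `{1, …, p - 1, N}`. -/
def negSelection (N p : ℕ) : Finset ℕ := insert N (Finset.Icc 1 (p - 1))

/-- `G_N(C) = (1/p) ∑_{j=1}^p log(1 + u_j(C)) - log 2`. -/
def G (N p : ℕ) (C : ℂ) : ℂ :=
  1 / (p : ℂ) * ∑ j ∈ Finset.Icc 1 p, Complex.log (1 + root N p j C) - Complex.log 2

/-- The logarithmic form of the consistency condition for the selection `{1, …, p - 1, N}`. -/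
def LogConsistency (N p : ℕ) (γ : ℝ) (C : ℂ) : Prop :=
  1 / (p : ℂ) * Complex.log ((root N p N C + 1) / (root N p p C + 1)) + G N p C = γ

/-! ### Thermodynamic limit and the assumption on the selection of roots -/

/-- The limit `N → ∞` over the pairs `(N, p)` with `p = ρ N`. -/
def thermodynamicLimit (ρ : ℚ) : Filter (ℕ × ℕ) :=
  comap Prod.fst atTop ⊓ 𝓟 {q : ℕ × ℕ | (q.2 : ℚ) = ρ * q.1}

/-- For all large `N`, the largest eigenvalue of `M_γ` is achieved by the
selection `{1, …, p - 1, N}`. -/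
def RootSelection (γ : ℝ) (ρ : ℚ) : Prop :=
  ∀ᶠ q in thermodynamicLimit ρ, ∀ l : ℂ, IsLargestEigenvalue q.1 q.2 γ l →
    ∃ C : ℂ, Consistency q.1 q.2 γ (negSelection q.1 q.2) C ∧
      l = betheEigenvalue q.1 q.2 (negSelection q.1 q.2) C

end TASEP

end

noncomputable section

namespace TASEP

/-! ### Monotonicity of the phase along the level lines -/

/-! Write n = N - p. The proof has a global half, which forces every solution `C` to be tiny, and a
local half, which solves both equations for tiny `C`.

Geometry of the roots. With b = log(1 + u), the logarithm of the left side of the root equation is p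
log(e^b - 2) + n b up to a constant, and its derivative p + n + 2p/(e^b - 2) has negative imaginary
part in the strip 0 < Im b < π. On a level line of the modulus this makes the phase F strictly
decreasing in |1 + u| in the upper half-plane (`phase_antitone_upper`); conjugation covers the lower
one. Hence roots are determined by their phases, the labels are well defined, the limits on the
positive axis exist, and u_1, ..., u_p are the p roots with largest |1 + u|.

A priori bound. Either equation fixes a modulus: ∏_{j ≤ p} |1 + u_j| · |1 + u_N| = 2^p e^{γp} |1 +
u_p|. In the other direction, symmetric functions of the roots are polynomials in C, and the maximum
principle shows that on each circle some product of p factors |1 + u_j| is essentially at least its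
value 2^p at the centre (`two_pow_le_of_forall_prod_le`). Roots at two points of a circle interlace,
so this carries over to the first p roots at every point of the circle, up to a third power of (R +
2)/|1 + u_N| with R = |C|^{1/N} (`sum_log_le_of_norm_eq`, `two_pow_mul_le`). Together these make |1
+ u_N| small, and then |C| ≤ e^{-cN²} (`norm_le_of_prod_eq`).

Local analysis. For small C = e^τ the roots form two lobes, around 1 and -1, parametrised by the
local inverse of x(1 - x/2)^a (`LobeChart`). Both equations turn into one fixed point equation τ =
pnγ + N log 2 + g(τ), with g holomorphic and of size O(N² e^{-cN}) (`logConsistency_iff`,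
`consistency_iff`). Cauchy's estimate makes g a contraction, which gives uniqueness; g is real on
the real axis, so the intermediate value theorem gives a real solution t, and C* = e^t
(`exists_unique_solution`).

For the eigenvalue, the linear terms of the p roots around 1 cancel because the p-th roots of unity
sum to zero. What remains to first order is the omitted root u_p, which contributes e^{γn}, and the
added root u_N, which contributes -1 + e^{γp} (`betheEigenvalue_bound`). -/

theorem continuousWithinAt_log_upper {z : ℂ} (hz : z ≠ 0) :
    ContinuousWithinAt Complex.log {w : ℂ | 0 ≤ w.im} z := by
  by_cases h : z ∈ Complex.slitPlane
  · exact (continuousAt_clog h).continuousWithinAt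
  · rw [Complex.mem_slitPlane_iff, not_or, not_lt, not_not] at h
    have hre : z.re < 0 := lt_of_le_of_ne h.1 (fun h0 => hz (Complex.ext h0 h.2))
    exact Complex.continuousWithinAt_log_of_re_neg_of_im_zero hre h.2

/-- Along the segment between two logarithms in a horizontal strip, the function
`p log(e^b - 2) + n b` has increments that point below the direction of the segment. -/
theorem im_increment_neg {p n : ℝ} (hp : 0 < p) {b b' : ℂ} (hne : b ≠ b')
    (hb : 0 ≤ b.im) (hb1 : b.im ≤ Real.pi) (hb' : 0 ≤ b'.im) (hb1' : b'.im ≤ Real.pi)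
    (h0 : 0 < b.im ∨ 0 < b'.im) (hpi : b.im < Real.pi ∨ b'.im < Real.pi)
    (hs : Complex.exp b - 2 ≠ 0) (hs' : Complex.exp b' - 2 ≠ 0) :
    (((p * Complex.log (Complex.exp b' - 2) + n * b') -
      (p * Complex.log (Complex.exp b - 2) + n * b)) * (starRingEnd ℂ) (b' - b)).im < 0 := by
  set Δ := b' - b with hΔ
  have hΔ0 : Δ ≠ 0 := sub_ne_zero.2 hne.symm
  set β : ℝ → ℂ := fun t => b + t * Δ with hβ
  have him : ∀ t : ℝ, (β t).im = (1 - t) * b.im + t * b'.im := by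
    intro t; simp [hβ, hΔ]; ring
  have hin : ∀ t ∈ Set.Ioo (0 : ℝ) 1, 0 < (β t).im ∧ (β t).im < Real.pi := by
    rintro t ⟨ht0, ht1⟩
    rw [him]
    have h1t : 0 < 1 - t := by linarith
    constructor
    · rcases h0 with h | h
      · have := mul_pos h1t h; have := mul_nonneg ht0.le hb'; linarith
      · have := mul_nonneg h1t.le hb; have := mul_pos ht0 h; linarith
    · rcases hpi with h | h
      · have := mul_lt_mul_of_pos_left h h1t
        have := mul_le_mul_of_nonneg_left hb1' ht0.le
        linarith
      · have := mul_le_mul_of_nonneg_left hb1 h1t.le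
        have := mul_lt_mul_of_pos_left h ht0
        linarith
  have himexp : ∀ t ∈ Set.Ioo (0 : ℝ) 1, 0 < (Complex.exp (β t) - 2).im := by
    intro t ht
    obtain ⟨h1, h2⟩ := hin t ht
    simp only [Complex.sub_im, Complex.im_ofNat, sub_zero, Complex.exp_im]
    exact mul_pos (Real.exp_pos _) (Real.sin_pos_of_pos_of_lt_pi h1 h2)
  have hβ0 : β 0 = b := by simp [hβ]
  have hβ1 : β 1 = b' := by simp [hβ, hΔ]
  have hβc : Continuous β := by fun_prop
  have hexpim : ∀ t ∈ Set.Icc (0 : ℝ) 1, 0 ≤ (Complex.exp (β t) - 2).im := by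
    rintro t ⟨ht0, ht1⟩
    simp only [Complex.sub_im, Complex.im_ofNat, sub_zero, Complex.exp_im]
    refine mul_nonneg (Real.exp_pos _).le (Real.sin_nonneg_of_nonneg_of_le_pi ?_ ?_)
    · rw [him]
      have := mul_nonneg (sub_nonneg.2 ht1) hb; have := mul_nonneg ht0 hb'; linarith
    · rw [him]
      have := mul_le_mul_of_nonneg_left hb1 (sub_nonneg.2 ht1)
      have := mul_le_mul_of_nonneg_left hb1' ht0
      linarith
  have hexpne : ∀ t ∈ Set.Icc (0 : ℝ) 1, Complex.exp (β t) - 2 ≠ 0 := by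
    rintro t ⟨ht0, ht1⟩
    rcases eq_or_lt_of_le ht0 with rfl | h0'
    · rwa [hβ0]
    rcases eq_or_lt_of_le ht1 with rfl | h1'
    · rwa [hβ1]
    intro h
    have := himexp t ⟨h0', h1'⟩
    rw [h] at this; simp at this
  set q : ℝ → ℝ := fun t =>
    ((p * Complex.log (Complex.exp (β t) - 2) + n * β t) * (starRingEnd ℂ) Δ).im with hq
  have hqc : ContinuousOn q (Set.Icc 0 1) := by
    -- The endpoints of the segment may be mapped onto the branch cut. The principal argument takes
    -- the value π there, which is its limit from above, and the curve stays in the closed upper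
    -- half-plane.
    have hlog : ContinuousOn (fun t => Complex.log (Complex.exp (β t) - 2)) (Set.Icc 0 1) := by
      intro t ht
      refine ContinuousWithinAt.comp (t := {w : ℂ | 0 ≤ w.im})
        (f := fun t => Complex.exp (β t) - 2)
        (continuousWithinAt_log_upper (hexpne t ht)) ?_ hexpim
      exact (by fun_prop : Continuous fun t => Complex.exp (β t) - 2).continuousWithinAt
    exact Complex.continuous_im.comp_continuousOn
      (((continuousOn_const.mul hlog).add (continuousOn_const.mul hβc.continuousOn)).mul
        continuousOn_const)
  have hqd : ∀ t ∈ Set.Ioo (0 : ℝ) 1, HasDerivAt q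
      ((p * (Complex.exp (β t) * Δ / (Complex.exp (β t) - 2)) + n * Δ) *
        (starRingEnd ℂ) Δ).im t := by
    intro t ht
    have hβd : HasDerivAt β Δ t := by
      have : HasDerivAt (fun t : ℝ => (t : ℂ)) 1 t := Complex.ofRealCLM.hasDerivAt
      simpa [hβ] using (this.mul_const Δ).const_add b
    have he : HasDerivAt (fun t => Complex.exp (β t) - 2) (Complex.exp (β t) * Δ) t :=
      (hβd.cexp).sub_const 2
    have hl := he.clog_real (Complex.mem_slitPlane_iff.2 (Or.inr (himexp t ht).ne'))
    have hall := ((hl.const_mul (p : ℂ)).add (hβd.const_mul (n : ℂ))).mul_const ((starRingEnd ℂ) Δ)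
    exact (Complex.imCLM.hasFDerivAt.comp_hasDerivAt t hall)
  have hneg : ∀ t ∈ Set.Ioo (0 : ℝ) 1, deriv q t < 0 := by
    intro t ht
    rw [(hqd t ht).deriv]
    set E := Complex.exp (β t) - 2 with hE
    have hEim : 0 < E.im := himexp t ht
    have hEne : E ≠ 0 := fun h => by rw [h] at hEim; simp at hEim
    have hexpE : Complex.exp (β t) = E + 2 := by simp [hE]
    -- The derivative is Δ(p + n + 2p/E). Multiplied by the conjugate of Δ it becomes |Δ|² times a
    -- number whose imaginary part has the sign of Im(1/E), negative since Im E > 0.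
    have hrew : (p * (Complex.exp (β t) * Δ / E) + n * Δ) * (starRingEnd ℂ) Δ
        = ((Complex.normSq Δ : ℝ) : ℂ) * (((p + n : ℝ) : ℂ) + ((2 * p : ℝ) : ℂ) * E⁻¹) := by
      rw [← Complex.mul_conj, hexpE]; field_simp; push_cast; ring
    rw [hrew, Complex.im_ofReal_mul, Complex.add_im, Complex.ofReal_im, Complex.im_ofReal_mul,
      Complex.inv_im, zero_add]
    have h1 : 0 < Complex.normSq Δ := Complex.normSq_pos.2 hΔ0
    have h2 : 0 < Complex.normSq E := Complex.normSq_pos.2 hEne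
    have : -E.im / Complex.normSq E < 0 := div_neg_of_neg_of_pos (by linarith) h2
    exact mul_neg_of_pos_of_neg h1 (mul_neg_of_pos_of_neg (by linarith) this)
  have hanti : StrictAntiOn q (Set.Icc 0 1) :=
    strictAntiOn_of_deriv_neg (convex_Icc 0 1) hqc (by rwa [interior_Icc])
  have h := hanti (Set.left_mem_Icc.2 zero_le_one) (Set.right_mem_Icc.2 zero_le_one) one_pos
  simp only [hq, hβ0, hβ1] at h
  rw [sub_mul, Complex.sub_im]
  linarith

/-- The phase is strictly decreasing in `‖1 + u‖` on the part of a level line of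
`‖1 - u‖ ^ p * ‖1 + u‖ ^ (N - p)` in the closed upper half-plane. -/
theorem phase_antitone_upper {N p : ℕ} (hp : 0 < p) (hpN : p < N) {u v : ℂ} (huv : u ≠ v)
    (hu : 0 ≤ u.im) (hv : 0 ≤ v.im) (hu1 : u ≠ 1) (hv1 : v ≠ 1) (hu2 : u ≠ -1) (hv2 : v ≠ -1)
    (h0 : 0 < Complex.arg (u + 1) ∨ 0 < Complex.arg (v + 1))
    (hpi : Complex.arg (u + 1) < Real.pi ∨ Complex.arg (v + 1) < Real.pi)
    (hmod : ‖1 - u‖ ^ p * ‖1 + u‖ ^ (N - p) = ‖1 - v‖ ^ p * ‖1 + v‖ ^ (N - p)) :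
    (rootPhase N p v - rootPhase N p u) * (Real.log ‖1 + v‖ - Real.log ‖1 + u‖) < 0 := by
  have hu3 : u + 1 ≠ 0 := fun h => hu2 (eq_neg_of_add_eq_zero_left h)
  have hv3 : v + 1 ≠ 0 := fun h => hv2 (eq_neg_of_add_eq_zero_left h)
  have hu4 : u - 1 ≠ 0 := sub_ne_zero.2 hu1
  have hv4 : v - 1 ≠ 0 := sub_ne_zero.2 hv1
  have eu : Complex.exp (Complex.log (u + 1)) - 2 = u - 1 := by
    rw [Complex.exp_log hu3]; ring
  have ev : Complex.exp (Complex.log (v + 1)) - 2 = v - 1 := by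
    rw [Complex.exp_log hv3]; ring
  have hne : Complex.log (u + 1) ≠ Complex.log (v + 1) := by
    intro h
    have := congrArg Complex.exp h
    rw [Complex.exp_log hu3, Complex.exp_log hv3] at this
    exact huv (add_right_cancel this)
  have key := im_increment_neg (p := p) (n := (N : ℝ) - p) (Nat.cast_pos.2 hp) hne
    (by rw [Complex.log_im, Complex.arg_nonneg_iff]; simpa using hu)
    (by rw [Complex.log_im]; exact Complex.arg_le_pi _)
    (by rw [Complex.log_im, Complex.arg_nonneg_iff]; simpa using hv)
    (by rw [Complex.log_im]; exact Complex.arg_le_pi _)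
    (by simpa only [Complex.log_im] using h0) (by simpa only [Complex.log_im] using hpi)
    (by rwa [eu]) (by rwa [ev])
  rw [eu, ev] at key
  have hlog := congrArg Real.log hmod
  have pos : ∀ w : ℂ, w ≠ 0 → ‖w‖ ≠ 0 := fun w hw => norm_ne_zero_iff.2 hw
  have hsw : ∀ w : ℂ, ‖1 - w‖ = ‖w - 1‖ := fun w => norm_sub_rev _ _
  have hsw' : ∀ w : ℂ, ‖1 + w‖ = ‖w + 1‖ := fun w => by rw [add_comm]
  simp only [hsw, hsw'] at hlog ⊢
  rw [Real.log_mul (pow_ne_zero _ (pos _ hu4)) (pow_ne_zero _ (pos _ hu3)),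
    Real.log_mul (pow_ne_zero _ (pos _ hv4)) (pow_ne_zero _ (pos _ hv3)),
    Real.log_pow, Real.log_pow, Real.log_pow, Real.log_pow, Nat.cast_sub hpN.le] at hlog
  simp only [Complex.mul_im, Complex.sub_im, Complex.add_im, Complex.sub_re, Complex.add_re,
    Complex.mul_re, Complex.ofReal_re, Complex.ofReal_im, Complex.log_re, Complex.log_im,
    Complex.conj_re, Complex.conj_im, zero_mul, add_zero, sub_zero] at key
  set A := Real.log ‖v - 1‖
  set B := Real.log ‖v + 1‖
  set A' := Real.log ‖u - 1‖
  set B' := Real.log ‖u + 1‖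
  have hF : ∀ w : ℂ, rootPhase N p w
      = (p * Complex.arg (w - 1) + ((N : ℝ) - p) * Complex.arg (w + 1)) / Real.pi := by
    intro w; unfold rootPhase; ring
  rw [hF, hF, ← sub_div, div_mul_eq_mul_div]
  refine div_neg_of_neg_of_pos ?_ Real.pi_pos
  -- On a level line the real part of the increment vanishes, so `key` is left with the product of
  -- the increments of πF and of log|1 + u|.
  have h5 : (p * A + ((N : ℝ) - p) * B) - (p * A' + ((N : ℝ) - p) * B') = 0 := by linarith
  rw [h5, zero_mul, zero_add] at key
  exact key

/-! ### Range and symmetry of the phase -/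

/-- `u` does not lie on the segment `[-1, 1]`. -/
def OffSegment (u : ℂ) : Prop := u.im ≠ 0 ∨ 1 < u.re ∨ u.re < -1

theorem OffSegment.ne_one {u : ℂ} (h : OffSegment u) : u ≠ 1 := by
  rintro rfl; rcases h with h | h | h <;> norm_num at h

theorem OffSegment.ne_neg_one {u : ℂ} (h : OffSegment u) : u ≠ -1 := by
  rintro rfl; rcases h with h | h | h <;> norm_num at h

theorem OffSegment.conj {u : ℂ} (h : OffSegment u) : OffSegment ((starRingEnd ℂ) u) := by
  simpa [OffSegment] using h

theorem rootPhase_eq (N p : ℕ) (u : ℂ) : rootPhase N p u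
    = (p * Complex.arg (u - 1) + ((N : ℝ) - p) * Complex.arg (u + 1)) / Real.pi := by
  unfold rootPhase; ring

theorem rootPhase_pos {N p : ℕ} (hp : 0 < p) (hpN : p < N) {u : ℂ} (hu : 0 < u.im) :
    0 < rootPhase N p u := by
  have h1 : 0 < Complex.arg (u - 1) := by
    refine lt_of_le_of_ne (Complex.arg_nonneg_iff.2 (by simpa using hu.le)) (fun h => ?_)
    have := (Complex.arg_eq_zero_iff.1 h.symm).2
    simp at this; linarith
  have h2 : 0 ≤ Complex.arg (u + 1) := Complex.arg_nonneg_iff.2 (by simpa using hu.le)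
  have hN : (0 : ℝ) < (N : ℝ) - p := sub_pos.2 (Nat.cast_lt.2 hpN)
  have hp' : (0 : ℝ) < p := Nat.cast_pos.2 hp
  rw [rootPhase_eq]
  have := Real.pi_pos
  positivity

theorem rootPhase_lt {N p : ℕ} (hp : 0 < p) (hpN : p < N) {u : ℂ} (hu : 0 < u.im) :
    rootPhase N p u < N := by
  have h1 : Complex.arg (u - 1) < Real.pi := by
    refine lt_of_le_of_ne (Complex.arg_le_pi _) (fun h => ?_)
    have := (Complex.arg_eq_pi_iff.1 h).2
    simp at this; linarith
  have h2 := Complex.arg_le_pi (u + 1)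
  have hN : (0 : ℝ) < (N : ℝ) - p := sub_pos.2 (Nat.cast_lt.2 hpN)
  have hp' : (0 : ℝ) < p := Nat.cast_pos.2 hp
  rw [rootPhase_eq, div_lt_iff₀ Real.pi_pos]
  have := mul_lt_mul_of_pos_left h1 hp'
  have := mul_le_mul_of_nonneg_left h2 hN.le
  linarith

theorem rootPhase_conj (N p : ℕ) {u : ℂ} (hu : u.im ≠ 0) :
    rootPhase N p ((starRingEnd ℂ) u) = -rootPhase N p u := by
  have h : ∀ c : ℝ, Complex.arg ((starRingEnd ℂ) u + c) = -Complex.arg (u + c) := by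
    intro c
    have : (starRingEnd ℂ) u + c = (starRingEnd ℂ) (u + c) := by simp
    rw [this, Complex.arg_conj, if_neg]
    intro h
    have := (Complex.arg_eq_pi_iff.1 h).2
    simp at this; exact hu this
  have h1 := h 1
  have h2 := h (-1)
  simp only [Complex.ofReal_neg, Complex.ofReal_one, ← sub_eq_add_neg] at h1 h2
  rw [rootPhase_eq, rootPhase_eq, h1, h2]; ring

theorem rootPhase_of_one_lt (N p : ℕ) {u : ℂ} (hu : u.im = 0) (h : 1 < u.re) :
    rootPhase N p u = 0 := by
  have h1 : Complex.arg (u - 1) = 0 :=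
    Complex.arg_eq_zero_iff.2 ⟨by simp; linarith, by simpa using hu⟩
  have h2 : Complex.arg (u + 1) = 0 :=
    Complex.arg_eq_zero_iff.2 ⟨by simp; linarith, by simpa using hu⟩
  rw [rootPhase_eq, h1, h2]; simp

theorem rootPhase_of_lt_neg_one (N p : ℕ) {u : ℂ} (hu : u.im = 0) (h : u.re < -1) :
    rootPhase N p u = N := by
  have h1 : Complex.arg (u - 1) = Real.pi :=
    Complex.arg_eq_pi_iff.2 ⟨by simp; linarith, by simpa using hu⟩
  have h2 : Complex.arg (u + 1) = Real.pi :=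
    Complex.arg_eq_pi_iff.2 ⟨by simp; linarith, by simpa using hu⟩
  rw [rootPhase_eq, h1, h2]
  have := Real.pi_pos
  field_simp; ring

theorem rootPhase_neg {N p : ℕ} (hp : 0 < p) (hpN : p < N) {u : ℂ} (hu : u.im < 0) :
    rootPhase N p u < 0 := by
  have := rootPhase_pos (N := N) hp hpN (u := (starRingEnd ℂ) u) (by simpa using hu)
  rw [rootPhase_conj N p hu.ne] at this; linarith

theorem neg_lt_rootPhase {N p : ℕ} (hp : 0 < p) (hpN : p < N) {u : ℂ} (hu : OffSegment u) :
    -(N : ℝ) < rootPhase N p u := by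
  have hN : (0 : ℝ) < N := Nat.cast_pos.2 (hp.trans hpN)
  rcases lt_trichotomy u.im 0 with h | h | h
  · have := rootPhase_lt (N := N) hp hpN (u := (starRingEnd ℂ) u) (by simpa using h)
    rw [rootPhase_conj N p h.ne] at this; linarith
  · rcases hu with hu | hu | hu
    · exact absurd h hu
    · rw [rootPhase_of_one_lt N p h hu]; linarith
    · rw [rootPhase_of_lt_neg_one N p h hu]; linarith
  · have := rootPhase_pos (N := N) hp hpN h; linarith

theorem rootPhase_le {N p : ℕ} (hp : 0 < p) (hpN : p < N) {u : ℂ} (hu : OffSegment u) :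
    rootPhase N p u ≤ N := by
  have hN : (0 : ℝ) < N := Nat.cast_pos.2 (hp.trans hpN)
  rcases lt_trichotomy u.im 0 with h | h | h
  · have := rootPhase_neg hp hpN h; linarith
  · rcases hu with hu | hu | hu
    · exact absurd h hu
    · rw [rootPhase_of_one_lt N p h hu]; linarith
    · rw [rootPhase_of_lt_neg_one N p h hu]
  · exact (rootPhase_lt hp hpN h).le

/-- The reflection of `u` to the closed upper half-plane. -/
def reflectUp (u : ℂ) : ℂ := if u.im < 0 then (starRingEnd ℂ) u else u

theorem reflectUp_im_nonneg (u : ℂ) : 0 ≤ (reflectUp u).im := by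
  unfold reflectUp; split_ifs with h
  · simpa using h.le
  · exact not_lt.1 h

theorem OffSegment.reflectUp {u : ℂ} (h : OffSegment u) : OffSegment (reflectUp u) := by
  unfold TASEP.reflectUp; split_ifs
  · exact h.conj
  · exact h

theorem norm_one_add_reflectUp (u : ℂ) : ‖1 + reflectUp u‖ = ‖1 + u‖ := by
  unfold reflectUp; split_ifs
  · rw [← Complex.norm_conj]; simp
  · rfl

theorem norm_one_sub_reflectUp (u : ℂ) : ‖1 - reflectUp u‖ = ‖1 - u‖ := by
  unfold reflectUp; split_ifs
  · rw [← Complex.norm_conj]; simp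
  · rfl

theorem rootPhase_reflectUp {N p : ℕ} (hp : 0 < p) (hpN : p < N) {u : ℂ} (hu : OffSegment u) :
    rootPhase N p (reflectUp u) = |rootPhase N p u| := by
  unfold reflectUp; split_ifs with h
  · rw [rootPhase_conj N p h.ne, abs_of_neg (rootPhase_neg hp hpN h)]
  · rw [abs_of_nonneg]
    rcases (not_lt.1 h).lt_or_eq with h | h
    · exact (rootPhase_pos hp hpN h).le
    · rcases hu with hu | hu | hu
      · exact absurd h.symm hu
      · rw [rootPhase_of_one_lt N p h.symm hu]
      · rw [rootPhase_of_lt_neg_one N p h.symm hu]; positivity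

theorem OffSegment.of_arg_eq_zero {u : ℂ} (h : OffSegment u) (ha : Complex.arg (u + 1) = 0) :
    u.im = 0 ∧ 1 < u.re := by
  obtain ⟨h1, h2⟩ := Complex.arg_eq_zero_iff.1 ha
  simp at h1 h2
  rcases h with h | h | h
  · exact absurd h2 h
  · exact ⟨h2, h⟩
  · linarith

theorem OffSegment.of_arg_eq_pi {u : ℂ} (h : OffSegment u) (ha : Complex.arg (u + 1) = Real.pi) :
    u.im = 0 ∧ u.re < -1 := by
  obtain ⟨h1, h2⟩ := Complex.arg_eq_pi_iff.1 ha
  simp at h1 h2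
  rcases h with h | h | h
  · exact absurd h2 h
  · linarith
  · exact ⟨h2, h⟩

/-- On a level line of the modulus, `‖1 + u‖` decreases with the absolute phase. -/
theorem norm_one_add_lt_of_abs_phase_lt {N p : ℕ} (hp : 0 < p) (hpN : p < N) {u v : ℂ}
    (hu : OffSegment u) (hv : OffSegment v)
    (hmod : ‖1 - u‖ ^ p * ‖1 + u‖ ^ (N - p) = ‖1 - v‖ ^ p * ‖1 + v‖ ^ (N - p))
    (hF : |rootPhase N p u| < |rootPhase N p v|) : ‖1 + v‖ < ‖1 + u‖ := by
  rw [← rootPhase_reflectUp hp hpN hu, ← rootPhase_reflectUp hp hpN hv] at hF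
  rw [← norm_one_add_reflectUp u, ← norm_one_add_reflectUp v, ← norm_one_sub_reflectUp u,
    ← norm_one_sub_reflectUp v] at hmod
  rw [← norm_one_add_reflectUp u, ← norm_one_add_reflectUp v]
  have hu' := hu.reflectUp
  have hv' := hv.reflectUp
  have hui := reflectUp_im_nonneg u
  have hvi := reflectUp_im_nonneg v
  generalize reflectUp u = u at *
  generalize reflectUp v = v at *
  have hne : u ≠ v := by rintro rfl; exact lt_irrefl _ hF
  have hau : 0 ≤ Complex.arg (u + 1) := Complex.arg_nonneg_iff.2 (by simpa using hui)
  have hav : 0 ≤ Complex.arg (v + 1) := Complex.arg_nonneg_iff.2 (by simpa using hvi)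
  -- The excluded configurations have both points on the same real ray beyond 1 or -1. The phase is
  -- constant along such a ray, against the strict inequality `hF`.
  have key := phase_antitone_upper hp hpN hne hui hvi hu'.ne_one hv'.ne_one hu'.ne_neg_one
    hv'.ne_neg_one
    (by
      by_contra! h
      obtain ⟨h1, h2⟩ := hu'.of_arg_eq_zero (le_antisymm h.1 hau)
      obtain ⟨h3, h4⟩ := hv'.of_arg_eq_zero (le_antisymm h.2 hav)
      rw [rootPhase_of_one_lt N p h1 h2, rootPhase_of_one_lt N p h3 h4] at hF
      exact lt_irrefl _ hF)
    (by
      by_contra! h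
      obtain ⟨h1, h2⟩ := hu'.of_arg_eq_pi (le_antisymm (Complex.arg_le_pi _) h.1)
      obtain ⟨h3, h4⟩ := hv'.of_arg_eq_pi (le_antisymm (Complex.arg_le_pi _) h.2)
      rw [rootPhase_of_lt_neg_one N p h1 h2, rootPhase_of_lt_neg_one N p h3 h4] at hF
      exact lt_irrefl _ hF) hmod
  have hlog : Real.log ‖1 + v‖ < Real.log ‖1 + u‖ := by
    by_contra! h
    exact absurd key (not_lt.2 (mul_nonneg (sub_pos.2 hF).le (sub_nonneg.2 h)))
  refine (Real.log_lt_log_iff (norm_pos_iff.2 fun h => hv'.ne_neg_one ?_)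
    (norm_pos_iff.2 fun h => hu'.ne_neg_one ?_)).1 hlog
  · exact eq_neg_of_add_eq_zero_right h
  · exact eq_neg_of_add_eq_zero_right h

/-- On a level line of the modulus, the phase is injective off `[-1, 1]`. -/
theorem eq_of_phase_eq {N p : ℕ} (hp : 0 < p) (hpN : p < N) {u v : ℂ}
    (hu : OffSegment u) (hv : OffSegment v)
    (hmod : ‖1 - u‖ ^ p * ‖1 + u‖ ^ (N - p) = ‖1 - v‖ ^ p * ‖1 + v‖ ^ (N - p))
    (hF : rootPhase N p u = rootPhase N p v) : u = v := by
  -- Monotonicity settles everything except two points on the same real ray beyond ±1. There both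
  -- moduli grow with the distance from the origin, so a level line meets each ray only once.
  have upper : ∀ u v : ℂ, OffSegment u → OffSegment v → 0 ≤ u.im → 0 ≤ v.im →
      ‖1 - u‖ ^ p * ‖1 + u‖ ^ (N - p) = ‖1 - v‖ ^ p * ‖1 + v‖ ^ (N - p) →
      rootPhase N p u = rootPhase N p v → u = v := by
    intro u v hu hv hui hvi hmod hF
    by_contra hne
    have hau : 0 ≤ Complex.arg (u + 1) := Complex.arg_nonneg_iff.2 (by simpa using hui)
    have hav : 0 ≤ Complex.arg (v + 1) := Complex.arg_nonneg_iff.2 (by simpa using hvi)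
    have hmono : ∀ x y a b : ℝ, 0 < x → 0 < y → x < a → y < b →
        x ^ p * y ^ (N - p) < a ^ p * b ^ (N - p) := by
      intro x y a b hx hy hxa hyb
      exact mul_lt_mul'' (pow_lt_pow_left₀ hxa hx.le hp.ne')
        (pow_lt_pow_left₀ hyb hy.le (Nat.sub_pos_of_lt hpN).ne') (by positivity) (by positivity)
    have hreal : ∀ w : ℂ, w.im = 0 → ‖1 - w‖ = |1 - w.re| ∧ ‖1 + w‖ = |1 + w.re| := by
      intro w hw
      have : w = (w.re : ℂ) := Complex.ext rfl (by simpa using hw)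
      constructor
      · rw [this]; rw [← Complex.ofReal_one, ← Complex.ofReal_sub, Complex.norm_real]; simp
      · rw [this]; rw [← Complex.ofReal_one, ← Complex.ofReal_add, Complex.norm_real]; simp
    by_cases h0 : 0 < Complex.arg (u + 1) ∨ 0 < Complex.arg (v + 1)
    · by_cases hpi : Complex.arg (u + 1) < Real.pi ∨ Complex.arg (v + 1) < Real.pi
      · have key := phase_antitone_upper hp hpN hne hui hvi hu.ne_one hv.ne_one hu.ne_neg_one
          hv.ne_neg_one h0 hpi hmod
        rw [hF] at key; simp at key
      · push Not at hpi
        obtain ⟨h1, h2⟩ := hu.of_arg_eq_pi (le_antisymm (Complex.arg_le_pi _) hpi.1)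
        obtain ⟨h3, h4⟩ := hv.of_arg_eq_pi (le_antisymm (Complex.arg_le_pi _) hpi.2)
        rw [(hreal u h1).1, (hreal u h1).2, (hreal v h3).1, (hreal v h3).2,
          abs_of_pos (by linarith : 0 < 1 - u.re), abs_of_pos (by linarith : 0 < 1 - v.re),
          abs_of_neg (by linarith : 1 + u.re < 0), abs_of_neg (by linarith : 1 + v.re < 0)] at hmod
        rcases lt_trichotomy u.re v.re with h | h | h
        · have := hmono (1 - v.re) (-(1 + v.re)) (1 - u.re) (-(1 + u.re)) (by linarith)
            (by linarith) (by linarith) (by linarith)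
          linarith
        · exact hne (Complex.ext h (h1.trans h3.symm))
        · have := hmono (1 - u.re) (-(1 + u.re)) (1 - v.re) (-(1 + v.re)) (by linarith)
            (by linarith) (by linarith) (by linarith)
          linarith
    · push Not at h0
      obtain ⟨h1, h2⟩ := hu.of_arg_eq_zero (le_antisymm h0.1 hau)
      obtain ⟨h3, h4⟩ := hv.of_arg_eq_zero (le_antisymm h0.2 hav)
      rw [(hreal u h1).1, (hreal u h1).2, (hreal v h3).1, (hreal v h3).2,
        abs_of_neg (by linarith : 1 - u.re < 0), abs_of_neg (by linarith : 1 - v.re < 0),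
        abs_of_pos (by linarith : 0 < 1 + u.re), abs_of_pos (by linarith : 0 < 1 + v.re)] at hmod
      rcases lt_trichotomy u.re v.re with h | h | h
      · have := hmono (-(1 - u.re)) (1 + u.re) (-(1 - v.re)) (1 + v.re) (by linarith)
          (by linarith) (by linarith) (by linarith)
        linarith
      · exact hne (Complex.ext h (h1.trans h3.symm))
      · have := hmono (-(1 - v.re)) (1 + v.re) (-(1 - u.re)) (1 + u.re) (by linarith)
          (by linarith) (by linarith) (by linarith)
        linarith
  have hup := upper _ _ hu.reflectUp hv.reflectUp (reflectUp_im_nonneg u) (reflectUp_im_nonneg v)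
    (by rw [norm_one_add_reflectUp, norm_one_add_reflectUp, norm_one_sub_reflectUp,
          norm_one_sub_reflectUp, hmod])
    (by rw [rootPhase_reflectUp hp hpN hu, rootPhase_reflectUp hp hpN hv, hF])
  have hsign : ∀ w : ℂ, OffSegment w → (w.im < 0 ↔ rootPhase N p w < 0) := by
    intro w hw
    refine ⟨rootPhase_neg hp hpN, fun h => ?_⟩
    by_contra h'
    have := rootPhase_reflectUp hp hpN hw
    rw [reflectUp, if_neg h'] at this
    have := abs_nonneg (rootPhase N p w)
    linarith
  have hiff : u.im < 0 ↔ v.im < 0 := by rw [hsign u hu, hsign v hv, hF]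
  unfold reflectUp at hup
  by_cases h : u.im < 0
  · rw [if_pos h, if_pos (hiff.1 h)] at hup
    exact (starRingEnd ℂ).injective hup
  · rwa [if_neg h, if_neg (fun h' => h (hiff.2 h'))] at hup

/-! ### The labelled roots off the positive axis -/

/-- On [-1, 1] both factors are real and nonnegative, so only values C ≥ 0 occur there, and these
are excluded. -/
theorem offSegment_of_root {N p : ℕ} {C u : ℂ} (hC : -C ∈ Complex.slitPlane)
    (hu : (1 - u) ^ p * (1 + u) ^ (N - p) = C) : OffSegment u := by
  by_contra h
  unfold OffSegment at h
  push Not at h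
  obtain ⟨h1, h2, h3⟩ := h
  have hur : u = (u.re : ℂ) := Complex.ext rfl (by simpa using h1)
  have : C = (((1 - u.re) ^ p * (1 + u.re) ^ (N - p) : ℝ) : ℂ) := by
    rw [← hu, hur]; push_cast; simp
  have hnn : 0 ≤ (1 - u.re) ^ p * (1 + u.re) ^ (N - p) :=
    mul_nonneg (pow_nonneg (by linarith) _) (pow_nonneg (by linarith) _)
  rw [this, Complex.mem_slitPlane_iff] at hC
  simp only [Complex.neg_re, Complex.neg_im, Complex.ofReal_re, Complex.ofReal_im] at hC
  rcases hC with hC | hC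
  · linarith
  · simp at hC

theorem norm_of_root {N p : ℕ} {C u : ℂ} (hu : (1 - u) ^ p * (1 + u) ^ (N - p) = C) :
    ‖1 - u‖ ^ p * ‖1 + u‖ ^ (N - p) = ‖C‖ := by
  rw [← hu, norm_mul, norm_pow, norm_pow]

/-- The normalised phase of `-C`, in `(-1, 1)` off the positive axis. -/
def slitAngle (C : ℂ) : ℝ := Complex.arg (-C) / Real.pi

theorem slitAngle_mem {C : ℂ} (hC : -C ∈ Complex.slitPlane) :
    -1 < slitAngle C ∧ slitAngle C < 1 := by
  unfold slitAngle
  rw [lt_div_iff₀ Real.pi_pos, div_lt_iff₀ Real.pi_pos]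
  have h := (Complex.mem_slitPlane_iff_arg.1 hC).1
  have h1 := Complex.neg_pi_lt_arg (-C)
  have h2 := lt_of_le_of_ne (Complex.arg_le_pi (-C)) h
  constructor <;> linarith

/-- Since (u - 1)^p (u + 1)^(N - p) = (-1)^p C, comparing imaginary parts of logarithms gives πF
modulo 2π. Writing C as -(-C) uses an argument that is continuous off the positive axis. -/
theorem exists_rootPhase_eq {N p : ℕ} (hpN : p < N) {C u : ℂ} (hC : -C ∈ Complex.slitPlane)
    (hu : (1 - u) ^ p * (1 + u) ^ (N - p) = C) :
    ∃ m : ℤ, rootPhase N p u = -(p : ℝ) + 1 + slitAngle C + 2 * m := by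
  have hoff := offSegment_of_root hC hu
  have h1 : u - 1 ≠ 0 := sub_ne_zero.2 hoff.ne_one
  have h2 : u + 1 ≠ 0 := fun h => hoff.ne_neg_one (eq_neg_of_add_eq_zero_left h)
  have hC0 : -C ≠ 0 := Complex.slitPlane_ne_zero hC
  have e : Complex.exp (p * Complex.log (u - 1) + (N - p : ℕ) * Complex.log (u + 1))
      = Complex.exp (Real.pi * Complex.I + p * (-(Real.pi * Complex.I)) + Complex.log (-C)) := by
    rw [Complex.exp_add, Complex.exp_add, Complex.exp_add, Complex.exp_nat_mul,
      Complex.exp_nat_mul, Complex.exp_nat_mul, Complex.exp_log h1, Complex.exp_log h2,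
      Complex.exp_log hC0, Complex.exp_neg, Complex.exp_pi_mul_I, ← hu,
      show (1 - u) = (-1) * (u - 1) by ring, mul_pow, inv_neg, inv_one, add_comm 1 u]
    have : ((-1 : ℂ) ^ p) * (-1) ^ p = 1 := by rw [← mul_pow]; simp
    linear_combination (-(u - 1) ^ p * (u + 1) ^ (N - p)) * this
  obtain ⟨m, hm⟩ := Complex.exp_eq_exp_iff_exists_int.1 e
  refine ⟨m, ?_⟩
  have him := congrArg Complex.im hm
  simp [Complex.add_im, Complex.mul_im, Complex.log_im] at him
  rw [Nat.cast_sub hpN.le] at him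
  rw [rootPhase_eq, slitAngle, div_eq_iff Real.pi_pos.ne', him]
  have := Real.pi_pos.ne'
  field_simp
  ring

/-- The possible phases form a lattice of step 2, offset by an angle strictly between -1 and 1. A
half-open interval of length 2 therefore contains exactly one of them, in its interior. -/
theorem inPhaseInterval_iff {N p j : ℕ} (hpN : p < N) {C u : ℂ} (hC : -C ∈ Complex.slitPlane)
    (hu : (1 - u) ^ p * (1 + u) ^ (N - p) = C) :
    InPhaseInterval N p j (rootPhase N p u) ↔
      ∃ k : ℤ, rootPhase N p u + 2 * (N : ℝ) * k = -(p : ℝ) + 2 * j - 1 + slitAngle C := by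
  obtain ⟨m, hm⟩ := exists_rootPhase_eq hpN hC hu
  obtain ⟨h1, h2⟩ := slitAngle_mem hC
  refine exists_congr fun k => ⟨fun h => ?_, fun h => ?_⟩
  · rw [hm] at h ⊢
    obtain ⟨h3, h4⟩ := h
    have h5 : ((m + N * k : ℤ) : ℝ) < ((j : ℤ) : ℝ) := by push_cast; linarith
    have h6 : ((j : ℤ) : ℝ) < ((m + N * k + 2 : ℤ) : ℝ) := by push_cast; linarith
    have h5' := Int.cast_lt.1 h5
    have h6' := Int.cast_lt.1 h6
    have h7 : (j : ℤ) = m + N * k + 1 := by omega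
    have h8 : (j : ℝ) = m + N * k + 1 := by exact_mod_cast h7
    rw [h8]; ring
  · rw [h]; constructor <;> linarith

/-- Equal labels make the phases congruent modulo 2N; both lie in (-N, N], so they coincide, and the
phase is injective on the level line. -/
theorem root_unique {N p j : ℕ} (hp : 0 < p) (hpN : p < N) {C u v : ℂ}
    (hC : -C ∈ Complex.slitPlane)
    (hu : (1 - u) ^ p * (1 + u) ^ (N - p) = C) (hv : (1 - v) ^ p * (1 + v) ^ (N - p) = C)
    (hju : InPhaseInterval N p j (rootPhase N p u))
    (hjv : InPhaseInterval N p j (rootPhase N p v)) : u = v := by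
  have hou := offSegment_of_root hC hu
  have hov := offSegment_of_root hC hv
  obtain ⟨k, hk⟩ := (inPhaseInterval_iff hpN hC hu).1 hju
  obtain ⟨l, hl⟩ := (inPhaseInterval_iff hpN hC hv).1 hjv
  refine eq_of_phase_eq hp hpN hou hov (by rw [norm_of_root hu, norm_of_root hv]) ?_
  have h1 := neg_lt_rootPhase (N := N) hp hpN hou
  have h2 := rootPhase_le (N := N) hp hpN hou
  have h3 := neg_lt_rootPhase (N := N) hp hpN hov
  have h4 := rootPhase_le (N := N) hp hpN hov
  have hN : (0 : ℝ) < N := Nat.cast_pos.2 (hp.trans hpN)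
  have h5 : (N : ℝ) * (k - l) < N * 1 := by linarith
  have h6 : (N : ℝ) * (-1) < N * (k - l) := by linarith
  have h5' := lt_of_mul_lt_mul_left h5 hN.le
  have h6' := lt_of_mul_lt_mul_left h6 hN.le
  have h7 : k - l < 1 := by exact_mod_cast h5'
  have h8 : -1 < k - l := by exact_mod_cast h6'
  have h9 : k = l := by omega
  rw [h9] at hk; linarith

/-! ### Simplicity of the roots and existence of every label -/

open Polynomial in
/-- The polynomial `(1 - u)^p (1 + u)^(N - p) - C`. -/
def bethePoly (N p : ℕ) (C : ℂ) : ℂ[X] :=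
  (1 - X) ^ p * (1 + X) ^ (N - p) - Polynomial.C C

theorem bethePoly_eval (N p : ℕ) (C u : ℂ) :
    (bethePoly N p C).eval u = (1 - u) ^ p * (1 + u) ^ (N - p) - C := by
  simp [bethePoly]

open Polynomial in
theorem bethePoly_natDegree {N p : ℕ} (hpN : p < N) (C : ℂ) :
    (bethePoly N p C).natDegree = N := by
  unfold bethePoly
  rw [natDegree_sub_C]
  have h1 : (1 - X : ℂ[X]).natDegree = 1 := by
    rw [show (1 - X : ℂ[X]) = -(X - Polynomial.C 1) by simp, natDegree_neg, natDegree_X_sub_C]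
  have h2 : (1 + X : ℂ[X]).natDegree = 1 := by
    rw [show (1 + X : ℂ[X]) = X + Polynomial.C 1 by simp [add_comm], natDegree_X_add_C]
  rw [natDegree_mul, natDegree_pow, natDegree_pow, h1, h2]
  · omega
  · exact pow_ne_zero _ (by rintro h; rw [h] at h1; simp at h1)
  · exact pow_ne_zero _ (by rintro h; rw [h] at h2; simp at h2)

open Polynomial in
-- A multiple root is a critical point. Besides ±1, which are roots only for C = 0, the only
-- critical point is 1 - 2p/N, on the excluded segment.
theorem bethePoly_roots_nodup {N p : ℕ} (hp : 0 < p) (hpN : p < N) {C : ℂ}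
    (hC : -C ∈ Complex.slitPlane) : (bethePoly N p C).roots.Nodup := by
  have hne : bethePoly N p C ≠ 0 := by
    intro h; have := bethePoly_natDegree hpN C; rw [h] at this; simp at this; omega
  rw [Multiset.nodup_iff_count_le_one]
  intro u
  rw [count_roots]
  by_contra! h
  obtain ⟨h1, h2⟩ := (one_lt_rootMultiplicity_iff_isRoot hne).1 h
  have hQ : (1 - u) ^ p * (1 + u) ^ (N - p) = C := by
    have := h1.eq_zero; rw [bethePoly_eval] at this; exact sub_eq_zero.1 this
  have hoff := offSegment_of_root hC hQ
  have hC0 : C ≠ 0 := by rintro rfl; simp at hC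
  have h3 : (-(p : ℂ)) * (1 + u) + ((N - p : ℕ) : ℂ) * (1 - u) = 0 := by
    have hd := h2.eq_zero
    simp [bethePoly, derivative_mul, derivative_pow] at hd
    obtain ⟨q, rfl⟩ : ∃ q, p = q + 1 := ⟨p - 1, by omega⟩
    obtain ⟨n, hn⟩ : ∃ n, N - (q + 1) = n + 1 := ⟨N - (q + 1) - 1, by omega⟩
    rw [hn] at hd hQ ⊢
    simp only [Nat.add_sub_cancel] at hd
    have : C * ((-((q + 1 : ℕ) : ℂ)) * (1 + u) + ((n + 1 : ℕ) : ℂ) * (1 - u)) = 0 := by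
      rw [← hQ]
      push_cast at hd ⊢
      linear_combination ((1 - u) * (1 + u)) * hd
    exact (mul_eq_zero.1 this).resolve_left hC0
  rw [Nat.cast_sub hpN.le] at h3
  have hN : (N : ℂ) ≠ 0 := Nat.cast_ne_zero.2 (by omega)
  have hN' : (0 : ℝ) < N := Nat.cast_pos.2 (by omega)
  have hpN' : (p : ℝ) < N := Nat.cast_lt.2 hpN
  have hp' : (0 : ℝ) < p := Nat.cast_pos.2 hp
  have hu : u = ((1 - 2 * p / N : ℝ) : ℂ) := by
    push_cast; field_simp; linear_combination -h3
  have h4 : (p : ℝ) / N < 1 := (div_lt_one hN').2 hpN'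
  have h5 : 0 < (p : ℝ) / N := div_pos hp' hN'
  rw [hu] at hoff
  rcases hoff with h | h | h
  · simp at h
  · rw [Complex.ofReal_re, mul_div_assoc] at h; linarith
  · rw [Complex.ofReal_re, mul_div_assoc] at h; linarith

open Polynomial in
-- A counting argument: there are N distinct roots, the lattice index of the phase modulo N
-- separates them by `root_unique`, so all N residues are attained.
theorem exists_labelled_root {N p j : ℕ} (hp : 0 < p) (hpN : p < N) {C : ℂ}
    (hC : -C ∈ Complex.slitPlane) (hj : 1 ≤ j) (hjN : j ≤ N) :
    ∃ u : ℂ, (1 - u) ^ p * (1 + u) ^ (N - p) = C ∧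
      InPhaseInterval N p j (rootPhase N p u) := by
  classical
  have hdeg := bethePoly_natDegree hpN C
  have hne : bethePoly N p C ≠ 0 := by
    intro h; rw [h] at hdeg; simp at hdeg; omega
  set R := (bethePoly N p C).roots.toFinset with hR
  have hcard : R.card = N := by
    rw [hR, Multiset.toFinset_card_of_nodup (bethePoly_roots_nodup hp hpN hC),
      IsAlgClosed.card_roots_eq_natDegree, hdeg]
  have hmem : ∀ u ∈ R, (1 - u) ^ p * (1 + u) ^ (N - p) = C := by
    intro u hu
    rw [hR, Multiset.mem_toFinset, mem_roots hne, IsRoot.def, bethePoly_eval] at hu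
    exact sub_eq_zero.1 hu
  choose! m hm using fun u (hu : (1 - u) ^ p * (1 + u) ^ (N - p) = C) =>
    exists_rootPhase_eq hpN hC hu
  have hNpos : (0 : ℤ) < N := by omega
  have himg : R.image (fun u => (m u % N).toNat) = Finset.range N := by
    refine Finset.eq_of_subset_of_card_le ?_ ?_
    · intro i hi
      obtain ⟨u, -, rfl⟩ := Finset.mem_image.1 hi
      have h1 := Int.emod_nonneg (m u) hNpos.ne'
      have h2 := Int.emod_lt_of_pos (m u) hNpos
      rw [Finset.mem_range]; omega
    · rw [Finset.card_image_of_injOn, hcard, Finset.card_range]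
      intro u hu v hv huv
      have h1 := Int.emod_nonneg (m u) hNpos.ne'
      have h2 := Int.emod_nonneg (m v) hNpos.ne'
      have h3 : m u % N = m v % N := by simp only at huv; omega
      have h4 := Int.mul_ediv_add_emod (m u) N
      have h5 := Int.mul_ediv_add_emod (m v) N
      have h6 := Int.emod_lt_of_pos (m u) hNpos
      have label : ∀ w ∈ R, m w % N = m u % N →
          InPhaseInterval N p ((m u % N).toNat + 1) (rootPhase N p w) := by
        intro w hw hwu
        refine (inPhaseInterval_iff hpN hC (hmem w hw)).2 ⟨-(m w / N), ?_⟩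
        have h7 := Int.mul_ediv_add_emod (m w) N
        have h8 : (((m u % N).toNat + 1 : ℕ) : ℝ) = (m w : ℝ) - N * (m w / N : ℤ) + 1 := by
          have : (((m u % N).toNat + 1 : ℕ) : ℤ) = m w - N * (m w / N) + 1 := by
            push_cast; omega
          exact_mod_cast this
        rw [hm w (hmem w hw), h8]; push_cast; ring
      exact root_unique hp hpN hC (hmem u hu) (hmem v hv) (label u hu rfl) (label v hv h3.symm)
  have hj' : j - 1 ∈ R.image (fun u => (m u % N).toNat) := by
    rw [himg, Finset.mem_range]; omega
  obtain ⟨u, hu, hju⟩ := Finset.mem_image.1 hj'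
  refine ⟨u, hmem u hu, (inPhaseInterval_iff hpN hC (hmem u hu)).2 ⟨-(m u / N), ?_⟩⟩
  have h1 := Int.emod_nonneg (m u) hNpos.ne'
  have h7 := Int.mul_ediv_add_emod (m u) N
  have h8 : (j : ℝ) = (m u : ℝ) - N * (m u / N : ℤ) + 1 := by
    have : (j : ℤ) = m u - N * (m u / N) + 1 := by omega
    exact_mod_cast this
  rw [hm u (hmem u hu), h8]; push_cast; ring

theorem slitRoot_spec {N p j : ℕ} (hp : 0 < p) (hpN : p < N) {C : ℂ}
    (hC : -C ∈ Complex.slitPlane) (hj : 1 ≤ j) (hjN : j ≤ N) :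
    (1 - slitRoot N p j C) ^ p * (1 + slitRoot N p j C) ^ (N - p) = C ∧
      InPhaseInterval N p j (rootPhase N p (slitRoot N p j C)) :=
  Classical.epsilon_spec (exists_labelled_root hp hpN hC hj hjN)

theorem slitRoot_eq {N p j : ℕ} (hp : 0 < p) (hpN : p < N) {C u : ℂ}
    (hC : -C ∈ Complex.slitPlane) (hu : (1 - u) ^ p * (1 + u) ^ (N - p) = C)
    (hj : InPhaseInterval N p j (rootPhase N p u)) : slitRoot N p j C = u := by
  have h := Classical.epsilon_spec (p := fun u : ℂ =>
    (1 - u) ^ p * (1 + u) ^ (N - p) = C ∧ InPhaseInterval N p j (rootPhase N p u)) ⟨u, hu, hj⟩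
  exact root_unique hp hpN hC h.1 hu h.2 hj

/-! ### Exact phases of the labelled roots -/

theorem slitRoot_phase_exists {N p j : ℕ} (hp : 0 < p) (hpN : p < N) {C : ℂ}
    (hC : -C ∈ Complex.slitPlane) (hj : 1 ≤ j) (hjN : j ≤ N) :
    ∃ k : ℤ, rootPhase N p (slitRoot N p j C)
      = ((-(p : ℤ) + 2 * j - 1 - 2 * N * k : ℤ) : ℝ) + slitAngle C ∧
      -(N : ℤ) ≤ -(p : ℤ) + 2 * j - 1 - 2 * N * k ∧ -(p : ℤ) + 2 * j - 1 - 2 * N * k ≤ N := by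
  obtain ⟨h1, h2⟩ := slitRoot_spec hp hpN hC hj hjN
  obtain ⟨k, hk⟩ := (inPhaseInterval_iff hpN hC h1).1 h2
  have hoff := offSegment_of_root hC h1
  have h3 := neg_lt_rootPhase (N := N) hp hpN hoff
  have h4 := rootPhase_le (N := N) hp hpN hoff
  obtain ⟨h5, h6⟩ := slitAngle_mem hC
  refine ⟨k, by push_cast; linarith, ?_, ?_⟩
  · have : ((-(N : ℤ) : ℤ) : ℝ) < ((-(p : ℤ) + 2 * j - 1 - 2 * N * k + 1 : ℤ) : ℝ) := by
      push_cast; linarith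
    have := Int.cast_lt.1 this
    omega
  · have : ((-(p : ℤ) + 2 * j - 1 - 2 * N * k - 1 : ℤ) : ℝ) < ((N : ℤ) : ℝ) := by
      push_cast; linarith
    have := Int.cast_lt.1 this
    omega

theorem winding_eq {N p j : ℕ} (hp : 0 < p) (hpN : p < N) (hj : 1 ≤ j) (hjN : j ≤ N) {k : ℤ}
    (h1 : -(N : ℤ) ≤ -(p : ℤ) + 2 * j - 1 - 2 * N * k)
    (h2 : -(p : ℤ) + 2 * j - 1 - 2 * N * k ≤ N) : k = 0 ∨ k = 1 := by
  have hN : (0 : ℤ) < N := by omega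
  have h3 : (N : ℤ) * k < N * 2 := by linarith
  have h4 : (N : ℤ) * (-1) < N * k := by linarith
  have h3' := lt_of_mul_lt_mul_left h3 hN.le
  have h4' := lt_of_mul_lt_mul_left h4 hN.le
  omega

theorem slitRoot_phase_of_le {N p j : ℕ} (hp : 0 < p) (hpN : p < N) {C : ℂ}
    (hC : -C ∈ Complex.slitPlane) (hj : 1 ≤ j) (hjp : j ≤ p) :
    rootPhase N p (slitRoot N p j C) = -(p : ℝ) + 2 * j - 1 + slitAngle C := by
  obtain ⟨k, hk, h1, h2⟩ := slitRoot_phase_exists hp hpN hC hj (hjp.trans hpN.le)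
  rcases winding_eq hp hpN hj (hjp.trans hpN.le) h1 h2 with rfl | rfl
  · rw [hk]; push_cast; ring
  · omega

theorem abs_slitRoot_phase_lt {N p j : ℕ} (hp : 0 < p) (hpN : p < N) {C : ℂ}
    (hC : -C ∈ Complex.slitPlane) (hj : 1 ≤ j) (hjp : j ≤ p) :
    |rootPhase N p (slitRoot N p j C)| < p := by
  rw [slitRoot_phase_of_le hp hpN hC hj hjp, abs_lt]
  obtain ⟨h5, h6⟩ := slitAngle_mem hC
  have h1 : (1 : ℝ) ≤ j := by exact_mod_cast hj
  have h2 : (j : ℝ) ≤ p := by exact_mod_cast hjp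
  constructor <;> linarith

/-- With `abs_slitRoot_phase_lt` this says that |F| = p separates the first p labels from the
others. As |1 + u| decreases with |F|, the first p roots are those with the largest |1 + u|. -/
theorem lt_abs_slitRoot_phase {N p j : ℕ} (hp : 0 < p) (hpN : p < N) {C : ℂ}
    (hC : -C ∈ Complex.slitPlane) (hj : p < j) (hjN : j ≤ N) :
    p < |rootPhase N p (slitRoot N p j C)| := by
  obtain ⟨k, hk, h1, h2⟩ := slitRoot_phase_exists hp hpN hC (by omega) hjN
  obtain ⟨h5, h6⟩ := slitAngle_mem hC
  have h3 : (p : ℝ) + 1 ≤ j := by exact_mod_cast hj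
  have h4 : (j : ℝ) ≤ N := by exact_mod_cast hjN
  rw [hk, lt_abs]
  rcases winding_eq hp hpN (by omega) hjN h1 h2 with rfl | rfl
  · left; push_cast; linarith
  · right; push_cast; linarith

theorem slitRoot_injOn {N p : ℕ} (hp : 0 < p) (hpN : p < N) {C : ℂ}
    (hC : -C ∈ Complex.slitPlane) :
    Set.InjOn (fun j => slitRoot N p j C) (Finset.Icc 1 N : Finset ℕ) := by
  intro i hi j hj hij
  simp only at hij
  rw [Finset.mem_coe, Finset.mem_Icc] at hi hj
  obtain ⟨k, hk, h1, h2⟩ := slitRoot_phase_exists hp hpN hC hi.1 hi.2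
  obtain ⟨l, hl, h3, h4⟩ := slitRoot_phase_exists hp hpN hC hj.1 hj.2
  rw [hij, hl] at hk
  have h5 := Int.cast_injective (add_right_cancel hk)
  rcases winding_eq hp hpN hi.1 hi.2 h1 h2 with rfl | rfl <;>
  rcases winding_eq hp hpN hj.1 hj.2 h3 h4 with rfl | rfl <;> omega

theorem slitRoot_label_le {N p : ℕ} (hp : 0 < p) (hpN : p < N) {C u : ℂ}
    (hC : -C ∈ Complex.slitPlane) (hu : (1 - u) ^ p * (1 + u) ^ (N - p) = C)
    (hF : |rootPhase N p u| < p) : ∃ j ∈ Finset.Icc 1 p, slitRoot N p j C = u := by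
  obtain ⟨m, hm⟩ := exists_rootPhase_eq hpN hC hu
  obtain ⟨h5, h6⟩ := slitAngle_mem hC
  rw [abs_lt, hm] at hF
  have h1 : ((-1 : ℤ) : ℝ) < (m : ℝ) := by push_cast; linarith [hF.1]
  have h2 : (m : ℝ) < ((p : ℤ) : ℝ) := by push_cast; linarith [hF.2]
  have h1' := Int.cast_lt.1 h1
  have h2' := Int.cast_lt.1 h2
  refine ⟨(m + 1).toNat, Finset.mem_Icc.2 ⟨by omega, by omega⟩, slitRoot_eq hp hpN hC hu ?_⟩
  refine (inPhaseInterval_iff hpN hC hu).2 ⟨0, ?_⟩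
  have h3 : (((m + 1).toNat : ℕ) : ℝ) = (m : ℝ) + 1 := by
    have : (((m + 1).toNat : ℕ) : ℤ) = m + 1 := by omega
    exact_mod_cast this
  rw [hm, h3]; push_cast; ring

/-- If |1 + u| > R + 2, then |1 - u| > R as well, and the product of the powers exceeds R^N. -/
theorem norm_one_add_le_of_root {N p : ℕ} (hp : 0 < p) (hpN : p < N) {C u : ℂ} {R : ℝ}
    (hR : 0 ≤ R) (hRN : R ^ N = ‖C‖) (hu : (1 - u) ^ p * (1 + u) ^ (N - p) = C) :
    ‖1 + u‖ ≤ R + 2 := by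
  by_contra! h
  have h1 : R < ‖1 - u‖ := by
    have h2 : ‖1 + u‖ ≤ ‖1 - u‖ + 2 := by
      calc ‖1 + u‖ = ‖2 - (1 - u)‖ := by ring_nf
        _ ≤ ‖(2 : ℂ)‖ + ‖1 - u‖ := norm_sub_le _ _
        _ = ‖1 - u‖ + 2 := by simp [add_comm]
    linarith
  have h2 := norm_of_root hu
  have h3 : R ^ p * R ^ (N - p) < ‖1 - u‖ ^ p * ‖1 + u‖ ^ (N - p) :=
    mul_lt_mul'' (pow_lt_pow_left₀ h1 hR hp.ne')
      (pow_lt_pow_left₀ (by linarith) hR (Nat.sub_pos_of_lt hpN).ne') (by positivity)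
      (by positivity)
  rw [h2, ← pow_add, Nat.add_sub_cancel' hpN.le, hRN] at h3
  exact lt_irrefl _ h3

/-! ### The labelled roots on the positive axis -/

theorem neg_rotate_mem_slitPlane {c δ : ℝ} (hc : 0 < c) (h1 : -(2 * Real.pi) < δ) (h2 : δ < 0) :
    -((c : ℂ) * Complex.exp (δ * Complex.I)) ∈ Complex.slitPlane ∧
    slitAngle ((c : ℂ) * Complex.exp (δ * Complex.I)) = 1 + δ / Real.pi := by
  have h : -((c : ℂ) * Complex.exp (δ * Complex.I))
      = c * Complex.exp ((δ + Real.pi : ℝ) * Complex.I) := by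
    push_cast
    rw [add_mul, Complex.exp_add, Complex.exp_pi_mul_I]; ring
  have harg : Complex.arg (-((c : ℂ) * Complex.exp (δ * Complex.I))) = δ + Real.pi := by
    rw [h, Complex.exp_mul_I, Complex.arg_mul_cos_add_sin_mul_I hc]
    constructor <;> linarith
  constructor
  · rw [Complex.mem_slitPlane_iff_arg, harg]
    refine ⟨by linarith, neg_ne_zero.2 (mul_ne_zero (by exact_mod_cast hc.ne')
      (Complex.exp_ne_zero _))⟩
  · rw [slitAngle, harg, add_div, div_self Real.pi_pos.ne']; ring

/-- The distances to 1 and -1 determine Re u and |Im u| continuously; a fixed sign of the imaginary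
part then determines u. -/
theorem tendsto_of_norms {u : ℝ → ℂ} {l : Filter ℝ} {s t : ℝ}
    (hs : Tendsto (fun x => ‖1 + u x‖) l (𝓝 s)) (ht : Tendsto (fun x => ‖1 - u x‖) l (𝓝 t))
    (hsign : (∀ᶠ x in l, 0 ≤ (u x).im) ∨ ∀ᶠ x in l, (u x).im ≤ 0) :
    ∃ w : ℂ, Tendsto u l (𝓝 w) := by
  have hre : ∀ x, (u x).re = (‖1 + u x‖ ^ 2 - ‖1 - u x‖ ^ 2) / 4 := by
    intro x
    rw [← Complex.normSq_eq_norm_sq, ← Complex.normSq_eq_norm_sq, Complex.normSq_apply,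
      Complex.normSq_apply]
    simp; ring
  have him : ∀ x, (u x).im ^ 2 = ‖1 + u x‖ ^ 2 - (1 + (u x).re) ^ 2 := by
    intro x
    rw [← Complex.normSq_eq_norm_sq, Complex.normSq_apply]
    simp; ring
  have h1 : Tendsto (fun x => (u x).re) l (𝓝 ((s ^ 2 - t ^ 2) / 4)) := by
    simp only [hre]; exact ((hs.pow 2).sub (ht.pow 2)).div_const 4
  have h2 : Tendsto (fun x => |(u x).im|) l
      (𝓝 (Real.sqrt (s ^ 2 - (1 + (s ^ 2 - t ^ 2) / 4) ^ 2))) := by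
    have : ∀ x, |(u x).im| = Real.sqrt (‖1 + u x‖ ^ 2 - (1 + (u x).re) ^ 2) := by
      intro x; rw [← him, Real.sqrt_sq_eq_abs]
    simp only [this]
    exact ((hs.pow 2).sub ((h1.const_add 1).pow 2)).sqrt
  have key : ∃ y, Tendsto (fun x => (u x).im) l (𝓝 y) := by
    rcases hsign with h | h
    · exact ⟨_, h2.congr' (h.mono fun x hx => abs_of_nonneg hx)⟩
    · refine ⟨_, h2.neg.congr' (h.mono fun x hx => ?_)⟩
      rw [abs_of_nonpos hx, neg_neg]
  obtain ⟨y, hy⟩ := key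
  refine ⟨((s ^ 2 - t ^ 2) / 4 : ℝ) + y * Complex.I, ?_⟩
  have := ((Complex.continuous_ofReal.tendsto _).comp h1).add
    (((Complex.continuous_ofReal.tendsto _).comp hy).mul_const Complex.I)
  refine this.congr fun x => ?_
  simp

/-- Along the arc the phase is an integer plus δ/π, so it keeps its sign and |F| is monotone in δ.
Hence |1 + u| is monotone and bounded, thus convergent; the modulus equation gives the limit of |1 -
u|, and the root stays in one closed half-plane. -/
theorem exists_slitRoot_limit {N p j : ℕ} (hp : 0 < p) (hpN : p < N) {c : ℝ} (hc : 0 < c)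
    (hj : 1 ≤ j) (hjN : j ≤ N) :
    ∃ w : ℂ, Tendsto (fun δ : ℝ => slitRoot N p j (c * Complex.exp (δ * Complex.I)))
      (𝓝[<] 0) (𝓝 w) := by
  set u : ℝ → ℂ := fun δ => slitRoot N p j (c * Complex.exp (δ * Complex.I)) with hu
  have hslit : ∀ δ ∈ Set.Ioo (-Real.pi) 0, -((c : ℂ) * Complex.exp (δ * Complex.I)) ∈
      Complex.slitPlane ∧ slitAngle ((c : ℂ) * Complex.exp (δ * Complex.I)) = 1 + δ / Real.pi :=
    fun δ hδ => neg_rotate_mem_slitPlane hc (by linarith [hδ.1, Real.pi_pos]) hδ.2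
  have hnC : ∀ δ : ℝ, ‖(c : ℂ) * Complex.exp (δ * Complex.I)‖ = c := by
    intro δ
    rw [norm_mul, Complex.norm_exp_ofReal_mul_I, Complex.norm_real, mul_one,
      Real.norm_of_nonneg hc.le]
  have hmod : ∀ δ ∈ Set.Ioo (-Real.pi) 0, ‖1 - u δ‖ ^ p * ‖1 + u δ‖ ^ (N - p) = c := by
    intro δ hδ
    rw [norm_of_root (slitRoot_spec hp hpN (hslit δ hδ).1 hj hjN).1, hnC]
  have hoff : ∀ δ ∈ Set.Ioo (-Real.pi) 0, OffSegment (u δ) := fun δ hδ =>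
    offSegment_of_root (hslit δ hδ).1 (slitRoot_spec hp hpN (hslit δ hδ).1 hj hjN).1
  have hIoo : Set.Ioo (-Real.pi) 0 ∈ 𝓝[<] (0 : ℝ) :=
    Ioo_mem_nhdsLT (by linarith [Real.pi_pos])
  have hbound : ∀ δ ∈ Set.Ioo (-Real.pi) 0, ‖1 + u δ‖ ≤ c ^ (1 / (N : ℝ)) + 2 := by
    intro δ hδ
    refine norm_one_add_le_of_root hp hpN (by positivity) ?_
      (slitRoot_spec hp hpN (hslit δ hδ).1 hj hjN).1
    rw [hnC, one_div, Real.rpow_inv_natCast_pow hc.le (by omega)]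
  -- the phase is `e + δ / π` with a fixed integer `e`
  have hphase : ∃ e : ℤ, ∀ δ ∈ Set.Ioo (-Real.pi) 0, rootPhase N p (u δ) = e + δ / Real.pi := by
    -- From -N < F ≤ N and -1 < δ/π < 0 the integer part lies in (-N, N]. It is thus the
    -- representative of -p + 2j modulo 2N in that range, the same for all δ.
    refine ⟨if -(p : ℤ) + 2 * j ≤ N then -(p : ℤ) + 2 * j else -(p : ℤ) + 2 * j - 2 * N, ?_⟩
    intro δ hδ
    obtain ⟨hs, ha⟩ := hslit δ hδ
    obtain ⟨k, hk, h1, h2⟩ := slitRoot_phase_exists hp hpN hs hj hjN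
    have hF : rootPhase N p (u δ)
        = ((-(p : ℤ) + 2 * j - 2 * N * k : ℤ) : ℝ) + δ / Real.pi := by
      rw [hu]; simp only [hk, ha]; push_cast; ring
    have h3 := neg_lt_rootPhase (N := N) hp hpN (hoff δ hδ)
    have h4 := rootPhase_le (N := N) hp hpN (hoff δ hδ)
    rw [hF] at h3 h4
    have hd0 : δ / Real.pi < 0 := div_neg_of_neg_of_pos hδ.2 Real.pi_pos
    have hd1 : -1 < δ / Real.pi := by
      rw [lt_div_iff₀ Real.pi_pos]; linarith [hδ.1]
    have h5 : ((-(N : ℤ) : ℤ) : ℝ) < ((-(p : ℤ) + 2 * j - 2 * N * k : ℤ) : ℝ) := by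
      rw [Int.cast_neg, Int.cast_natCast]; linarith
    have h6 : ((-(p : ℤ) + 2 * j - 2 * N * k : ℤ) : ℝ) < ((N + 1 : ℤ) : ℝ) := by
      rw [Int.cast_add, Int.cast_natCast, Int.cast_one]; linarith
    have h5' := Int.cast_lt.1 h5
    have h6' := Int.cast_lt.1 h6
    rw [hF]
    congr 2
    rcases winding_eq hp hpN hj hjN h1 h2 with rfl | rfl
    · rw [if_pos (by omega)]; ring
    · rw [if_neg (by omega)]; ring
  obtain ⟨e, he⟩ := hphase
  have hquot : ∀ δ ∈ Set.Ioo (-Real.pi) 0, δ / Real.pi < 0 ∧ -1 < δ / Real.pi := by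
    intro δ hδ
    exact ⟨div_neg_of_neg_of_pos hδ.2 Real.pi_pos, by
      rw [lt_div_iff₀ Real.pi_pos]; linarith [hδ.1]⟩
  have hlim : ((∀ᶠ δ in 𝓝[<] (0 : ℝ), 0 ≤ (u δ).im) ∨ ∀ᶠ δ in 𝓝[<] (0 : ℝ), (u δ).im ≤ 0) ∧
      ∃ s, Tendsto (fun δ => ‖1 + u δ‖) (𝓝[<] 0) (𝓝 s) := by
    rcases le_or_gt e 0 with h0 | h0
    · have h0' : (e : ℝ) ≤ 0 := by exact_mod_cast h0
      have hneg : ∀ δ ∈ Set.Ioo (-Real.pi) 0, rootPhase N p (u δ) < 0 := by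
        intro δ hδ; rw [he δ hδ]; linarith [(hquot δ hδ).1]
      refine ⟨Or.inr ?_, ?_⟩
      · filter_upwards [hIoo] with δ hδ
        by_contra! h
        have := rootPhase_pos (N := N) hp hpN h
        linarith [hneg δ hδ]
      · have hmono : MonotoneOn (fun δ => ‖1 + u δ‖) (Set.Ioo (-Real.pi) 0) := by
          intro x hx y hy hxy
          rcases hxy.eq_or_lt with rfl | hxy
          · exact le_rfl
          refine (norm_one_add_lt_of_abs_phase_lt hp hpN (hoff y hy) (hoff x hx)
            (by rw [hmod x hx, hmod y hy]) ?_).le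
          rw [abs_of_neg (hneg x hx), abs_of_neg (hneg y hy), he x hx, he y hy]
          have := div_lt_div_of_pos_right hxy Real.pi_pos
          linarith
        exact ⟨_, hmono.tendsto_nhdsWithin_Ioo_left (Set.nonempty_Ioo.2 (by
          linarith [Real.pi_pos])) ⟨_, by rintro _ ⟨δ, hδ, rfl⟩; exact hbound δ hδ⟩⟩
    · have h0' : (1 : ℝ) ≤ e := by exact_mod_cast h0
      have hpos : ∀ δ ∈ Set.Ioo (-Real.pi) 0, 0 < rootPhase N p (u δ) := by
        intro δ hδ; rw [he δ hδ]; linarith [(hquot δ hδ).2]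
      refine ⟨Or.inl ?_, ?_⟩
      · filter_upwards [hIoo] with δ hδ
        by_contra! h
        have := rootPhase_neg (N := N) hp hpN h
        linarith [hpos δ hδ]
      · have hmono : MonotoneOn (fun δ => -‖1 + u δ‖) (Set.Ioo (-Real.pi) 0) := by
          intro x hx y hy hxy
          rcases hxy.eq_or_lt with rfl | hxy
          · exact le_rfl
          refine neg_le_neg (norm_one_add_lt_of_abs_phase_lt hp hpN (hoff x hx) (hoff y hy)
            (by rw [hmod x hx, hmod y hy]) ?_).le
          rw [abs_of_pos (hpos x hx), abs_of_pos (hpos y hy), he x hx, he y hy]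
          have := div_lt_div_of_pos_right hxy Real.pi_pos
          linarith
        have h := hmono.tendsto_nhdsWithin_Ioo_left (Set.nonempty_Ioo.2 (by
          linarith [Real.pi_pos])) ⟨0, by
            rintro _ ⟨δ, hδ, rfl⟩; exact neg_nonpos.2 (norm_nonneg _)⟩
        refine ⟨_, h.neg.congr fun δ => neg_neg _⟩
  obtain ⟨hsign, s, hs⟩ := hlim
  have hn : N - p ≠ 0 := (Nat.sub_pos_of_lt hpN).ne'
  -- If |1 + u| tended to 0, the product of the powers would too, although it is constantly c > 0.
  -- This allows dividing by s^(N - p) below.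
  have hs0 : s ≠ 0 := by
    rintro rfl
    have h1 : Tendsto (fun δ => (2 + ‖1 + u δ‖) ^ p * ‖1 + u δ‖ ^ (N - p)) (𝓝[<] 0)
        (𝓝 ((2 + 0) ^ p * 0 ^ (N - p))) := ((hs.const_add 2).pow p).mul (hs.pow _)
    rw [zero_pow hn, mul_zero] at h1
    refine absurd (ge_of_tendsto h1 (b := c) ?_) (not_le.2 hc)
    filter_upwards [hIoo] with δ hδ
    rw [← hmod δ hδ]
    refine mul_le_mul_of_nonneg_right (pow_le_pow_left₀ (norm_nonneg _) ?_ _) (by positivity)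
    calc ‖1 - u δ‖ = ‖2 - (1 + u δ)‖ := by ring_nf
      _ ≤ ‖(2 : ℂ)‖ + ‖1 + u δ‖ := norm_sub_le _ _
      _ = 2 + ‖1 + u δ‖ := by simp
  refine tendsto_of_norms hs (t := (c / s ^ (N - p)) ^ (1 / (p : ℝ))) ?_ hsign
  have h2 : Tendsto (fun δ => (c / ‖1 + u δ‖ ^ (N - p)) ^ (1 / (p : ℝ))) (𝓝[<] 0)
      (𝓝 ((c / s ^ (N - p)) ^ (1 / (p : ℝ)))) :=
    (tendsto_const_nhds.div (hs.pow _) (pow_ne_zero _ hs0)).rpow_const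
      (Or.inr (by positivity))
  refine h2.congr' ?_
  filter_upwards [hIoo] with δ hδ
  have h3 : ‖1 + u δ‖ ≠ 0 := by
    intro h; have := hmod δ hδ; rw [h, zero_pow hn, mul_zero] at this; exact hc.ne this
  rw [← hmod δ hδ, mul_div_assoc, div_self (pow_ne_zero _ h3), mul_one, one_div,
    Real.pow_rpow_inv_natCast (norm_nonneg _) hp.ne']

theorem root_of_slit {N p j : ℕ} {C : ℂ} (hC : -C ∈ Complex.slitPlane) :
    root N p j C = slitRoot N p j C := by
  have h0 : C ≠ 0 := by rintro rfl; simp at hC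
  rw [root, if_neg h0, if_neg]
  rintro ⟨h1, h2⟩
  rw [Complex.mem_slitPlane_iff] at hC
  simp only [Complex.neg_re, Complex.neg_im] at hC
  rcases hC with h | h
  · linarith
  · exact h (by rw [h2, neg_zero])

theorem tendsto_root {N p j : ℕ} (hp : 0 < p) (hpN : p < N) {c : ℝ} (hc : 0 < c)
    (hj : 1 ≤ j) (hjN : j ≤ N) :
    Tendsto (fun δ : ℝ => root N p j (c * Complex.exp (δ * Complex.I)))
      (𝓝[<] 0) (𝓝 (root N p j c)) := by
  have h0 : (c : ℂ) ≠ 0 := by exact_mod_cast hc.ne'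
  have h1 : root N p j c = limUnder (𝓝[<] (0 : ℝ)) fun δ : ℝ =>
      slitRoot N p j (c * Complex.exp (δ * Complex.I)) := by
    rw [root, if_neg h0, if_pos ⟨by simpa using hc, by simp⟩]
  rw [h1]
  refine (tendsto_nhds_limUnder (exists_slitRoot_limit hp hpN hc hj hjN)).congr' ?_
  filter_upwards [Ioo_mem_nhdsLT (show -Real.pi < 0 by linarith [Real.pi_pos])] with δ hδ
  rw [root_of_slit (neg_rotate_mem_slitPlane hc (by linarith [hδ.1, Real.pi_pos]) hδ.2).1]

theorem slit_or_pos {C : ℂ} (hC : C ≠ 0) :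
    -C ∈ Complex.slitPlane ∨ ∃ c : ℝ, 0 < c ∧ C = c := by
  by_cases h : -C ∈ Complex.slitPlane
  · exact Or.inl h
  · right
    rw [Complex.mem_slitPlane_iff, not_or, not_lt, not_not] at h
    simp only [Complex.neg_re, Complex.neg_im, neg_eq_zero] at h
    have hre : 0 < C.re := lt_of_le_of_ne (by linarith [h.1])
      (fun h' => hC (Complex.ext h'.symm h.2))
    exact ⟨C.re, hre, Complex.ext rfl (by simpa using h.2)⟩

/-- A closed condition on the roots that holds off the positive axis holds for all `C ≠ 0`. -/
theorem root_le_of_slit {N p : ℕ} (hp : 0 < p) (hpN : p < N) {C : ℂ} (hC : C ≠ 0)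
    (f g : (ℕ → ℂ) → ℝ)
    (hf : ∀ v : ℝ → ℕ → ℂ, ∀ w : ℕ → ℂ,
      (∀ j ∈ Finset.Icc 1 N, Tendsto (fun δ => v δ j) (𝓝[<] 0) (𝓝 (w j))) →
        Tendsto (fun δ => f (v δ)) (𝓝[<] 0) (𝓝 (f w)))
    (hg : ∀ v : ℝ → ℕ → ℂ, ∀ w : ℕ → ℂ,
      (∀ j ∈ Finset.Icc 1 N, Tendsto (fun δ => v δ j) (𝓝[<] 0) (𝓝 (w j))) →
        Tendsto (fun δ => g (v δ)) (𝓝[<] 0) (𝓝 (g w)))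
    (h : ∀ D : ℂ, -D ∈ Complex.slitPlane → ‖D‖ = ‖C‖ →
      f (fun j => root N p j D) ≤ g (fun j => root N p j D)) :
    f (fun j => root N p j C) ≤ g (fun j => root N p j C) := by
  rcases slit_or_pos hC with hs | ⟨c, hc, rfl⟩
  · exact h C hs rfl
  · have ht : ∀ j ∈ Finset.Icc 1 N, Tendsto
        (fun δ : ℝ => root N p j (c * Complex.exp (δ * Complex.I))) (𝓝[<] 0)
        (𝓝 (root N p j c)) := fun j hj =>
      tendsto_root hp hpN hc (Finset.mem_Icc.1 hj).1 (Finset.mem_Icc.1 hj).2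
    refine le_of_tendsto_of_tendsto
      (hf (fun δ j => root N p j (c * Complex.exp (δ * Complex.I))) _ ht)
      (hg (fun δ j => root N p j (c * Complex.exp (δ * Complex.I))) _ ht) ?_
    filter_upwards [Ioo_mem_nhdsLT (show -Real.pi < 0 by linarith [Real.pi_pos])] with δ hδ
    refine h _ (neg_rotate_mem_slitPlane hc (by linarith [hδ.1, Real.pi_pos]) hδ.2).1 ?_
    rw [norm_mul, Complex.norm_exp_ofReal_mul_I, mul_one]

theorem root_spec {N p j : ℕ} (hp : 0 < p) (hpN : p < N) {C : ℂ} (hC : C ≠ 0)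
    (hj : 1 ≤ j) (hjN : j ≤ N) :
    (1 - root N p j C) ^ p * (1 + root N p j C) ^ (N - p) = C := by
  rcases slit_or_pos hC with hs | ⟨c, hc, rfl⟩
  · rw [root_of_slit hs]; exact (slitRoot_spec hp hpN hs hj hjN).1
  · have ht := tendsto_root hp hpN hc hj hjN
    have h1 := (((ht.const_sub 1).pow p).mul ((ht.const_add 1).pow (N - p)))
    have h2 : Tendsto (fun δ : ℝ => (c : ℂ) * Complex.exp (δ * Complex.I)) (𝓝[<] 0) (𝓝 c) := by
      have : Continuous fun δ : ℝ => (c : ℂ) * Complex.exp (δ * Complex.I) := by fun_prop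
      have := (this.tendsto 0).mono_left (nhdsWithin_le_nhds (s := Set.Iio 0))
      simpa using this
    refine tendsto_nhds_unique h1 (h2.congr' ?_)
    filter_upwards [Ioo_mem_nhdsLT (show -Real.pi < 0 by linarith [Real.pi_pos])] with δ hδ
    have hs := (neg_rotate_mem_slitPlane hc (by linarith [hδ.1, Real.pi_pos]) hδ.2).1
    rw [root_of_slit hs]
    exact (slitRoot_spec hp hpN hs hj hjN).1.symm

/-! ### Symmetric functions of the roots and the maximum principle -/

theorem bethePoly_coeff (N p : ℕ) (C : ℂ) (k : ℕ) :
    (bethePoly N p C).coeff k = (bethePoly N p 0).coeff k - if k = 0 then C else 0 := by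
  simp [bethePoly, Polynomial.coeff_C]

open Polynomial in
/-- A symmetric polynomial of the roots of `bethePoly N p C` is a polynomial in `C`. -/
theorem exists_polynomial_of_symmetric {N p : ℕ} (hpN : p < N)
    {f : MvPolynomial (Fin N) ℂ} (hf : f.IsSymmetric) :
    ∃ T : ℂ[X], ∀ (C : ℂ) (u : Fin N → ℂ),
      (bethePoly N p C).roots = Finset.univ.val.map u → MvPolynomial.aeval u f = T.eval C := by
  obtain ⟨g, hg⟩ := MvPolynomial.esymmAlgHom_surjective (σ := Fin N) (R := ℂ) (n := N)
    (Fintype.card_fin N).le ⟨f, hf⟩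
  have hg' : MvPolynomial.aeval (fun i : Fin N => MvPolynomial.esymm (Fin N) ℂ (i + 1)) g = f := by
    rw [← MvPolynomial.esymmAlgHom_apply, hg]
  set lc := (bethePoly N p 0).coeff N with hlc
  have hlcC : ∀ C, (bethePoly N p C).leadingCoeff = lc := by
    intro C
    rw [leadingCoeff, bethePoly_natDegree hpN, bethePoly_coeff, if_neg (by omega), sub_zero]
  have hlc0 : lc ≠ 0 := by
    rw [← hlcC 0, Ne, leadingCoeff_eq_zero]
    intro h; have := bethePoly_natDegree hpN 0; rw [h] at this; simp at this; omega
  -- By Vieta each elementary symmetric function of the roots is a coefficient divided by the signed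
  -- leading coefficient. Only the constant coefficient contains C, hence the `X` in the single case
  -- N - (i + 1) = 0.
  refine ⟨MvPolynomial.aeval (fun i : Fin N =>
    Polynomial.C ((lc * (-1) ^ ((i : ℕ) + 1))⁻¹) *
      (Polynomial.C ((bethePoly N p 0).coeff (N - (i + 1))) -
        if N - ((i : ℕ) + 1) = 0 then X else 0)) g, fun C u hu => ?_⟩
  have hE : ∀ i : Fin N, MvPolynomial.aeval u (MvPolynomial.esymm (Fin N) ℂ ((i : ℕ) + 1))
      = (Polynomial.C ((lc * (-1) ^ ((i : ℕ) + 1))⁻¹) *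
      (Polynomial.C ((bethePoly N p 0).coeff (N - (i + 1))) -
        if N - ((i : ℕ) + 1) = 0 then X else 0)).eval C := by
    intro i
    have hv := Polynomial.coeff_eq_esymm_roots_of_card (p := bethePoly N p C)
      (IsAlgClosed.card_roots_eq_natDegree) (k := N - (i + 1))
      (by rw [bethePoly_natDegree hpN]; omega)
    rw [hu, hlcC, bethePoly_natDegree hpN, ← MvPolynomial.aeval_esymm_eq_multiset_esymm (Fin N) ℂ,
      show N - (N - ((i : ℕ) + 1)) = (i : ℕ) + 1 by omega, bethePoly_coeff] at hv
    have h1 : (-1 : ℂ) ^ ((i : ℕ) + 1) ≠ 0 := pow_ne_zero _ (by norm_num)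
    rw [eval_mul, eval_C, eval_sub, eval_C, apply_ite (eval C), eval_X, eval_zero, hv]
    field_simp
  rw [← hg', ← AlgHom.comp_apply, MvPolynomial.comp_aeval, ← Polynomial.coe_aeval_eq_eval,
    ← AlgHom.comp_apply, MvPolynomial.comp_aeval]
  congr 2
  funext i
  rw [Polynomial.coe_aeval_eq_eval]
  exact hE i

/-- The symmetric polynomial `∑_{|S| = p} ∏_{i ∈ S} (1 + X_i)^k`. -/
def powerESymm (N p k : ℕ) : MvPolynomial (Fin N) ℂ :=
  MvPolynomial.aeval (fun i => (1 + MvPolynomial.X i) ^ k) (MvPolynomial.esymm (Fin N) ℂ p)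

theorem powerESymm_isSymmetric (N p k : ℕ) : (powerESymm N p k).IsSymmetric := by
  intro e
  have h1 : (MvPolynomial.rename e) (powerESymm N p k)
      = MvPolynomial.aeval (fun i => (1 + MvPolynomial.X (e i)) ^ k)
          (MvPolynomial.esymm (Fin N) ℂ p) := by
    unfold powerESymm
    rw [← AlgHom.comp_apply, MvPolynomial.comp_aeval]
    simp
  rw [h1]
  have h2 := MvPolynomial.aeval_rename (R := ℂ) e
    (fun i => ((1 + MvPolynomial.X i) ^ k : MvPolynomial (Fin N) ℂ)) (MvPolynomial.esymm (Fin N) ℂ p)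
  rw [MvPolynomial.rename_esymm] at h2
  exact h2.symm

theorem aeval_powerESymm (N p k : ℕ) (u : Fin N → ℂ) :
    MvPolynomial.aeval u (powerESymm N p k)
      = ∑ S ∈ Finset.powersetCard p Finset.univ, ∏ i ∈ S, (1 + u i) ^ k := by
  unfold powerESymm
  rw [← AlgHom.comp_apply, MvPolynomial.comp_aeval]
  simp [MvPolynomial.esymm, map_sum, map_prod]

open Polynomial in
theorem bethePoly_roots_zero {N p : ℕ} (hpN : p < N) :
    (bethePoly N p 0).roots
      = (Finset.univ : Finset (Fin N)).val.map fun i : Fin N => if (i : ℕ) < p then (1 : ℂ) else -1 := by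
  have h : bethePoly N p 0 = Polynomial.C ((-1) ^ p) *
      ∏ i : Fin N, (X - Polynomial.C (if (i : ℕ) < p then (1 : ℂ) else -1)) := by
    rw [Fin.prod_univ_eq_prod_range
      (fun i => (X - Polynomial.C (if i < p then (1 : ℂ) else -1) : ℂ[X])) N]
    conv_rhs => rw [show N = p + (N - p) by omega, Finset.prod_range_add]
    rw [Finset.prod_congr rfl (g := fun _ => (X - 1 : ℂ[X]))
        (fun i hi => by simp [Finset.mem_range.1 hi]),
      Finset.prod_congr (s₁ := Finset.range (N - p)) rfl (g := fun _ => (X + 1 : ℂ[X]))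
        (fun i hi => by simp)]
    simp only [Finset.prod_const, Finset.card_range, bethePoly, map_zero, sub_zero, map_pow,
      map_neg, map_one]
    rw [← mul_assoc, ← mul_pow, add_comm 1 X]
    congr 2; ring
  rw [h, roots_C_mul _ (pow_ne_zero _ (by norm_num)), Polynomial.roots_prod]
  · simp
  · exact Finset.prod_ne_zero_iff.2 fun i _ => X_sub_C_ne_zero _

/-- Every selection of p roots other than the p copies of 1 contains a root -1, whose factor 1 + u
vanishes. -/
theorem powerESymm_at_zero {N p k : ℕ} (hpN : p < N) (hk : k ≠ 0) :
    MvPolynomial.aeval (fun i : Fin N => if (i : ℕ) < p then (1 : ℂ) else -1) (powerESymm N p k)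
      = (2 ^ p) ^ k := by
  rw [aeval_powerESymm]
  have hcard : (Finset.univ.filter fun i : Fin N => (i : ℕ) < p).card = p := by
    rw [Fin.card_filter_val_lt]; omega
  rw [Finset.sum_eq_single (Finset.univ.filter fun i : Fin N => (i : ℕ) < p)]
  · rw [Finset.prod_congr rfl (g := fun _ => (2 : ℂ) ^ k), Finset.prod_const, hcard, ← pow_mul,
      ← pow_mul, mul_comm]
    intro i hi
    rw [if_pos (Finset.mem_filter.1 hi).2]; norm_num
  · intro S hS hne
    rw [Finset.mem_powersetCard] at hS
    have : ¬ S ⊆ Finset.univ.filter fun i : Fin N => (i : ℕ) < p := fun h =>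
      hne (Finset.eq_of_subset_of_card_le h (by rw [hcard, hS.2]))
    obtain ⟨i, hi, hi'⟩ := Finset.not_subset.1 this
    refine Finset.prod_eq_zero hi ?_
    rw [if_neg (fun h => hi' (Finset.mem_filter.2 ⟨Finset.mem_univ _, h⟩))]
    simp [hk]
  · intro h
    exact absurd (Finset.mem_powersetCard.2 ⟨Finset.subset_univ _, hcard⟩) h

open Polynomial in
theorem bethePoly_roots_eq {N p : ℕ} (hp : 0 < p) (hpN : p < N) {C : ℂ}
    (hC : -C ∈ Complex.slitPlane) :
    (bethePoly N p C).roots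
      = (Finset.univ : Finset (Fin N)).val.map fun i : Fin N => slitRoot N p (i + 1) C := by
  have hne : bethePoly N p C ≠ 0 := by
    intro h; have := bethePoly_natDegree hpN C; rw [h] at this; simp at this; omega
  symm
  refine Multiset.eq_of_le_of_card_le ?_ ?_
  · rw [Multiset.le_iff_subset]
    · intro u hu
      obtain ⟨i, -, rfl⟩ := Multiset.mem_map.1 hu
      rw [mem_roots hne, IsRoot.def, bethePoly_eval, sub_eq_zero]
      exact (slitRoot_spec hp hpN hC (by omega) (by omega)).1
    · refine Multiset.Nodup.map_on ?_ Finset.univ.nodup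
      intro i _ j _ hij
      have := slitRoot_injOn hp hpN hC (x₁ := i + 1) (x₂ := j + 1)
        (by simp) (by simp) hij
      exact Fin.ext (by omega)
  · rw [IsAlgClosed.card_roots_eq_natDegree, bethePoly_natDegree hpN]
    simp

/-- On every circle, the products of `p` factors `1 + u_j` reach the modulus `2^p` that they have
at the centre. -/
theorem two_pow_le_of_forall_prod_le {N p : ℕ} (hp : 0 < p) (hpN : p < N) {r m : ℝ} (hr : 0 < r)
    (hm : 0 < m)
    (h : ∀ C : ℂ, -C ∈ Complex.slitPlane → ‖C‖ = r → ∀ S ⊆ Finset.Icc 1 N, S.card = p →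
      ∏ j ∈ S, ‖1 + slitRoot N p j C‖ ≤ m) : 2 ^ p ≤ m := by
  -- A sum of products is needed to obtain a polynomial in C, at the price of the factor `N.choose
  -- p`. Taking k-th powers first and letting k grow removes that factor.
  have main : ∀ k : ℕ, k ≠ 0 → ((2 : ℝ) ^ p) ^ k ≤ (N.choose p : ℝ) * m ^ k := by
    intro k hk
    obtain ⟨T, hT⟩ := exists_polynomial_of_symmetric hpN (powerESymm_isSymmetric N p k)
    have hT0 : T.eval 0 = (2 ^ p) ^ k := by
      rw [← hT 0 _ (bethePoly_roots_zero hpN), powerESymm_at_zero hpN hk]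
    have hslit : ∀ C : ℂ, -C ∈ Complex.slitPlane → ‖C‖ = r →
        ‖T.eval C‖ ≤ (N.choose p : ℝ) * m ^ k := by
      intro C hC hCr
      rw [← hT C _ (bethePoly_roots_eq hp hpN hC), aeval_powerESymm]
      refine (norm_sum_le _ _).trans ?_
      have : ∀ S ∈ Finset.powersetCard p (Finset.univ : Finset (Fin N)),
          ‖∏ i ∈ S, (1 + slitRoot N p (i + 1) C) ^ k‖ ≤ m ^ k := by
        intro S hS
        rw [Finset.prod_pow, norm_pow, norm_prod]
        refine pow_le_pow_left₀ (Finset.prod_nonneg fun _ _ => norm_nonneg _) ?_ k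
        have := h C hC hCr (S.map ⟨fun i : Fin N => (i : ℕ) + 1, fun i j hij =>
          Fin.ext (by simpa using hij)⟩) (by
            intro j hj
            obtain ⟨i, -, rfl⟩ := Finset.mem_map.1 hj
            exact Finset.mem_Icc.2 ⟨Nat.le_add_left _ _, i.2⟩) (by
            rw [Finset.card_map, (Finset.mem_powersetCard.1 hS).2])
        rwa [Finset.prod_map] at this
      refine (Finset.sum_le_card_nsmul _ _ _ this).trans ?_
      rw [Finset.card_powersetCard, Finset.card_univ, Fintype.card_fin, nsmul_eq_mul]
    have hcirc : ∀ C : ℂ, ‖C‖ = r → ‖T.eval C‖ ≤ (N.choose p : ℝ) * m ^ k := by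
      intro C hCr
      have hC0 : C ≠ 0 := by rintro rfl; rw [norm_zero] at hCr; exact hr.ne hCr
      rcases slit_or_pos hC0 with hs | ⟨c, hc, rfl⟩
      · exact hslit C hs hCr
      · have hcont : Continuous fun δ : ℝ => ‖T.eval ((c : ℂ) * Complex.exp (δ * Complex.I))‖ :=
          (T.continuous.comp (by fun_prop)).norm
        have ht := (hcont.tendsto 0).mono_left (nhdsWithin_le_nhds (s := Set.Iio 0))
        simp only [Complex.ofReal_zero, zero_mul, Complex.exp_zero, mul_one] at ht
        refine le_of_tendsto ht ?_
        filter_upwards [Ioo_mem_nhdsLT (show -Real.pi < 0 by linarith [Real.pi_pos])] with δ hδ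
        refine hslit _ (neg_rotate_mem_slitPlane hc (by linarith [hδ.1, Real.pi_pos]) hδ.2).1 ?_
        rw [norm_mul, Complex.norm_exp_ofReal_mul_I, mul_one, hCr]
    -- Maximum principle on the disc of radius r, evaluated at its centre.
    have := Complex.norm_le_of_forall_mem_frontier_norm_le (f := fun z => T.eval z)
      (U := Metric.ball 0 r) Metric.isBounded_ball T.differentiable.diffContOnCl
      (C := (N.choose p : ℝ) * m ^ k) (by
        intro z hz
        rw [frontier_ball _ hr.ne', mem_sphere_zero_iff_norm] at hz
        exact hcirc z hz) (z := 0) (subset_closure (Metric.mem_ball_self hr))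
    rw [hT0] at this
    simpa using this
  by_contra! hlt
  have h1 : 1 < 2 ^ p / m := (one_lt_div hm).2 hlt
  obtain ⟨k, hk⟩ := ((tendsto_pow_atTop_atTop_of_one_lt h1).eventually_gt_atTop
    (N.choose p : ℝ)).and (eventually_ge_atTop 1) |>.exists
  have h2 := main k (by omega)
  have h3 := hk.1
  rw [div_pow, lt_div_iff₀ (by positivity)] at h3
  linarith

/-! ### Interlacing of the roots on a circle and the a priori bound -/

theorem one_add_ne_zero_of_root {N p : ℕ} (hpN : p < N) {C u : ℂ} (hC : C ≠ 0)
    (hu : (1 - u) ^ p * (1 + u) ^ (N - p) = C) : 1 + u ≠ 0 := by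
  intro h
  rw [h, zero_pow (Nat.sub_pos_of_lt hpN).ne', mul_zero] at hu
  exact hC hu.symm

theorem log_slitRoot_le {N p i j : ℕ} (hp : 0 < p) (hpN : p < N) {C D : ℂ}
    (hC : -C ∈ Complex.slitPlane) (hD : -D ∈ Complex.slitPlane) (hCD : ‖D‖ = ‖C‖)
    (hi : 1 ≤ i) (hiN : i ≤ N) (hj : 1 ≤ j) (hjN : j ≤ N)
    (h : |rootPhase N p (slitRoot N p i C)| < |rootPhase N p (slitRoot N p j D)|) :
    Real.log ‖1 + slitRoot N p j D‖ ≤ Real.log ‖1 + slitRoot N p i C‖ := by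
  have h1 := (slitRoot_spec hp hpN hC hi hiN).1
  have h2 := (slitRoot_spec hp hpN hD hj hjN).1
  have hD0 : D ≠ 0 := by rintro rfl; simp at hD
  refine Real.log_le_log (norm_pos_iff.2 (one_add_ne_zero_of_root hpN hD0 h2))
    (norm_one_add_lt_of_abs_phase_lt hp hpN (offSegment_of_root hC h1) (offSegment_of_root hD h2)
      (by rw [norm_of_root h1, norm_of_root h2, hCD]) h).le

/-- Phases of consecutive labels differ by 2, while moving from C to D on the circle shifts each
phase by less than 2. So, away from phase 0, the j-th root at D has larger |F|, hence smaller |1 +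
u|, than the neighbour of u_j(C) one label closer to the middle. At most three middle labels escape
and are bounded crudely, which produces the 3. -/
theorem sum_log_le_of_norm_eq {N p : ℕ} (hp : 0 < p) (hpN : p < N) {C D : ℂ}
    (hC : -C ∈ Complex.slitPlane) (hD : -D ∈ Complex.slitPlane) (hCD : ‖D‖ = ‖C‖) {B : ℝ}
    (hBC : ∀ j ∈ Finset.Icc 1 N, Real.log ‖1 + slitRoot N p j C‖ ≤ B)
    (hBD : ∀ j ∈ Finset.Icc 1 N, Real.log ‖1 + slitRoot N p j D‖ ≤ B)
    {S : Finset ℕ} (hS : S ⊆ Finset.Icc 1 N) (hSp : S.card = p) :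
    ∑ j ∈ S, Real.log ‖1 + slitRoot N p j D‖ ≤
      ∑ j ∈ Finset.Icc 1 p, Real.log ‖1 + slitRoot N p j C‖
        + 3 * (B - Real.log ‖1 + slitRoot N p N C‖) := by
  set b : ℕ → ℝ := fun j => Real.log ‖1 + slitRoot N p j C‖ with hb
  set d : ℕ → ℝ := fun j => Real.log ‖1 + slitRoot N p j D‖ with hd
  obtain ⟨i, hi, himin⟩ := Finset.exists_min_image (Finset.Icc 1 p) b ⟨1, by simp; omega⟩
  have hi' := Finset.mem_Icc.1 hi
  set β := b i with hβ
  have hβB : β ≤ B := hBC i (Finset.mem_Icc.2 ⟨hi'.1, hi'.2.trans hpN.le⟩)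
  have hphi := abs_slitRoot_phase_lt hp hpN hC hi'.1 hi'.2
  have hbN : b N ≤ β := log_slitRoot_le hp hpN hC hC rfl hi'.1 (hi'.2.trans hpN.le) (by omega)
    le_rfl (hphi.trans (lt_abs_slitRoot_phase hp hpN hC hpN le_rfl))
  have houter : ∀ j ∈ Finset.Icc 1 N, j ∉ Finset.Icc 1 p → max (d j - β) 0 = 0 := by
    intro j hj hj'
    rw [Finset.mem_Icc] at hj hj'
    have := log_slitRoot_le hp hpN hC hD hCD hi'.1 (hi'.2.trans hpN.le) hj.1 hj.2
      (hphi.trans (lt_abs_slitRoot_phase hp hpN hD (by omega) hj.2))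
    exact max_eq_right (sub_nonpos.2 this)
  -- Measured from the smallest value β of the first p logarithms at C, the labels beyond p at D
  -- contribute no positive part. So the first p labels bound an arbitrary selection of p roots.
  have h1 : ∑ j ∈ S, d j ≤ p * β + ∑ j ∈ Finset.Icc 1 p, max (d j - β) 0 := by
    have e1 : ∑ j ∈ S, d j = p * β + ∑ j ∈ S, (d j - β) := by
      rw [Finset.sum_sub_distrib, Finset.sum_const, hSp, nsmul_eq_mul]; ring
    have e2 : ∑ j ∈ S, (d j - β) ≤ ∑ j ∈ S, max (d j - β) 0 :=
      Finset.sum_le_sum fun j _ => le_max_left _ _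
    have e3 : ∑ j ∈ S, max (d j - β) 0 ≤ ∑ j ∈ Finset.Icc 1 N, max (d j - β) 0 :=
      Finset.sum_le_sum_of_subset_of_nonneg hS fun j _ _ => le_max_right _ _
    have e4 : ∑ j ∈ Finset.Icc 1 p, max (d j - β) 0 = ∑ j ∈ Finset.Icc 1 N, max (d j - β) 0 :=
      Finset.sum_subset (Finset.Icc_subset_Icc_right hpN.le) houter
    linarith
  -- away from the middle, each term of `D` is dominated by a neighbouring term of `C`
  set σ : ℕ → ℕ := fun j => if p + 4 ≤ 2 * j then j - 1 else j + 1 with hσ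
  -- For these labels the phases of `j` at D and of `σ j` at C have the same sign for any angles in
  -- (-1, 1). The shift also maps the two halves to disjoint sets, so it is injective.
  set P : ℕ → Prop := fun j => p + 4 ≤ 2 * j ∨ 2 * j + 2 ≤ p with hP
  have hσmem : ∀ j ∈ (Finset.Icc 1 p).filter P, σ j ∈ Finset.Icc 1 p := by
    intro j hj
    simp only [hP, Finset.mem_filter, Finset.mem_Icc] at hj
    simp only [hσ, Finset.mem_Icc]
    split_ifs <;> omega
  have hσinj : Set.InjOn σ ((Finset.Icc 1 p).filter P : Finset ℕ) := by
    intro x hx y hy hxy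
    simp only [hP, Finset.coe_filter, Set.mem_ofPred_eq, Finset.mem_Icc] at hx hy
    simp only [hσ] at hxy
    split_ifs at hxy <;> omega
  have hdom : ∀ j ∈ (Finset.Icc 1 p).filter P, max (d j - β) 0 ≤ b (σ j) - β := by
    intro j hj
    have hm := hσmem j hj
    refine max_le (sub_le_sub_right ?_ β) (sub_nonneg.2 (himin _ hm))
    have hm' := Finset.mem_Icc.1 hm
    simp only [hP, Finset.mem_filter, Finset.mem_Icc] at hj
    refine log_slitRoot_le hp hpN hC hD hCD hm'.1 (hm'.2.trans hpN.le) hj.1.1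
      (hj.1.2.trans hpN.le) ?_
    rw [slitRoot_phase_of_le hp hpN hC hm'.1 hm'.2, slitRoot_phase_of_le hp hpN hD hj.1.1 hj.1.2]
    obtain ⟨a1, a2⟩ := slitAngle_mem hC
    obtain ⟨a3, a4⟩ := slitAngle_mem hD
    rcases hj.2 with h | h
    · have hs : (σ j : ℝ) = j - 1 := by
        simp only [hσ, if_pos h]; rw [Nat.cast_sub hj.1.1]; simp
      have h' : (p : ℝ) + 4 ≤ 2 * j := by exact_mod_cast h
      rw [hs, abs_of_pos (by linarith), abs_of_pos (by linarith)]
      linarith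
    · have hs : (σ j : ℝ) = j + 1 := by
        simp only [hσ, if_neg (show ¬ p + 4 ≤ 2 * j by omega)]; simp
      have h' : 2 * (j : ℝ) + 2 ≤ p := by exact_mod_cast h
      rw [hs, abs_of_neg (by linarith), abs_of_neg (by linarith)]
      linarith
  have h2 : ∑ j ∈ (Finset.Icc 1 p).filter P, max (d j - β) 0 ≤
      ∑ j ∈ Finset.Icc 1 p, (b j - β) := by
    refine (Finset.sum_le_sum hdom).trans ?_
    rw [← Finset.sum_image (f := fun j => b j - β) hσinj]
    refine Finset.sum_le_sum_of_subset_of_nonneg (Finset.image_subset_iff.2 hσmem) ?_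
    intro j hj _
    exact sub_nonneg.2 (himin j hj)
  have h3 : ∑ j ∈ (Finset.Icc 1 p).filter (fun j => ¬ P j), max (d j - β) 0 ≤ 3 * (B - β) := by
    have hcard : ((Finset.Icc 1 p).filter (fun j => ¬ P j)).card ≤ 3 := by
      have hsub : (Finset.Icc 1 p).filter (fun j => ¬ P j) ⊆ Finset.Icc (p / 2) (p / 2 + 2) := by
        intro j hj
        simp only [hP, Finset.mem_filter, Finset.mem_Icc, not_or] at hj ⊢
        omega
      have := Finset.card_le_card hsub
      rw [Nat.card_Icc] at this
      omega
    refine (Finset.sum_le_card_nsmul _ _ (B - β) ?_).trans ?_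
    · intro j hj
      have hj' := Finset.mem_Icc.1 (Finset.mem_filter.1 hj).1
      exact max_le (sub_le_sub_right (hBD j (Finset.mem_Icc.2 ⟨hj'.1, hj'.2.trans hpN.le⟩)) β)
        (sub_nonneg.2 hβB)
    · rw [nsmul_eq_mul]
      exact mul_le_mul_of_nonneg_right (by exact_mod_cast hcard) (sub_nonneg.2 hβB)
  have h4 := Finset.sum_filter_add_sum_filter_not (Finset.Icc 1 p) P
    (fun j => max (d j - β) 0)
  have h5 : ∑ j ∈ Finset.Icc 1 p, (b j - β) = ∑ j ∈ Finset.Icc 1 p, b j - p * β := by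
    rw [Finset.sum_sub_distrib, Finset.sum_const, Nat.card_Icc, nsmul_eq_mul]; simp
  linarith

/-- Interlacing bounds every product of p factors, at every D on the circle of C, by the product of
the first p factors at C times ((R + 2)/|1 + u_N(C)|)^3. That bound serves as `m` in the maximum
principle. -/
theorem two_pow_mul_le_slit {N p : ℕ} (hp : 0 < p) (hpN : p < N) {C : ℂ}
    (hC : -C ∈ Complex.slitPlane) {R : ℝ} (hR : 0 ≤ R) (hRN : R ^ N = ‖C‖) :
    2 ^ p * ‖1 + slitRoot N p N C‖ ^ 3 ≤
      (∏ j ∈ Finset.Icc 1 p, ‖1 + slitRoot N p j C‖) * (R + 2) ^ 3 := by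
  have hne : ∀ D : ℂ, -D ∈ Complex.slitPlane → ∀ j ∈ Finset.Icc 1 N,
      0 < ‖1 + slitRoot N p j D‖ := by
    intro D hD j hj
    rw [Finset.mem_Icc] at hj
    have hD0 : D ≠ 0 := by rintro rfl; simp at hD
    exact norm_pos_iff.2 (one_add_ne_zero_of_root hpN hD0 (slitRoot_spec hp hpN hD hj.1 hj.2).1)
  have hB : ∀ D : ℂ, -D ∈ Complex.slitPlane → ‖D‖ = ‖C‖ → ∀ j ∈ Finset.Icc 1 N,
      Real.log ‖1 + slitRoot N p j D‖ ≤ Real.log (R + 2) := by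
    intro D hD hDC j hj
    have hj' := Finset.mem_Icc.1 hj
    exact Real.log_le_log (hne D hD j hj) (norm_one_add_le_of_root hp hpN hR (hRN.trans hDC.symm)
      (slitRoot_spec hp hpN hD hj'.1 hj'.2).1)
  have hC0 : C ≠ 0 := by rintro rfl; simp at hC
  have hNmem : N ∈ Finset.Icc 1 N := Finset.mem_Icc.2 ⟨by omega, le_rfl⟩
  have hsub : Finset.Icc 1 p ⊆ Finset.Icc 1 N := Finset.Icc_subset_Icc_right hpN.le
  have hy := hne C hC N hNmem
  have key := two_pow_le_of_forall_prod_le hp hpN (r := ‖C‖)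
    (m := (∏ j ∈ Finset.Icc 1 p, ‖1 + slitRoot N p j C‖) * ((R + 2) / ‖1 + slitRoot N p N C‖) ^ 3)
    (norm_pos_iff.2 hC0) (mul_pos (Finset.prod_pos fun j hj => hne C hC j (hsub hj))
      (by positivity)) ?_
  · rw [div_pow, ← mul_div_assoc, le_div_iff₀ (by positivity)] at key
    exact key
  · intro D hD hDC S hS hSp
    have h1 := sum_log_le_of_norm_eq hp hpN hC hD hDC (hB C hC rfl) (hB D hD hDC) hS hSp
    have h2 : 0 < ∏ j ∈ S, ‖1 + slitRoot N p j D‖ :=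
      Finset.prod_pos fun j hj => hne D hD j (hS hj)
    have h3 : 0 < ∏ j ∈ Finset.Icc 1 p, ‖1 + slitRoot N p j C‖ :=
      Finset.prod_pos fun j hj => hne C hC j (hsub hj)
    rw [← Real.log_le_log_iff h2 (mul_pos h3 (by positivity)),
      Real.log_mul h3.ne' (by positivity), Real.log_pow, Real.log_div (by positivity) hy.ne',
      Real.log_prod (fun j hj => (hne D hD j (hS hj)).ne'),
      Real.log_prod (fun j hj => (hne C hC j (hsub hj)).ne')]
    exact_mod_cast h1

theorem two_pow_mul_le {N p : ℕ} (hp : 0 < p) (hpN : p < N) {C : ℂ} (hC : C ≠ 0) {R : ℝ}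
    (hR : 0 ≤ R) (hRN : R ^ N = ‖C‖) :
    2 ^ p * ‖1 + root N p N C‖ ^ 3 ≤
      (∏ j ∈ Finset.Icc 1 p, ‖1 + root N p j C‖) * (R + 2) ^ 3 := by
  refine root_le_of_slit hp hpN hC (fun v => 2 ^ p * ‖1 + v N‖ ^ 3)
    (fun v => (∏ j ∈ Finset.Icc 1 p, ‖1 + v j‖) * (R + 2) ^ 3) ?_ ?_ ?_
  · intro v w h
    exact ((((h N (Finset.mem_Icc.2 ⟨by omega, le_rfl⟩)).const_add 1).norm).pow 3).const_mul _
  · intro v w h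
    refine Tendsto.mul_const _ (tendsto_finsetProd _ fun j hj => ?_)
    exact ((h j (Finset.Icc_subset_Icc_right hpN.le hj)).const_add 1).norm
  · intro D hD hDC
    simp only [root_of_slit hD]
    exact two_pow_mul_le_slit hp hpN hD hR (hRN.trans hDC.symm)

/-- The product of the selected factors `1 + u_j` can have the modulus `2^p e^{γ p}` only for very
small `C`. -/
theorem norm_le_of_prod_eq {N p : ℕ} (hp : 0 < p) (hpN : p < N) {C : ℂ} (hC : C ≠ 0) {γ κ : ℝ}
    (hκ0 : 0 < κ) (hκ : κ ≤ 1 / 2) (hκγ : κ ^ (4 * N) = Real.exp (γ * p) ^ (N - p))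
    (h : (∏ j ∈ Finset.Icc 1 p, ‖1 + root N p j C‖) * ‖1 + root N p N C‖
      = 2 ^ p * Real.exp (γ * p) * ‖1 + root N p p C‖) : ‖C‖ ≤ (8 * κ) ^ N := by
  have hN : N ≠ 0 := by omega
  set R : ℝ := ‖C‖ ^ ((N : ℝ)⁻¹) with hRdef
  have hR : 0 ≤ R := by positivity
  have hRN : R ^ N = ‖C‖ := Real.rpow_inv_natCast_pow (norm_nonneg _) hN
  set y := ‖1 + root N p N C‖ with hy
  have hy0 : 0 ≤ y := norm_nonneg _
  have h1 := two_pow_mul_le hp hpN hC hR hRN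
  have hQ := root_spec hp hpN hC (j := N) (by omega) le_rfl
  have hyR : y ≤ R + 2 := norm_one_add_le_of_root hp hpN hR hRN hQ
  have hpR : ‖1 + root N p p C‖ ≤ R + 2 := norm_one_add_le_of_root hp hpN hR hRN
    (root_spec hp hpN hC hp hpN.le)
  set E := Real.exp (γ * p) with hE
  have hE0 : 0 < E := Real.exp_pos _
  -- Multiplying the a priori bound, which has y³ on the left, by one more y lets the hypothesis `h`
  -- replace the product of the first p factors.
  have h2 : y ^ 4 ≤ E * (R + 2) ^ 4 := by
    have h3 : 2 ^ p * y ^ 3 * y ≤ (2 ^ p * E * (R + 2)) * (R + 2) ^ 3 := by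
      calc 2 ^ p * y ^ 3 * y
          ≤ (∏ j ∈ Finset.Icc 1 p, ‖1 + root N p j C‖) * (R + 2) ^ 3 * y :=
            mul_le_mul_of_nonneg_right h1 hy0
        _ = (2 ^ p * E * ‖1 + root N p p C‖) * (R + 2) ^ 3 := by rw [← h]; ring
        _ ≤ _ := by gcongr
    have h4 : (0 : ℝ) < 2 ^ p := by positivity
    refine le_of_mul_le_mul_left ?_ h4
    calc (2 : ℝ) ^ p * y ^ 4 = 2 ^ p * y ^ 3 * y := by ring
      _ ≤ _ := h3
      _ = _ := by ring
  have h5 : ‖1 - root N p N C‖ ≤ R + 4 := by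
    calc ‖1 - root N p N C‖ = ‖2 - (1 + root N p N C)‖ := by ring_nf
      _ ≤ ‖(2 : ℂ)‖ + ‖1 + root N p N C‖ := norm_sub_le _ _
      _ ≤ R + 4 := by simp; linarith
  -- The root equation at u_N reads R^N = |1 - u_N|^p y^(N - p). Its fourth power brings in y⁴, and
  -- `κ` is chosen so that κ^(4N) absorbs E^(N - p).
  have h6 : R ^ (4 * N) ≤ (κ * (R + 4)) ^ (4 * N) := by
    calc R ^ (4 * N) = (R ^ N) ^ 4 := by rw [← pow_mul, mul_comm]
      _ = (‖1 - root N p N C‖ ^ p) ^ 4 * (y ^ 4) ^ (N - p) := by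
          rw [hRN, ← norm_of_root hQ, mul_pow]; ring
      _ ≤ ((R + 4) ^ p) ^ 4 * (E * (R + 2) ^ 4) ^ (N - p) := by gcongr
      _ ≤ ((R + 4) ^ p) ^ 4 * (E * (R + 4) ^ 4) ^ (N - p) := by gcongr; norm_num
      _ = κ ^ (4 * N) * (R + 4) ^ (4 * p + 4 * (N - p)) := by
          rw [mul_pow, hκγ, pow_add, ← pow_mul, ← pow_mul, mul_comm p 4]; ring
      _ = (κ * (R + 4)) ^ (4 * N) := by
          rw [mul_pow]; congr 2; omega
  have h7 : R ≤ κ * (R + 4) := le_of_pow_le_pow_left₀ (by omega) (by positivity) h6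
  have h8 : R ≤ 8 * κ := by nlinarith
  rw [← hRN]
  exact pow_le_pow_left₀ hR h8 N

/-! ### The local inverse of `x (1 - x/2)^a` -/

/-- The local inverse `φ` of `x ↦ x (1 - x/2)^a` at `0` on a disc of radius `δ`, together with
`ℓ = log (1 - φ/2)`. -/
structure LobeChart (a : ℝ) where
  φ : ℂ → ℂ
  ℓ : ℂ → ℂ
  δ : ℝ
  K : ℝ
  δ_pos : 0 < δ
  K_nonneg : 0 ≤ K
  differentiableAt : ∀ z, ‖z‖ < δ → DifferentiableAt ℂ ℓ z
  φ_eq : ∀ z, ‖z‖ < δ → φ z = z * Complex.exp (-a * ℓ z)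
  two_sub_φ : ∀ z, ‖z‖ < δ → 2 - φ z = 2 * Complex.exp (ℓ z)
  norm_ℓ_le : ∀ z, ‖z‖ < δ → ‖ℓ z‖ ≤ K * ‖z‖
  norm_φ_sub_le : ∀ z, ‖z‖ < δ → ‖φ z - z‖ ≤ K * ‖z‖ ^ 2
  φ_small : ∀ z, ‖z‖ < δ → ‖φ z‖ < 1 ∧ a * (Real.pi / 2) * ‖φ z‖ < 1
  ℓ_small : ∀ z, ‖z‖ < δ → ‖ℓ z‖ < 1 / 2 ∧ a * ‖ℓ z‖ < 1 / 2
  ℓ_conj : ∀ z, ‖z‖ < δ → ℓ ((starRingEnd ℂ) z) = (starRingEnd ℂ) (ℓ z)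

/-- The function x exp(a log(1 - x/2)) has derivative 1 at 0, so it has an analytic local inverse
there. The remaining properties hold near 0, so a single small `δ` serves them all; the conjugation
symmetry follows from uniqueness of the inverse. -/
theorem exists_lobeChart {a : ℝ} (ha : 0 < a) : Nonempty (LobeChart a) := by
  set h : ℂ → ℂ := fun x => x * Complex.exp (a * Complex.log (1 - x / 2)) with hh
  have han : AnalyticAt ℂ h 0 := by
    refine analyticAt_id.mul (AnalyticAt.cexp (analyticAt_const.mul (AnalyticAt.clog ?_ ?_)))
    · fun_prop
    · simp
  have hd : HasDerivAt h 1 0 := by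
    have h1 : HasDerivAt (fun x : ℂ => 1 - x / 2) (-(1 / 2)) 0 := by
      simpa using ((hasDerivAt_id (0 : ℂ)).div_const 2).const_sub 1
    have h2 := ((h1.clog (by simp)).const_mul (a : ℂ)).cexp
    have h3 : HasDerivAt h _ 0 := (hasDerivAt_id (0 : ℂ)).mul h2
    simpa using h3
  have hne : deriv h 0 ≠ 0 := by rw [hd.deriv]; exact one_ne_zero
  have hs := han.hasStrictDerivAt
  have hh0 : h 0 = 0 := by simp [hh]
  set φ := hs.localInverse _ _ _ hne with hφ
  have hright : ∀ᶠ z in 𝓝 (0 : ℂ), h (φ z) = z := by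
    have := hs.eventually_right_inverse hne
    rwa [hh0] at this
  have hleft : ∀ᶠ x in 𝓝 (0 : ℂ), φ (h x) = x := hs.eventually_left_inverse hne
  have hφ0 : φ 0 = 0 := by
    have := hleft.self_of_nhds
    rwa [hh0] at this
  have hφan : AnalyticAt ℂ φ 0 := by
    have h1 := han.analyticAt_localInverse hne
    rwa [hh0] at h1
  have hφc : Tendsto φ (𝓝 0) (𝓝 0) := by
    have := hφan.continuousAt.tendsto; rwa [hφ0] at this
  set ℓ : ℂ → ℂ := fun z => Complex.log (1 - φ z / 2) with hℓ
  have hslit : (1 - φ 0 / 2) ∈ Complex.slitPlane := by rw [hφ0]; simp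
  have hℓan : AnalyticAt ℂ ℓ 0 :=
    (analyticAt_const.sub (hφan.div analyticAt_const two_ne_zero)).clog hslit
  have hℓ0 : ℓ 0 = 0 := by simp [hℓ, hφ0]
  have hℓc : Tendsto ℓ (𝓝 0) (𝓝 0) := by
    have := hℓan.continuousAt.tendsto; rwa [hℓ0] at this
  obtain ⟨K, hK0, hK⟩ := (hℓan.differentiableAt.isBigO_sub).exists_pos
  rw [IsBigOWith] at hK
  have small : ∀ ε > 0, ∀ f : ℂ → ℂ, Tendsto f (𝓝 0) (𝓝 0) → ∀ᶠ z in 𝓝 0, ‖f z‖ < ε := by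
    intro ε hε f hf
    have := hf.norm
    rw [norm_zero] at this
    exact this.eventually_lt_const hε
  have hlogconj : ∀ x : ℂ, ‖x‖ < 1 → Complex.log (1 - (starRingEnd ℂ) x / 2)
      = (starRingEnd ℂ) (Complex.log (1 - x / 2)) := by
    intro x hx
    rw [← Complex.log_conj]
    · rw [map_sub, map_div₀, map_one, Complex.conj_ofNat]
    · intro harg
      have := (Complex.arg_eq_pi_iff.1 harg).1
      have h6 := (abs_le.1 (Complex.abs_re_le_norm x)).2
      simp at this
      linarith
  have hconj : ∀ᶠ z in 𝓝 (0 : ℂ), φ ((starRingEnd ℂ) z) = (starRingEnd ℂ) (φ z) := by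
    have hc : Tendsto (fun z => (starRingEnd ℂ) (φ z)) (𝓝 0) (𝓝 0) := by
      have := (Complex.continuous_conj.tendsto 0).comp hφc
      simpa [Function.comp_def] using this
    filter_upwards [hc.eventually hleft, hright, small 1 one_pos φ hφc] with z h1 h2 h3
    have h4 : h ((starRingEnd ℂ) (φ z)) = (starRingEnd ℂ) z := by
      conv_rhs => rw [← h2]
      simp only [hh, map_mul, ← Complex.exp_conj, Complex.conj_ofReal, hlogconj _ h3]
    rw [← h4, h1]
  have hall : ∀ᶠ z in 𝓝 (0 : ℂ), (DifferentiableAt ℂ ℓ z ∧ h (φ z) = z) ∧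
      (‖ℓ z - ℓ 0‖ ≤ K * ‖z - 0‖ ∧ ‖φ z‖ < min 1 (1 / (a * (Real.pi / 2)))) ∧
      (‖ℓ z‖ < min (1 / 2) (1 / 2 / a) ∧ φ ((starRingEnd ℂ) z) = (starRingEnd ℂ) (φ z)) := by
    have hpi := Real.pi_pos
    exact ((hℓan.eventually_analyticAt.mono fun z hz => hz.differentiableAt).and hright).and
      ((hK.and (small _ (by positivity) φ hφc)).and ((small _ (by positivity) ℓ hℓc).and hconj))
  obtain ⟨δ, hδ, hball⟩ := Metric.eventually_nhds_iff.1 hall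
  have hb : ∀ z : ℂ, ‖z‖ < δ → _ := fun z hz => @hball z (by simpa using hz)
  have hpi := Real.pi_pos
  have hslit' : ∀ z, ‖z‖ < δ → 1 - φ z / 2 ≠ 0 := by
    intro z hz h0
    obtain ⟨_, ⟨_, h1⟩, _⟩ := hb z hz
    have h2 : φ z = 2 := by linear_combination (-2) * h0
    have h3 := lt_of_lt_of_le h1 (min_le_left _ _)
    rw [h2] at h3; norm_num at h3
  have hφeq : ∀ z, ‖z‖ < δ → φ z = z * Complex.exp (-a * ℓ z) := by
    intro z hz
    obtain ⟨⟨_, h1⟩, _⟩ := hb z hz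
    have h2 : φ z * Complex.exp (a * ℓ z) = z := h1
    calc φ z = (φ z * Complex.exp (a * ℓ z)) * Complex.exp (-a * ℓ z) := by
          rw [mul_assoc, ← Complex.exp_add]; simp
      _ = z * Complex.exp (-a * ℓ z) := by rw [h2]
  have hℓle : ∀ z, ‖z‖ < δ → ‖ℓ z‖ ≤ K * ‖z‖ := by
    intro z hz
    have := (hb z hz).2.1.1
    simpa [hℓ0] using this
  have hℓs : ∀ z, ‖z‖ < δ → ‖ℓ z‖ < 1 / 2 ∧ a * ‖ℓ z‖ < 1 / 2 := by
    intro z hz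
    have h1 := (hb z hz).2.2.1
    refine ⟨lt_of_lt_of_le h1 (min_le_left _ _), ?_⟩
    have := lt_of_lt_of_le h1 (min_le_right _ _)
    rwa [lt_div_iff₀ ha, mul_comm] at this
  -- K is the linear bound for ℓ; 2aK bounds the quadratic remainder of φ through |e^w - 1| ≤ 2|w|.
  refine ⟨⟨φ, ℓ, δ, max K (2 * (a * K)), hδ, le_max_of_le_left hK0.le, fun z hz => (hb z hz).1.1,
    hφeq, ?_, ?_, ?_, ?_, hℓs, ?_⟩⟩
  · intro z hz
    simp only [hℓ]
    rw [Complex.exp_log (hslit' z hz)]; ring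
  · intro z hz
    exact (hℓle z hz).trans (mul_le_mul_of_nonneg_right (le_max_left _ _) (norm_nonneg _))
  · intro z hz
    have hn : ‖-(a : ℂ) * ℓ z‖ = a * ‖ℓ z‖ := by
      rw [norm_mul, norm_neg, Complex.norm_real, Real.norm_of_nonneg ha.le]
    have h1 : ‖Complex.exp (-(a : ℂ) * ℓ z) - 1‖ ≤ 2 * ‖-(a : ℂ) * ℓ z‖ :=
      Complex.norm_exp_sub_one_le (by rw [hn]; linarith [(hℓs z hz).2])
    have h2 : φ z - z = z * (Complex.exp (-a * ℓ z) - 1) := by rw [hφeq z hz]; ring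
    rw [h2, norm_mul]
    rw [hn] at h1
    have h3 := hℓle z hz
    calc ‖z‖ * ‖Complex.exp (-(a : ℂ) * ℓ z) - 1‖ ≤ ‖z‖ * (2 * (a * (K * ‖z‖))) := by
          refine mul_le_mul_of_nonneg_left (h1.trans ?_) (norm_nonneg _)
          gcongr
      _ = 2 * (a * K) * ‖z‖ ^ 2 := by ring
      _ ≤ _ := mul_le_mul_of_nonneg_right (le_max_right _ _) (by positivity)
  · intro z hz
    have h1 := (hb z hz).2.1.2
    refine ⟨lt_of_lt_of_le h1 (min_le_left _ _), ?_⟩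
    have := lt_of_lt_of_le h1 (min_le_right _ _)
    rwa [lt_div_iff₀ (by positivity), mul_comm] at this
  · intro z hz
    simp only [hℓ]
    rw [(hb z hz).2.2.2, hlogconj _ (lt_of_lt_of_le (hb z hz).2.1.2 (min_le_left _ _))]

namespace LobeChart

variable {a : ℝ} (c : LobeChart a)

theorem log_one_sub {z : ℂ} (hz : ‖z‖ < c.δ) : Complex.log (1 - c.φ z / 2) = c.ℓ z := by
  have h1 : 1 - c.φ z / 2 = Complex.exp (c.ℓ z) := by
    linear_combination (1 / 2) * c.two_sub_φ z hz
  have h2 := Complex.abs_im_le_norm (c.ℓ z)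
  have h3 := (c.ℓ_small z hz).1
  have h4 := Real.pi_gt_three
  rw [abs_le] at h2
  rw [h1, Complex.log_exp] <;> linarith

theorem φ_injOn : Set.InjOn c.φ {z | ‖z‖ < c.δ} := by
  intro z hz w hw h
  have h1 : c.ℓ z = c.ℓ w := by rw [← c.log_one_sub hz, ← c.log_one_sub hw, h]
  rw [c.φ_eq z hz, c.φ_eq w hw, h1] at h
  exact mul_right_cancel₀ (Complex.exp_ne_zero _) h

theorem continuousAt_φ {z : ℂ} (hz : ‖z‖ < c.δ) : ContinuousAt c.φ z := by
  have h1 : ContinuousAt (fun z => z * Complex.exp (-a * c.ℓ z)) z := by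
    have := (c.differentiableAt z hz).continuousAt
    fun_prop
  refine h1.congr ?_
  filter_upwards [(isOpen_lt continuous_norm continuous_const).mem_nhds hz] with w hw
  exact (c.φ_eq w hw).symm

/-- Near `0` the angle of `1 - x/2` is dominated by the angles between `x` and the real axis. -/
theorem angle_bound (ha : 0 < a) {x : ℂ} (hx : ‖x‖ < 1) (hx' : a * (Real.pi / 2) * ‖x‖ < 1)
    (him : x.im ≠ 0) : a * |Complex.arg (1 - x / 2)| < |Complex.arg x| ∧
      a * |Complex.arg (1 - x / 2)| < Real.pi - |Complex.arg x| := by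
  have hpi := Real.pi_pos
  have hre := abs_le.1 (Complex.abs_re_le_norm x)
  have hx0 : 0 < ‖x‖ := norm_pos_iff.2 (by rintro rfl; simp at him)
  have hn : 1 / 2 ≤ ‖1 - x / 2‖ := by
    have h1 : (1 - x / 2).re ≤ ‖1 - x / 2‖ := Complex.re_le_norm _
    have h2 : (1 - x / 2).re = 1 - x.re / 2 := by simp
    linarith [hre.2]
  have h1 : |Complex.arg (1 - x / 2)| ≤ Real.pi / 2 * |x.im| := by
    have h2 : |Complex.arg (1 - x / 2)| ≤ Real.pi / 2 :=
      Complex.abs_arg_le_pi_div_two_iff.2 (by simp; linarith [hre.2])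
    -- Jordan's inequality bounds the angle by π/2 times its sine, and the sine is at most |Im x|
    -- because |1 - x/2| ≥ 1/2.
    have h3 := Real.mul_le_sin (abs_nonneg (Complex.arg (1 - x / 2))) h2
    have h4 : Real.sin |Complex.arg (1 - x / 2)| = |Real.sin (Complex.arg (1 - x / 2))| :=
      (Real.abs_sin_eq_sin_abs_of_abs_le_pi (h2.trans (by linarith))).symm
    rw [h4, Complex.sin_arg, abs_div, abs_norm] at h3
    have h5 : |(1 - x / 2).im| / ‖1 - x / 2‖ ≤ |x.im| := by
      rw [div_le_iff₀ (by linarith)]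
      have : (1 - x / 2).im = -(x.im / 2) := by simp
      rw [this, abs_neg, abs_div, abs_of_pos (two_pos : (0 : ℝ) < 2)]
      nlinarith [abs_nonneg x.im]
    have h6 := h3.trans h5
    have h7 := mul_le_mul_of_nonneg_left h6 (show 0 ≤ Real.pi / 2 by positivity)
    have h8 : Real.pi / 2 * (2 / Real.pi * |Complex.arg (1 - x / 2)|)
        = |Complex.arg (1 - x / 2)| := by field_simp
    rwa [h8] at h7
  have h2 : a * |Complex.arg (1 - x / 2)| < |x.im| / ‖x‖ := by
    rw [lt_div_iff₀ hx0]
    have h3 : 0 < |x.im| := abs_pos.2 him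
    calc a * |Complex.arg (1 - x / 2)| * ‖x‖ ≤ a * (Real.pi / 2 * |x.im|) * ‖x‖ := by gcongr
      _ = (a * (Real.pi / 2) * ‖x‖) * |x.im| := by ring
      _ < 1 * |x.im| := by gcongr
      _ = |x.im| := one_mul _
  have h3 : |x.im| / ‖x‖ = Real.sin |Complex.arg x| := by
    rw [← Real.abs_sin_eq_sin_abs_of_abs_le_pi (Complex.abs_arg_le_pi x), Complex.sin_arg, abs_div,
      abs_norm]
  rw [h3] at h2
  refine ⟨h2.trans_le (Real.sin_le (abs_nonneg _)), h2.trans_le ?_⟩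
  rw [← Real.sin_pi_sub]
  exact Real.sin_le (sub_nonneg.2 (Complex.abs_arg_le_pi x))

end LobeChart

/-! ### The labelled roots for small `C` -/

/-- The local parameter `(e^τ / 2^t)^(1/s)` of a lobe. -/
def lobeVar (s t : ℕ) (τ : ℂ) : ℂ := Complex.exp ((τ - t * Real.log 2) / s)

theorem exp_nat_mul_log_two (t : ℕ) : Complex.exp (t * (Real.log 2 : ℝ)) = 2 ^ t := by
  rw [Complex.exp_nat_mul, ← Complex.ofReal_exp, Real.exp_log two_pos]; norm_num

theorem lobeVar_pow {s : ℕ} (hs : s ≠ 0) (t : ℕ) (τ : ℂ) :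
    lobeVar s t τ ^ s * 2 ^ t = Complex.exp τ := by
  have hs' : (s : ℂ) ≠ 0 := Nat.cast_ne_zero.2 hs
  rw [lobeVar, ← Complex.exp_nat_mul, ← exp_nat_mul_log_two, ← Complex.exp_add]
  congr 1
  field_simp
  ring

theorem norm_lobeVar (s t : ℕ) (τ : ℂ) :
    ‖lobeVar s t τ‖ = Real.exp ((τ.re - t * Real.log 2) / s) := by
  rw [lobeVar, Complex.norm_exp]
  congr 1
  rw [Complex.div_natCast_re]
  simp only [Complex.sub_re, Complex.mul_re, Complex.natCast_re, Complex.natCast_im,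
    Complex.ofReal_im, Complex.ofReal_re, mul_zero, sub_zero]

theorem lobeVar_ne_zero (s t : ℕ) (τ : ℂ) : lobeVar s t τ ≠ 0 := Complex.exp_ne_zero _

theorem continuous_lobeVar (s t : ℕ) : Continuous (lobeVar s t) := by
  unfold lobeVar; fun_prop

namespace LobeChart

variable {a : ℝ} (c : LobeChart a)

theorem φ_pow_mul {s t : ℕ} (hst : a * s = t) {z C : ℂ} (hz : ‖z‖ < c.δ)
    (h : z ^ s * 2 ^ t = C) : c.φ z ^ s * (2 - c.φ z) ^ t = C := by
  have hst' : (a : ℂ) * s = t := by exact_mod_cast hst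
  rw [c.two_sub_φ z hz, c.φ_eq z hz, ← h, mul_pow, mul_pow, ← Complex.exp_nat_mul,
    ← Complex.exp_nat_mul, ← hst']
  have : Complex.exp (s * (-a * c.ℓ z)) * Complex.exp (a * s * c.ℓ z) = 1 := by
    rw [← Complex.exp_add, ← Complex.exp_zero]; congr 1; ring
  linear_combination (z ^ s * 2 ^ t) * this

theorem abs_im_ℓ_lt {z : ℂ} (hz : ‖z‖ < c.δ) : |(c.ℓ z).im| < 1 / 2 :=
  (Complex.abs_im_le_norm _).trans_lt (c.ℓ_small z hz).1

theorem abs_mul_im_ℓ_lt (ha : 0 < a) {z : ℂ} (hz : ‖z‖ < c.δ) : |a * (c.ℓ z).im| < 1 / 2 := by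
  rw [abs_mul, abs_of_pos ha]
  exact (mul_le_mul_of_nonneg_left (Complex.abs_im_le_norm _) ha.le).trans_lt (c.ℓ_small z hz).2

theorem φ_lobeVar {s t : ℕ} {τ : ℂ} (hz : ‖lobeVar s t τ‖ < c.δ) :
    c.φ (lobeVar s t τ)
      = Complex.exp ((τ - t * Real.log 2) / s - a * c.ℓ (lobeVar s t τ)) := by
  rw [c.φ_eq _ hz]
  conv_lhs => enter [1]; rw [lobeVar]
  rw [← Complex.exp_add]
  congr 1; ring

/-- With s ≥ 3 the angle is at most 2π/3, which leaves room for the corrections by ℓ inside the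
principal strip of the logarithm. -/
theorem abs_im_div_le {s : ℕ} (hs : 3 ≤ s) {τ : ℂ} (h1 : -(2 * Real.pi) < τ.im) (h2 : τ.im ≤ 0) :
    |τ.im / s| ≤ 2 * Real.pi / 3 := by
  have hs' : (3 : ℝ) ≤ s := by exact_mod_cast hs
  rw [abs_div, abs_of_nonpos h2, abs_of_pos (by linarith : (0 : ℝ) < s)]
  have := Real.pi_pos
  exact div_le_div₀ (by linarith) (by linarith) (by norm_num) hs'

theorem log_φ_lobeVar (ha : 0 < a) {s t : ℕ} (hs : 3 ≤ s) {τ : ℂ} (h1 : -(2 * Real.pi) < τ.im)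
    (h2 : τ.im ≤ 0) (hz : ‖lobeVar s t τ‖ < c.δ) :
    Complex.log (c.φ (lobeVar s t τ))
      = (τ - t * Real.log 2) / s - a * c.ℓ (lobeVar s t τ) := by
  have him : ((τ - t * Real.log 2) / s - a * c.ℓ (lobeVar s t τ)).im
      = τ.im / s - a * (c.ℓ (lobeVar s t τ)).im := by
    rw [Complex.sub_im, Complex.div_natCast_im, Complex.im_ofReal_mul]
    simp only [Complex.sub_im, Complex.mul_im, Complex.natCast_re, Complex.natCast_im,
      Complex.ofReal_im, Complex.ofReal_re, mul_zero, zero_mul, add_zero, sub_zero]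
  have h3 := abs_le.1 (abs_im_div_le hs h1 h2)
  have h4 := abs_lt.1 (c.abs_mul_im_ℓ_lt ha hz)
  have h5 := Real.pi_gt_three
  rw [c.φ_lobeVar hz, Complex.log_exp] <;> rw [him] <;> linarith

theorem arg_φ_lobeVar (ha : 0 < a) {s t : ℕ} (hst : a * s = t) (hs : 3 ≤ s) {τ : ℂ}
    (h1 : -(2 * Real.pi) < τ.im) (h2 : τ.im ≤ 0) (hz : ‖lobeVar s t τ‖ < c.δ) :
    s * Complex.arg (c.φ (lobeVar s t τ)) + t * Complex.arg (1 - c.φ (lobeVar s t τ) / 2)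
      = τ.im := by
  have h3 := congrArg Complex.im (c.log_φ_lobeVar ha hs h1 h2 hz)
  have h4 := congrArg Complex.im (c.log_one_sub hz)
  rw [Complex.log_im] at h3 h4
  have hs' : (s : ℝ) ≠ 0 := Nat.cast_ne_zero.2 (by omega)
  rw [h3, h4, Complex.sub_im, Complex.div_natCast_im, Complex.im_ofReal_mul, ← hst]
  simp only [Complex.sub_im, Complex.mul_im, Complex.natCast_re, Complex.natCast_im,
    Complex.ofReal_im, Complex.ofReal_re]
  field_simp
  ring

/-- By `arg_φ_lobeVar`, arg x + a arg(1 - x/2) has the sign of Im τ, and by `angle_bound` the first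
term dominates. The half-plane of x is what identifies the labels p and N. -/
theorem im_φ_lobeVar_neg (ha : 0 < a) {s t : ℕ} (hst : a * s = t) (hs : 3 ≤ s) {τ : ℂ}
    (h1 : -(2 * Real.pi) < τ.im) (h2 : τ.im < 0) (hz : ‖lobeVar s t τ‖ < c.δ) :
    (c.φ (lobeVar s t τ)).im < 0 := by
  have h3 := c.arg_φ_lobeVar ha hst hs h1 h2.le hz
  have hsm := c.φ_small _ hz
  set x := c.φ (lobeVar s t τ) with hx
  have hs' : (0 : ℝ) < s := Nat.cast_pos.2 (by omega)
  rw [← hst] at h3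
  have h4 : Complex.arg x + a * Complex.arg (1 - x / 2) < 0 := by
    have : s * (Complex.arg x + a * Complex.arg (1 - x / 2)) < s * 0 := by
      rw [mul_zero]; linarith
    exact lt_of_mul_lt_mul_left this hs'.le
  by_contra! h
  have h5 : 0 ≤ Complex.arg x := Complex.arg_nonneg_iff.2 h
  rcases h.eq_or_lt with h0 | h0
  · have h6 : Complex.arg (1 - x / 2) = 0 := by
      rw [Complex.arg_eq_zero_iff]
      have := (abs_le.1 (Complex.abs_re_le_norm x)).2
      constructor
      · simp; linarith [hsm.1]
      · simp [← h0]
    rw [h6] at h4; linarith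
  · have h6 := (angle_bound ha hsm.1 hsm.2 h0.ne').1
    rw [abs_of_nonneg h5] at h6
    have h7 := neg_abs_le (Complex.arg (1 - x / 2))
    have := mul_le_mul_of_nonneg_left h7 ha.le
    linarith

end LobeChart

theorem neg_exp_mem_slitPlane {τ : ℂ} (h1 : -(2 * Real.pi) < τ.im) (h2 : τ.im < 0) :
    -Complex.exp τ ∈ Complex.slitPlane := by
  have := (neg_rotate_mem_slitPlane (Real.exp_pos τ.re) h1 h2).1
  rwa [Complex.ofReal_exp, ← Complex.exp_add, Complex.re_add_im] at this

theorem arg_two_sub (x : ℂ) : Complex.arg (2 - x) = Complex.arg (1 - x / 2) := by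
  have : 2 - x = ((2 : ℝ) : ℂ) * (1 - x / 2) := by push_cast; ring
  rw [this, Complex.arg_real_mul _ two_pos]

/-- A root near `1` has absolute phase below `p`. -/
theorem abs_phase_lt_of_near_one {N p : ℕ} (hp : 0 < p) (hpN : p < N) {a : ℝ} (ha : 0 < a)
    (hap : a * p = (N - p : ℕ)) {x : ℂ} (hx : ‖x‖ < 1) (hx' : a * (Real.pi / 2) * ‖x‖ < 1)
    (hoff : OffSegment (1 - x)) : |rootPhase N p (1 - x)| < p := by
  have hp' : (0 : ℝ) < p := Nat.cast_pos.2 hp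
  rw [Nat.cast_sub hpN.le] at hap
  have upper : ∀ x : ℂ, ‖x‖ < 1 → a * (Real.pi / 2) * ‖x‖ < 1 → x.im < 0 →
      |rootPhase N p (1 - x)| < p := by
    intro x hx hx' him
    rw [abs_of_pos (rootPhase_pos hp hpN (by simpa using him)), rootPhase_eq,
      div_lt_iff₀ Real.pi_pos, show (1 - x - 1 : ℂ) = -x by ring,
      show (1 - x + 1 : ℂ) = 2 - x by ring, Complex.arg_neg_eq_arg_add_pi_of_im_neg him,
      arg_two_sub, ← hap]
    have h1 := (LobeChart.angle_bound ha hx hx' him.ne).1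
    rw [abs_of_neg (Complex.arg_neg_iff.2 him)] at h1
    have h2 := mul_le_mul_of_nonneg_left (le_abs_self (Complex.arg (1 - x / 2))) ha.le
    have h3 := mul_lt_mul_of_pos_left (h2.trans_lt h1) hp'
    linarith
  rcases lt_trichotomy x.im 0 with h | h | h
  · exact upper x hx hx' h
  · have h0 : (1 - x).im = 0 := by simp [h]
    have hre := abs_le.1 (Complex.abs_re_le_norm x)
    rcases hoff with h1 | h1 | h1
    · exact absurd h0 h1
    · rw [rootPhase_of_one_lt N p h0 h1, abs_zero]; exact hp'
    · simp at h1; linarith [hre.2]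
  · have h1 := upper ((starRingEnd ℂ) x) (by rwa [Complex.norm_conj])
      (by rwa [Complex.norm_conj]) (by simpa using h)
    have h2 : 1 - (starRingEnd ℂ) x = (starRingEnd ℂ) (1 - x) := by simp
    rwa [h2, rootPhase_conj N p (by simpa using h.ne'), abs_neg] at h1

/-- A primitive `p`-th root of unity. -/
def unityRoot (p : ℕ) : ℂ := Complex.exp (2 * Real.pi * Complex.I / p)

theorem unityRoot_isPrimitive {p : ℕ} (hp : 0 < p) : IsPrimitiveRoot (unityRoot p) p :=
  Complex.isPrimitiveRoot_exp p hp.ne'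

theorem norm_mul_unityRoot_pow {p : ℕ} (hp : 0 < p) (z : ℂ) (k : ℕ) :
    ‖z * unityRoot p ^ k‖ = ‖z‖ := by
  rw [norm_mul, norm_pow, (unityRoot_isPrimitive hp).norm'_eq_one hp.ne', one_pow, mul_one]

section SmallRoots

variable {N p : ℕ} {a b : ℝ} (ca : LobeChart a) (cb : LobeChart b)

/-- The lobe point lies below the real axis, so the root is above it and its phase is p + Im τ / π,
in the interval (p - 2, p] of label p. -/
theorem slitRoot_p_eq (hp : 3 ≤ p) (hpN : p < N) (ha : 0 < a) (hap : a * p = (N - p : ℕ)) {τ : ℂ}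
    (h1 : -(2 * Real.pi) < τ.im) (h2 : τ.im < 0) (hz : ‖lobeVar p (N - p) τ‖ < ca.δ) :
    slitRoot N p p (Complex.exp τ) = 1 - ca.φ (lobeVar p (N - p) τ) := by
  have him := ca.im_φ_lobeVar_neg ha hap hp h1 h2 hz
  have harg := ca.arg_φ_lobeVar ha hap hp h1 h2.le hz
  have hpow := ca.φ_pow_mul hap hz (lobeVar_pow (by omega) _ τ)
  set x := ca.φ (lobeVar p (N - p) τ) with hx
  refine slitRoot_eq (by omega) hpN (neg_exp_mem_slitPlane h1 h2) ?_ ⟨0, ?_⟩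
  · rw [← hpow]; ring
  · have hF : rootPhase N p (1 - x) = p + τ.im / Real.pi := by
      rw [rootPhase_eq, show (1 - x - 1 : ℂ) = -x by ring, show (1 - x + 1 : ℂ) = 2 - x by ring,
        Complex.arg_neg_eq_arg_add_pi_of_im_neg him, arg_two_sub, ← harg, Nat.cast_sub hpN.le]
      have := Real.pi_pos.ne'
      field_simp
      ring
    have h3 : -2 < τ.im / Real.pi := by rw [lt_div_iff₀ Real.pi_pos]; linarith
    have h4 : τ.im / Real.pi < 0 := div_neg_of_neg_of_pos h2 Real.pi_pos
    rw [hF]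
    constructor <;> push_cast <;> linarith

theorem slitRoot_N_eq (hp : 0 < p) (hpN : p + 3 ≤ N) (hb : 0 < b)
    (hbp : b * (N - p : ℕ) = p) {τ : ℂ} (h1 : -(2 * Real.pi) < τ.im) (h2 : τ.im < 0)
    (hz : ‖lobeVar (N - p) p τ‖ < cb.δ) :
    slitRoot N p N (Complex.exp τ) = -1 + cb.φ (lobeVar (N - p) p τ) := by
  have hn : 3 ≤ N - p := by omega
  have him := cb.im_φ_lobeVar_neg hb hbp hn h1 h2 hz
  have harg := cb.arg_φ_lobeVar hb hbp hn h1 h2.le hz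
  have hpow := cb.φ_pow_mul hbp hz (lobeVar_pow (by omega) _ τ)
  set y := cb.φ (lobeVar (N - p) p τ) with hy
  -- Here the phase is -p + Im τ / π; adding 2N once, hence the witness 1, puts it in the interval
  -- of label N.
  refine slitRoot_eq hp (by omega) (neg_exp_mem_slitPlane h1 h2) ?_ ⟨1, ?_⟩
  · rw [← hpow]; ring
  · have hF : rootPhase N p (-1 + y) = -p + τ.im / Real.pi := by
      rw [rootPhase_eq, show (-1 + y - 1 : ℂ) = -(2 - y) by ring,
        show (-1 + y + 1 : ℂ) = y by ring,
        Complex.arg_neg_eq_arg_sub_pi_of_im_pos (by simpa using him), arg_two_sub, ← harg,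
        Nat.cast_sub (by omega)]
      have := Real.pi_pos.ne'
      field_simp
      ring
    have h3 : -2 < τ.im / Real.pi := by rw [lt_div_iff₀ Real.pi_pos]; linarith
    have h4 : τ.im / Real.pi < 0 := div_neg_of_neg_of_pos h2 Real.pi_pos
    rw [hF]
    constructor <;> push_cast <;> linarith

/-- The p points ζω^k give p distinct roots near 1. Each has |F| < p, so its label is among the
first p, and equality follows by counting. Which k carries which label is not needed. -/
theorem slitRoot_multiset_eq (hp : 3 ≤ p) (hpN : p < N) (ha : 0 < a) (hap : a * p = (N - p : ℕ))
    {τ : ℂ} (h1 : -(2 * Real.pi) < τ.im) (h2 : τ.im < 0) (hz : ‖lobeVar p (N - p) τ‖ < ca.δ) :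
    (Finset.Icc 1 p).val.map (fun j => slitRoot N p j (Complex.exp τ))
      = (Finset.range p).val.map
          fun k => 1 - ca.φ (lobeVar p (N - p) τ * unityRoot p ^ k) := by
  have hp0 : 0 < p := by omega
  have hC := neg_exp_mem_slitPlane h1 h2
  have hprim := unityRoot_isPrimitive hp0
  have hzk : ∀ k, ‖lobeVar p (N - p) τ * unityRoot p ^ k‖ < ca.δ := fun k => by
    rwa [norm_mul_unityRoot_pow hp0]
  symm
  refine Multiset.eq_of_le_of_card_le ?_ (by simp)
  rw [Multiset.le_iff_subset]
  · intro u hu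
    obtain ⟨k, -, rfl⟩ := Multiset.mem_map.1 hu
    have hpow := ca.φ_pow_mul hap (hzk k) (C := Complex.exp τ) (by
      rw [mul_pow, ← pow_mul, mul_comm k p, pow_mul, hprim.pow_eq_one, one_pow, mul_one,
        lobeVar_pow (by omega)])
    have hQ : (1 - (1 - ca.φ (lobeVar p (N - p) τ * unityRoot p ^ k))) ^ p *
        (1 + (1 - ca.φ (lobeVar p (N - p) τ * unityRoot p ^ k))) ^ (N - p)
          = Complex.exp τ := by rw [← hpow]; ring
    have hsm := ca.φ_small _ (hzk k)
    obtain ⟨j, hj, hju⟩ := slitRoot_label_le hp0 hpN hC hQ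
      (abs_phase_lt_of_near_one hp0 hpN ha hap hsm.1 hsm.2 (offSegment_of_root hC hQ))
    exact Multiset.mem_map.2 ⟨j, hj, hju⟩
  · refine Multiset.Nodup.map_on ?_ (Finset.range p).nodup
    intro k hk l hl hkl
    have h3 := ca.φ_injOn (hzk k) (hzk l) (sub_right_injective hkl)
    exact hprim.pow_inj (Finset.mem_range.1 hk) (Finset.mem_range.1 hl)
      (mul_left_cancel₀ (lobeVar_ne_zero _ _ _) h3)

theorem exp_eq_real_mul {τ : ℂ} (h : τ.im = 0) : Complex.exp τ = (Real.exp τ.re : ℝ) := by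
  rw [Complex.ofReal_exp]; congr 1; exact Complex.ext rfl (by simpa using h)

theorem tendsto_lobeVar (s t : ℕ) (τ : ℂ) :
    Tendsto (fun δ : ℝ => lobeVar s t (τ + δ * Complex.I)) (𝓝[<] 0) (𝓝 (lobeVar s t τ)) := by
  have h : Continuous fun δ : ℝ => lobeVar s t (τ + δ * Complex.I) :=
    (continuous_lobeVar s t).comp (by fun_prop)
  have := (h.tendsto 0).mono_left (nhdsWithin_le_nhds (s := Set.Iio 0))
  simpa using this

theorem norm_lobeVar_add (s t : ℕ) (τ : ℂ) (δ : ℝ) :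
    ‖lobeVar s t (τ + δ * Complex.I)‖ = ‖lobeVar s t τ‖ := by
  rw [norm_lobeVar, norm_lobeVar]; simp

/-- Transfer of a formula for a root from the slit plane to the positive axis. -/
theorem root_eq_of_slit {j : ℕ} (hp : 0 < p) (hpN : p < N) (hj : 1 ≤ j) (hjN : j ≤ N)
    {f : ℂ → ℂ} {τ : ℂ} (h1 : -(2 * Real.pi) < τ.im) (h2 : τ.im ≤ 0)
    (hf : Tendsto (fun δ : ℝ => f (τ + δ * Complex.I)) (𝓝[<] 0) (𝓝 (f τ)))
    (h : ∀ σ : ℂ, σ.re = τ.re → -(2 * Real.pi) < σ.im → σ.im < 0 →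
      slitRoot N p j (Complex.exp σ) = f σ) : root N p j (Complex.exp τ) = f τ := by
  rcases h2.lt_or_eq with h2 | h2
  · rw [root_of_slit (neg_exp_mem_slitPlane h1 h2), h τ rfl h1 h2]
  · have ht := tendsto_root hp hpN (Real.exp_pos τ.re) hj hjN
    rw [exp_eq_real_mul h2]
    refine tendsto_nhds_unique ht (hf.congr' ?_)
    filter_upwards [Ioo_mem_nhdsLT (show -Real.pi < 0 by linarith [Real.pi_pos])] with δ hδ
    have him : (τ + δ * Complex.I).im = δ := by simp [h2]
    rw [← exp_eq_real_mul h2, ← Complex.exp_add,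
      root_of_slit (neg_exp_mem_slitPlane (by rw [him]; linarith [hδ.1, Real.pi_pos])
        (by rw [him]; exact hδ.2)),
      h _ (by simp) (by rw [him]; linarith [hδ.1, Real.pi_pos]) (by rw [him]; exact hδ.2)]

theorem root_p_eq (hp : 3 ≤ p) (hpN : p < N) (ha : 0 < a) (hap : a * p = (N - p : ℕ)) {τ : ℂ}
    (h1 : -(2 * Real.pi) < τ.im) (h2 : τ.im ≤ 0) (hz : ‖lobeVar p (N - p) τ‖ < ca.δ) :
    root N p p (Complex.exp τ) = 1 - ca.φ (lobeVar p (N - p) τ) := by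
  refine root_eq_of_slit (by omega) hpN (by omega) hpN.le
    (f := fun σ => 1 - ca.φ (lobeVar p (N - p) σ)) h1 h2 ?_ ?_
  · exact ((ca.continuousAt_φ hz).tendsto.comp (tendsto_lobeVar _ _ τ)).const_sub 1
  · intro σ hσ h3 h4
    exact slitRoot_p_eq ca hp hpN ha hap h3 h4 (by rwa [norm_lobeVar, hσ, ← norm_lobeVar])

theorem root_N_eq (hp : 0 < p) (hpN : p + 3 ≤ N) (hb : 0 < b) (hbp : b * (N - p : ℕ) = p) {τ : ℂ}
    (h1 : -(2 * Real.pi) < τ.im) (h2 : τ.im ≤ 0) (hz : ‖lobeVar (N - p) p τ‖ < cb.δ) :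
    root N p N (Complex.exp τ) = -1 + cb.φ (lobeVar (N - p) p τ) := by
  refine root_eq_of_slit hp (by omega) (by omega) le_rfl
    (f := fun σ => -1 + cb.φ (lobeVar (N - p) p σ)) h1 h2 ?_ ?_
  · exact ((cb.continuousAt_φ hz).tendsto.comp (tendsto_lobeVar _ _ τ)).const_add (-1)
  · intro σ hσ h3 h4
    exact slitRoot_N_eq cb hp hpN hb hbp h3 h4 (by rwa [norm_lobeVar, hσ, ← norm_lobeVar])

open Polynomial in
-- On the positive axis the identity is a limit. As labels and powers of ω are not matched
-- individually, the limit is taken in the product ∏(z - u_j), which determines the multiset.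
theorem root_multiset_eq (hp : 3 ≤ p) (hpN : p < N) (ha : 0 < a) (hap : a * p = (N - p : ℕ))
    {τ : ℂ} (h1 : -(2 * Real.pi) < τ.im) (h2 : τ.im ≤ 0) (hz : ‖lobeVar p (N - p) τ‖ < ca.δ) :
    (Finset.Icc 1 p).val.map (fun j => root N p j (Complex.exp τ))
      = (Finset.range p).val.map
          fun k => 1 - ca.φ (lobeVar p (N - p) τ * unityRoot p ^ k) := by
  have hp0 : 0 < p := by omega
  rcases h2.lt_or_eq with h2 | h2
  · simp only [root_of_slit (neg_exp_mem_slitPlane h1 h2)]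
    exact slitRoot_multiset_eq ca hp hpN ha hap h1 h2 hz
  have hpoly : ∀ z : ℂ, ∏ j ∈ Finset.Icc 1 p, (z - root N p j (Complex.exp τ))
      = ∏ k ∈ Finset.range p, (z - (1 - ca.φ (lobeVar p (N - p) τ * unityRoot p ^ k))) := by
    intro z
    rw [exp_eq_real_mul h2]
    have hl : Tendsto (fun δ : ℝ => ∏ j ∈ Finset.Icc 1 p,
        (z - root N p j (Real.exp τ.re * Complex.exp (δ * Complex.I)))) (𝓝[<] 0)
        (𝓝 (∏ j ∈ Finset.Icc 1 p, (z - root N p j (Real.exp τ.re)))) :=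
      tendsto_finsetProd _ fun j hj => by
        rw [Finset.mem_Icc] at hj
        exact (tendsto_root hp0 hpN (Real.exp_pos τ.re) hj.1 (hj.2.trans hpN.le)).const_sub z
    have hr : Tendsto (fun δ : ℝ => ∏ k ∈ Finset.range p,
        (z - (1 - ca.φ (lobeVar p (N - p) (τ + δ * Complex.I) * unityRoot p ^ k)))) (𝓝[<] 0)
        (𝓝 (∏ k ∈ Finset.range p,
          (z - (1 - ca.φ (lobeVar p (N - p) τ * unityRoot p ^ k))))) :=
      tendsto_finsetProd _ fun k _ => by
        have hc := ca.continuousAt_φ (z := lobeVar p (N - p) τ * unityRoot p ^ k)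
          (by rwa [norm_mul_unityRoot_pow hp0])
        exact ((hc.tendsto.comp ((tendsto_lobeVar p (N - p) τ).mul_const _)).const_sub 1).const_sub z
    refine tendsto_nhds_unique hl (hr.congr' ?_)
    filter_upwards [Ioo_mem_nhdsLT (show -Real.pi < 0 by linarith [Real.pi_pos])] with δ hδ
    have him : (τ + δ * Complex.I).im = δ := by simp [h2]
    have h3 : -(2 * Real.pi) < (τ + δ * Complex.I).im := by
      rw [him]; linarith [hδ.1, Real.pi_pos]
    have h4 : (τ + δ * Complex.I).im < 0 := by rw [him]; exact hδ.2
    have hm := slitRoot_multiset_eq ca hp hpN ha hap h3 h4 (by rwa [norm_lobeVar_add])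
    rw [← exp_eq_real_mul h2, ← Complex.exp_add]
    simp only [root_of_slit (neg_exp_mem_slitPlane h3 h4)]
    have := congrArg (fun s => (s.map fun w => z - w).prod) hm
    simp only [Multiset.map_map, Function.comp_def] at this
    exact this.symm
  have heq : (((Finset.Icc 1 p).val.map (fun j => root N p j (Complex.exp τ))).map
        (fun w => X - Polynomial.C w)).prod
      = (((Finset.range p).val.map
          (fun k => 1 - ca.φ (lobeVar p (N - p) τ * unityRoot p ^ k))).map
        (fun w => X - Polynomial.C w)).prod := by
    refine Polynomial.funext fun z => ?_
    simp only [Polynomial.eval_multiset_prod, Multiset.map_map, Function.comp_def, eval_sub,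
      eval_X, eval_C]
    exact hpoly z
  rw [← Polynomial.roots_multiset_prod_X_sub_C
    ((Finset.Icc 1 p).val.map (fun j => root N p j (Complex.exp τ))), heq,
    Polynomial.roots_multiset_prod_X_sub_C]

theorem sum_root_eq (hp : 3 ≤ p) (hpN : p < N) (ha : 0 < a) (hap : a * p = (N - p : ℕ))
    {τ : ℂ} (h1 : -(2 * Real.pi) < τ.im) (h2 : τ.im ≤ 0) (hz : ‖lobeVar p (N - p) τ‖ < ca.δ)
    (f : ℂ → ℂ) : ∑ j ∈ Finset.Icc 1 p, f (root N p j (Complex.exp τ))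
      = ∑ k ∈ Finset.range p, f (1 - ca.φ (lobeVar p (N - p) τ * unityRoot p ^ k)) := by
  have := congrArg (fun s => (s.map f).sum) (root_multiset_eq ca hp hpN ha hap h1 h2 hz)
  simp only [Multiset.map_map, Function.comp_def] at this
  exact this

theorem prod_root_eq (hp : 3 ≤ p) (hpN : p < N) (ha : 0 < a) (hap : a * p = (N - p : ℕ))
    {τ : ℂ} (h1 : -(2 * Real.pi) < τ.im) (h2 : τ.im ≤ 0) (hz : ‖lobeVar p (N - p) τ‖ < ca.δ)
    (f : ℂ → ℂ) : ∏ j ∈ Finset.Icc 1 p, f (root N p j (Complex.exp τ))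
      = ∏ k ∈ Finset.range p, f (1 - ca.φ (lobeVar p (N - p) τ * unityRoot p ^ k)) := by
  have := congrArg (fun s => (s.map f).prod) (root_multiset_eq ca hp hpN ha hap h1 h2 hz)
  simp only [Multiset.map_map, Function.comp_def] at this
  exact this

end SmallRoots

/-! ### The consistency equations for small `C` -/

theorem prod_neg_unityRoot_pow {p : ℕ} (hp : 0 < p) :
    ∏ k ∈ Finset.range p, (-unityRoot p ^ k) = -1 := by
  have h := X_pow_sub_C_eq_prod (unityRoot_isPrimitive hp) hp (one_pow p)
  have h1 := congrArg (Polynomial.eval 0) h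
  rw [Polynomial.eval_prod] at h1
  simp [hp.ne'] at h1
  exact h1.symm

/-- Conjugation permutes the p-th roots of unity, k ↦ p - k; this makes the shift real at real
arguments. -/
theorem sum_unityRoot_conj {p : ℕ} (hp : 0 < p) (f : ℂ → ℂ) :
    ∑ k ∈ Finset.range p, f ((starRingEnd ℂ) (unityRoot p ^ k))
      = ∑ k ∈ Finset.range p, f (unityRoot p ^ k) := by
  have hprim := unityRoot_isPrimitive hp
  have hconj : (starRingEnd ℂ) (unityRoot p) = (unityRoot p)⁻¹ :=
    (Complex.inv_eq_conj (hprim.norm'_eq_one hp.ne')).symm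
  have h1 : ∀ k ∈ Finset.range p, f ((starRingEnd ℂ) (unityRoot p ^ k))
      = f (unityRoot p ^ (p - 1 - k + 1)) := by
    intro k hk
    rw [Finset.mem_range] at hk
    congr 1
    rw [map_pow, hconj, inv_pow, inv_eq_iff_eq_inv]
    refine eq_inv_of_mul_eq_one_left ?_
    rw [← pow_add, show k + (p - 1 - k + 1) = p by omega, hprim.pow_eq_one]
  rw [Finset.sum_congr rfl h1, Finset.sum_range_reflect (fun k => f (unityRoot p ^ (k + 1))) p]
  have h2 := Finset.sum_range_succ (fun k => f (unityRoot p ^ k)) p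
  rw [Finset.sum_range_succ', hprim.pow_eq_one, pow_zero] at h2
  exact add_right_cancel h2

/-- The correction to the leading order of `τ = log C` in the consistency equations. -/
def lobeShift {a b : ℝ} (ca : LobeChart a) (cb : LobeChart b) (N p : ℕ) (τ : ℂ) : ℂ :=
  p * cb.ℓ (lobeVar (N - p) p τ) + (N - p : ℕ) * (ca.ℓ (lobeVar p (N - p) τ) -
    ∑ k ∈ Finset.range p, ca.ℓ (lobeVar p (N - p) τ * unityRoot p ^ k))

/-- The leading order `γ p (N - p) + N log 2` of `log C`. -/
def leadingLog (N p : ℕ) (γ : ℝ) : ℝ := p * (N - p : ℕ) * γ + N * Real.log 2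

section

variable {N p : ℕ} {a b : ℝ} (ca : LobeChart a) (cb : LobeChart b)

/-- In the lobe coordinates every logarithm in the equation is affine in τ up to a value of ℓ,
without jumps by 2πi. Multiplying by p(N - p) isolates τ. -/
theorem logConsistency_iff (hp : 3 ≤ p) (hpN : p + 3 ≤ N) (ha : 0 < a) (hb : 0 < b)
    (hap : a * p = (N - p : ℕ)) (hbp : b * (N - p : ℕ) = p) {τ : ℂ} {γ : ℝ}
    (h1 : -(2 * Real.pi) < τ.im) (h2 : τ.im ≤ 0)
    (hζ : ‖lobeVar p (N - p) τ‖ < ca.δ) (hξ : ‖lobeVar (N - p) p τ‖ < cb.δ) :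
    LogConsistency N p γ (Complex.exp τ) ↔
      τ = leadingLog N p γ + lobeShift ca cb N p τ := by
  have hpN' : p < N := by omega
  have hζk : ∀ k, ‖lobeVar p (N - p) τ * unityRoot p ^ k‖ < ca.δ := fun k => by
    rwa [norm_mul_unityRoot_pow (by omega)]
  have hL : Complex.exp (Real.log 2 : ℝ) = 2 := by
    rw [← Complex.ofReal_exp, Real.exp_log two_pos]; norm_num
  have hlog2 : Complex.log 2 = (Real.log 2 : ℝ) := by
    rw [Complex.ofReal_log two_pos.le]; norm_num
  set L : ℂ := ((Real.log 2 : ℝ) : ℂ) with hLdef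
  have hLim : L.im = 0 := Complex.ofReal_im _
  have hpi := Real.pi_gt_three
  have hlog : ∀ z, ‖z‖ < ca.δ → Complex.log (1 + (1 - ca.φ z)) = L + ca.ℓ z := by
    intro z hz
    have h3 := abs_lt.1 (ca.abs_im_ℓ_lt hz)
    rw [show 1 + (1 - ca.φ z) = 2 - ca.φ z by ring, ca.two_sub_φ z hz, ← hL, ← Complex.exp_add,
      Complex.log_exp] <;> rw [Complex.add_im, hLim] <;> linarith
  have hG : G N p (Complex.exp τ) = 1 / (p : ℂ) *
      (p * L + ∑ k ∈ Finset.range p, ca.ℓ (lobeVar p (N - p) τ * unityRoot p ^ k)) - L := by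
    rw [G, sum_root_eq ca hp hpN' ha hap h1 h2 hζ (fun u => Complex.log (1 + u)), hlog2,
      Finset.sum_congr rfl fun k _ => hlog _ (hζk k), Finset.sum_add_distrib]
    simp
  have hquot : Complex.log ((root N p N (Complex.exp τ) + 1) / (root N p p (Complex.exp τ) + 1))
      = (τ - p * L) / (N - p : ℕ) - b * cb.ℓ (lobeVar (N - p) p τ) - L
        - ca.ℓ (lobeVar p (N - p) τ) := by
    rw [root_p_eq ca hp hpN' ha hap h1 h2 hζ, root_N_eq cb (by omega) hpN hb hbp h1 h2 hξ,
      show 1 - ca.φ (lobeVar p (N - p) τ) + 1 = 2 - ca.φ (lobeVar p (N - p) τ) by ring,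
      ca.two_sub_φ _ hζ, show -1 + cb.φ (lobeVar (N - p) p τ) + 1 = cb.φ (lobeVar (N - p) p τ) by
        ring, cb.φ_lobeVar hξ, ← hL, ← Complex.exp_add, ← Complex.exp_sub, ← sub_sub]
    have him : ((τ - p * L) / (N - p : ℕ) - b * cb.ℓ (lobeVar (N - p) p τ) - L
        - ca.ℓ (lobeVar p (N - p) τ)).im = τ.im / (N - p : ℕ)
          - b * (cb.ℓ (lobeVar (N - p) p τ)).im - (ca.ℓ (lobeVar p (N - p) τ)).im := by
      rw [Complex.sub_im, Complex.sub_im, Complex.sub_im, Complex.div_natCast_im,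
        Complex.im_ofReal_mul, hLim, Complex.sub_im, Complex.mul_im, hLim]
      simp
    have h3 := abs_le.1 (LobeChart.abs_im_div_le (s := N - p) (by omega) h1 h2)
    have h4 := abs_lt.1 (cb.abs_mul_im_ℓ_lt hb hξ)
    have h5 := abs_lt.1 (ca.abs_im_ℓ_lt hζ)
    -- The three angles add up to at most 2π/3 + 1/2 + 1/2, which is below π exactly because π > 3.
    rw [Complex.log_exp] <;> rw [him] <;> linarith
  rw [LogConsistency, hG, hquot]
  have hp0 : (p : ℂ) ≠ 0 := Nat.cast_ne_zero.2 (by omega)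
  have hn0 : ((N - p : ℕ) : ℂ) ≠ 0 := Nat.cast_ne_zero.2 (by omega)
  have hbp' : (b : ℂ) * (N - p : ℕ) = p := by exact_mod_cast hbp
  have hN : (N : ℂ) = p + (N - p : ℕ) := by
    rw [Nat.cast_sub hpN'.le]; ring
  rw [leadingLog, lobeShift]
  push_cast [-Nat.cast_sub]
  rw [← hLdef, hN]
  generalize ((N - p : ℕ) : ℂ) = n at *
  generalize cb.ℓ _ = lb at *
  generalize ca.ℓ (lobeVar p (N - p) τ) = la at *
  generalize ∑ k ∈ Finset.range p, ca.ℓ _ = S at *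
  rw [← sub_eq_zero, ← sub_eq_zero (a := τ)]
  have key : 1 / (p : ℂ) * ((τ - p * L) / n - b * lb - L - la) +
      (1 / (p : ℂ) * (p * L + S) - L) - γ
      = (τ - (p * n * γ + (p + n) * L + (p * lb + n * (la - S)))) / (p * n) := by
    field_simp
    linear_combination (-lb) * hbp'
  rw [key, div_eq_zero_iff, or_iff_left (mul_ne_zero hp0 hn0)]

/-! ### The product form of the equation for the selection {1, …, p - 1, N} -/

theorem prod_negSelection (hp : 0 < p) (hpN : p < N) (f : ℕ → ℂ) :
    (∏ j ∈ negSelection N p, f j) * f p = f N * ∏ j ∈ Finset.Icc 1 p, f j := by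
  rw [negSelection, Finset.prod_insert (by simp; omega)]
  obtain ⟨q, rfl⟩ : ∃ q, p = q + 1 := ⟨p - 1, by omega⟩
  rw [Finset.prod_Icc_succ_top (by omega), Nat.add_sub_cancel]
  ring

theorem sum_negSelection (hp : 0 < p) (hpN : p < N) (f : ℕ → ℂ) :
    (∑ j ∈ negSelection N p, f j) + f p = f N + ∑ j ∈ Finset.Icc 1 p, f j := by
  rw [negSelection, Finset.sum_insert (by simp; omega)]
  obtain ⟨q, rfl⟩ : ∃ q, p = q + 1 := ⟨p - 1, by omega⟩
  rw [Finset.sum_Icc_succ_top (by omega), Nat.add_sub_cancel]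
  ring

theorem negSelection_mem {j : ℕ} (hp : 0 < p) (hpN : p < N) (hj : j ∈ negSelection N p) :
    1 ≤ j ∧ j ≤ N := by
  simp only [negSelection, Finset.mem_insert, Finset.mem_Icc] at hj
  omega

/-- Each factor (u - 1)/(u + 1) at a root near 1 is -z exp(-(log 2 + (1 + a)ℓ(z))). The product over
z = ζω^k collapses since ∏(-ω^k) = -1, and exchanging the factor of u_p for that of u_N gives the
exponent. -/
theorem consistency_iff_exp (hp : 3 ≤ p) (hpN : p + 3 ≤ N) (ha : 0 < a) (hb : 0 < b)
    (hap : a * p = (N - p : ℕ)) (hbp : b * (N - p : ℕ) = p) {τ : ℂ} {γ : ℝ}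
    (h1 : -(2 * Real.pi) < τ.im) (h2 : τ.im ≤ 0)
    (hζ : ‖lobeVar p (N - p) τ‖ < ca.δ) (hξ : ‖lobeVar (N - p) p τ‖ < cb.δ) :
    Consistency N p γ (negSelection N p) (Complex.exp τ) ↔
      Complex.exp (-((N : ℂ) / (p * (N - p : ℕ)) *
        (τ - (leadingLog N p γ + lobeShift ca cb N p τ)))) = 1 := by
  have hp0' : 0 < p := by omega
  have hpN' : p < N := by omega
  have hζk : ∀ k, ‖lobeVar p (N - p) τ * unityRoot p ^ k‖ < ca.δ := fun k => by
    rwa [norm_mul_unityRoot_pow (by omega)]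
  have hL : Complex.exp (Real.log 2 : ℝ) = 2 := by
    rw [← Complex.ofReal_exp, Real.exp_log two_pos]; norm_num
  have hLn := exp_nat_mul_log_two
  set L : ℂ := ((Real.log 2 : ℝ) : ℂ) with hLdef
  set S := ∑ k ∈ Finset.range p, ca.ℓ (lobeVar p (N - p) τ * unityRoot p ^ k) with hS
  have hne : ∀ j ∈ negSelection N p, root N p j (Complex.exp τ) + 1 ≠ 0 := by
    intro j hj
    obtain ⟨hj1, hj2⟩ := negSelection_mem hp0' hpN' hj
    rw [add_comm]
    exact one_add_ne_zero_of_root hpN' (Complex.exp_ne_zero τ)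
      (root_spec hp0' hpN' (Complex.exp_ne_zero τ) hj1 hj2)
  have hfac : ∀ z, ‖z‖ < ca.δ → (1 - ca.φ z - 1) / (1 - ca.φ z + 1)
      = -(z * Complex.exp (-(L + (1 + a) * ca.ℓ z))) := by
    intro z hz
    rw [show 1 - ca.φ z + 1 = 2 - ca.φ z by ring, show 1 - ca.φ z - 1 = -ca.φ z by ring,
      ca.two_sub_φ z hz, ca.φ_eq z hz, ← hL, ← Complex.exp_add, neg_div, mul_div_assoc,
      ← Complex.exp_sub]
    congr 3; ring
  have hprod : ∏ j ∈ Finset.Icc 1 p,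
      (root N p j (Complex.exp τ) - 1) / (root N p j (Complex.exp τ) + 1)
      = -Complex.exp (τ - N * L - (1 + a) * S) := by
    rw [prod_root_eq ca hp hpN' ha hap h1 h2 hζ (fun u => (u - 1) / (u + 1))]
    rw [Finset.prod_congr rfl fun k _ => hfac _ (hζk k)]
    have e1 : ∀ k ∈ Finset.range p, -(lobeVar p (N - p) τ * unityRoot p ^ k *
        Complex.exp (-(L + (1 + a) * ca.ℓ (lobeVar p (N - p) τ * unityRoot p ^ k))))
        = lobeVar p (N - p) τ * (-unityRoot p ^ k) *
        Complex.exp (-(L + (1 + a) * ca.ℓ (lobeVar p (N - p) τ * unityRoot p ^ k))) := by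
      intro k _; ring
    rw [Finset.prod_congr rfl e1, Finset.prod_mul_distrib, Finset.prod_mul_distrib,
      prod_neg_unityRoot_pow hp0', Finset.prod_const, Finset.card_range, ← Complex.exp_sum,
      Finset.sum_neg_distrib, Finset.sum_add_distrib, ← Finset.mul_sum, ← hS, Finset.sum_const,
      Finset.card_range, nsmul_eq_mul]
    have e2 : lobeVar p (N - p) τ ^ p = Complex.exp (τ - (N - p : ℕ) * L) := by
      rw [Complex.exp_sub, hLn, eq_div_iff (pow_ne_zero _ two_ne_zero), lobeVar_pow (by omega)]
    rw [e2, mul_neg_one, neg_mul, ← Complex.exp_add, Nat.cast_sub hpN'.le]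
    congr 2; ring
  have hfp : (root N p p (Complex.exp τ) - 1) / (root N p p (Complex.exp τ) + 1)
      = -Complex.exp ((τ - (N - p : ℕ) * L) / p
        - (L + (1 + a) * ca.ℓ (lobeVar p (N - p) τ))) := by
    rw [root_p_eq ca hp hpN' ha hap h1 h2 hζ, hfac _ hζ]
    conv_lhs => enter [1, 1]; rw [lobeVar]
    rw [← Complex.exp_add, ← sub_eq_add_neg]
  have hfN : (root N p N (Complex.exp τ) - 1) / (root N p N (Complex.exp τ) + 1)
      = -Complex.exp ((L + (1 + b) * cb.ℓ (lobeVar (N - p) p τ)) - (τ - p * L) / (N - p : ℕ)) := by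
    rw [root_N_eq cb hp0' hpN hb hbp h1 h2 hξ,
      show -1 + cb.φ (lobeVar (N - p) p τ) - 1 = -(2 - cb.φ (lobeVar (N - p) p τ)) by ring,
      show -1 + cb.φ (lobeVar (N - p) p τ) + 1 = cb.φ (lobeVar (N - p) p τ) by ring,
      cb.two_sub_φ _ hξ, cb.φ_lobeVar hξ, ← hL, ← Complex.exp_add, neg_div, ← Complex.exp_sub]
    congr 2; ring
  have hA := prod_negSelection hp0' hpN'
    (fun j => (root N p j (Complex.exp τ) - 1) / (root N p j (Complex.exp τ) + 1))
  rw [hprod, hfp, hfN, neg_mul_neg, mul_neg, ← Complex.exp_add] at hA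
  have hP : ∏ j ∈ negSelection N p,
      (root N p j (Complex.exp τ) - 1) / (root N p j (Complex.exp τ) + 1)
      = -Complex.exp ((L + (1 + b) * cb.ℓ (lobeVar (N - p) p τ)) - (τ - p * L) / (N - p : ℕ)
        + (τ - N * L - (1 + a) * S) - ((τ - (N - p : ℕ) * L) / p
        - (L + (1 + a) * ca.ℓ (lobeVar p (N - p) τ)))) := by
    rw [Complex.exp_sub _ ((τ - (N - p : ℕ) * L) / p
        - (L + (1 + a) * ca.ℓ (lobeVar p (N - p) τ))), ← hA, neg_div, neg_neg,
        mul_div_assoc, div_self (Complex.exp_ne_zero _), mul_one]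
  have hp0 : (p : ℂ) ≠ 0 := Nat.cast_ne_zero.2 (by omega)
  have hn0 : ((N - p : ℕ) : ℂ) ≠ 0 := Nat.cast_ne_zero.2 (by omega)
  have hbp' : (b : ℂ) = p / (N - p : ℕ) := by
    rw [eq_div_iff hn0]; exact_mod_cast hbp
  have hap' : (a : ℂ) = (N - p : ℕ) / p := by
    rw [eq_div_iff hp0]; exact_mod_cast hap
  have hN : (N : ℂ) = p + (N - p : ℕ) := by
    rw [Nat.cast_sub hpN'.le]; ring
  have hT : ((leadingLog N p γ : ℝ) : ℂ) = p * (N - p : ℕ) * γ + N * L := by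
    rw [leadingLog]; push_cast [-Nat.cast_sub]; rfl
  rw [Consistency, and_iff_right hne, hP, ← hLn, ← Complex.exp_add, mul_neg, ← Complex.exp_add,
    neg_add_eq_zero, hT, lobeShift, ← hS]
  have hexp : (N * L + γ * N + ((L + (1 + b) * cb.ℓ (lobeVar (N - p) p τ))
        - (τ - p * L) / (N - p : ℕ)
        + (τ - N * L - (1 + a) * S) - ((τ - (N - p : ℕ) * L) / p
        - (L + (1 + a) * ca.ℓ (lobeVar p (N - p) τ)))))
      = -((N : ℂ) / (p * (N - p : ℕ)) * (τ - (p * (N - p : ℕ) * γ + N * L +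
        (p * cb.ℓ (lobeVar (N - p) p τ) + (N - p : ℕ) *
          (ca.ℓ (lobeVar p (N - p) τ) - S))))) + τ := by
    rw [hbp', hap']
    generalize ((N - p : ℕ) : ℂ) = n at *
    rw [hN]
    field_simp
    ring
  rw [hexp, Complex.exp_add, mul_eq_right₀ (Complex.exp_ne_zero τ)]

theorem consistency_iff (hp : 4 ≤ p) (hpN : p + 4 ≤ N) (ha : 0 < a) (hb : 0 < b)
    (hap : a * p = (N - p : ℕ)) (hbp : b * (N - p : ℕ) = p) {τ : ℂ} {γ : ℝ}
    (h1 : -(2 * Real.pi) < τ.im) (h2 : τ.im ≤ 0)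
    (hζ : ‖lobeVar p (N - p) τ‖ < ca.δ) (hξ : ‖lobeVar (N - p) p τ‖ < cb.δ)
    (hg : ‖lobeShift ca cb N p τ‖ ≤ 1) :
    Consistency N p γ (negSelection N p) (Complex.exp τ) ↔
      τ = leadingLog N p γ + lobeShift ca cb N p τ := by
  rw [consistency_iff_exp ca cb (by omega) (by omega) ha hb hap hbp h1 h2 hζ hξ]
  have hp0 : (p : ℝ) ≠ 0 := Nat.cast_ne_zero.2 (by omega)
  have hn0 : ((N - p : ℕ) : ℝ) ≠ 0 := Nat.cast_ne_zero.2 (by omega)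
  have hN : (N : ℝ) = p + (N - p : ℕ) := by
    rw [Nat.cast_sub (by omega)]; ring
  have hr0 : 0 < (N : ℝ) / (p * (N - p : ℕ)) := by
    have : 0 < N := by omega
    have : 0 < N - p := by omega
    positivity
  have hr : (N : ℝ) / (p * (N - p : ℕ)) ≤ 1 / 2 := by
    have e : (N : ℝ) / (p * (N - p : ℕ)) = 1 / p + 1 / (N - p : ℕ) := by
      rw [hN]; field_simp
      ring
    have h3 : (1 : ℝ) / p ≤ 1 / 4 :=
      one_div_le_one_div_of_le (by norm_num) (by exact_mod_cast hp)
    have h4 : (1 : ℝ) / (N - p : ℕ) ≤ 1 / 4 :=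
      one_div_le_one_div_of_le (by norm_num) (by exact_mod_cast (by omega : 4 ≤ N - p))
    rw [e]; linarith
  have hcast : ((N : ℂ) / (p * (N - p : ℕ))) = (((N : ℝ) / (p * (N - p : ℕ)) : ℝ) : ℂ) := by
    push_cast [-Nat.cast_sub]; rfl
  rw [hcast]
  set r := (N : ℝ) / (p * (N - p : ℕ)) with hrdef
  set D := τ - (leadingLog N p γ + lobeShift ca cb N p τ) with hD
  -- The exponent could be a nonzero multiple of 2πi. But r = 1/p + 1/(N - p) ≤ 1/2 and |Im D| ≤ 2π
  -- + 1, so |r Im D| < 2π excludes this.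
  rw [← sub_eq_zero (a := τ), ← hD]
  constructor
  · intro h
    obtain ⟨m, hm⟩ := Complex.exp_eq_one_iff.1 h
    have him := congrArg Complex.im hm
    rw [Complex.neg_im, Complex.im_ofReal_mul] at him
    simp at him
    have hDim : D.im = τ.im - (lobeShift ca cb N p τ).im := by simp [hD]
    have h3 := abs_le.1 ((Complex.abs_im_le_norm (lobeShift ca cb N p τ)).trans hg)
    have hpi := Real.pi_gt_three
    have hDlo : -(2 * Real.pi + 1) < D.im := by rw [hDim]; linarith [h3.2]
    have hDhi : D.im ≤ 1 := by rw [hDim]; linarith [h3.1]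
    have h4 : |r * D.im| < 2 * Real.pi := by
      rw [abs_mul, abs_of_pos hr0]
      have : |D.im| ≤ 2 * Real.pi + 1 := abs_le.2 ⟨by linarith, by linarith⟩
      calc r * |D.im| ≤ 1 / 2 * (2 * Real.pi + 1) := by gcongr
        _ < 2 * Real.pi := by linarith
    have h5 : |(m : ℝ) * (2 * Real.pi)| < 2 * Real.pi := by rw [← him, abs_neg]; exact h4
    rw [abs_mul, abs_of_pos (by linarith : (0 : ℝ) < 2 * Real.pi)] at h5
    have h6 : |(m : ℝ)| < 1 := by
      by_contra! h7
      have := mul_le_mul_of_nonneg_right h7 (by linarith : (0 : ℝ) ≤ 2 * Real.pi)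
      linarith
    have h7 : m = 0 := by
      have : |m| < 1 := by exact_mod_cast h6
      exact Int.abs_lt_one_iff.1 this
    rw [h7] at hm
    simp only [Int.cast_zero, zero_mul, neg_eq_zero, mul_eq_zero, Complex.ofReal_eq_zero] at hm
    exact hm.resolve_left hr0.ne'
  · intro h; rw [h]; simp

end

/-! ### Existence and uniqueness of the solution -/

theorem lobeVar_conj (s t : ℕ) (τ : ℂ) :
    lobeVar s t ((starRingEnd ℂ) τ) = (starRingEnd ℂ) (lobeVar s t τ) := by
  rw [lobeVar, lobeVar, ← Complex.exp_conj, map_div₀, map_sub, map_mul, Complex.conj_ofReal,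
    Complex.conj_natCast, Complex.conj_natCast]

section

variable {N p : ℕ} {a b : ℝ} (ca : LobeChart a) (cb : LobeChart b)

/-- At real τ both lobe parameters are real, ℓ commutes with conjugation, and the sum over the roots
of unity is conjugation invariant. -/
theorem lobeShift_real_im (hp : 0 < p) {t : ℝ} (hζ : ‖lobeVar p (N - p) (t : ℂ)‖ < ca.δ)
    (hξ : ‖lobeVar (N - p) p (t : ℂ)‖ < cb.δ) : (lobeShift ca cb N p t).im = 0 := by
  have hreal : ∀ s r, (starRingEnd ℂ) (lobeVar s r (t : ℂ)) = lobeVar s r t := fun s r => by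
    rw [← lobeVar_conj, Complex.conj_ofReal]
  rw [← Complex.conj_eq_iff_im]
  rw [lobeShift, map_add, map_mul, map_mul, map_sub, map_sum, Complex.conj_natCast,
    Complex.conj_natCast, ← cb.ℓ_conj _ hξ, ← ca.ℓ_conj _ hζ, hreal, hreal]
  congr 3
  rw [← sum_unityRoot_conj hp (fun w => ca.ℓ (lobeVar p (N - p) (t : ℂ) * w))]
  refine Finset.sum_congr rfl fun k _ => ?_
  rw [← ca.ℓ_conj _ (by rwa [norm_mul_unityRoot_pow hp]), map_mul, hreal]

theorem differentiableAt_lobeShift (hp : 0 < p) {τ : ℂ} (hζ : ‖lobeVar p (N - p) τ‖ < ca.δ)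
    (hξ : ‖lobeVar (N - p) p τ‖ < cb.δ) : DifferentiableAt ℂ (lobeShift ca cb N p) τ := by
  have hd : ∀ s t, DifferentiableAt ℂ (lobeVar s t) τ := by
    intro s t; unfold lobeVar; fun_prop
  have h1 := (cb.differentiableAt _ hξ).comp τ (hd (N - p) p)
  have h2 := (ca.differentiableAt _ hζ).comp τ (hd p (N - p))
  have h3 : ∀ k ∈ Finset.range p, DifferentiableAt ℂ
      (fun τ => ca.ℓ (lobeVar p (N - p) τ * unityRoot p ^ k)) τ := fun k _ =>
    (ca.differentiableAt _ (by rwa [norm_mul_unityRoot_pow hp])).comp τ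
      ((hd p (N - p)).mul_const (unityRoot p ^ k))
  exact (h1.const_mul _).add ((h2.sub (DifferentiableAt.fun_sum h3)).const_mul _)

theorem norm_lobeShift_le (hp : 0 < p) {τ : ℂ} (hζ : ‖lobeVar p (N - p) τ‖ < ca.δ)
    (hξ : ‖lobeVar (N - p) p τ‖ < cb.δ) :
    ‖lobeShift ca cb N p τ‖ ≤ p * (cb.K * ‖lobeVar (N - p) p τ‖)
      + (N - p : ℕ) * ((1 + p) * (ca.K * ‖lobeVar p (N - p) τ‖)) := by
  unfold lobeShift
  have h1 := cb.norm_ℓ_le _ hξ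
  have h2 := ca.norm_ℓ_le _ hζ
  have h3 : ‖∑ k ∈ Finset.range p, ca.ℓ (lobeVar p (N - p) τ * unityRoot p ^ k)‖
      ≤ p * (ca.K * ‖lobeVar p (N - p) τ‖) := by
    refine (norm_sum_le_of_le _ (f := fun k => ca.ℓ (lobeVar p (N - p) τ * unityRoot p ^ k))
      (n := fun _ => ca.K * ‖lobeVar p (N - p) τ‖) fun k _ => ?_).trans ?_
    · have := ca.norm_ℓ_le (lobeVar p (N - p) τ * unityRoot p ^ k)
        (by rwa [norm_mul_unityRoot_pow hp])
      rwa [norm_mul_unityRoot_pow hp] at this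
    · simp
  refine (norm_add_le _ _).trans (add_le_add ?_ ?_)
  · rw [norm_mul, Complex.norm_natCast]; gcongr
  · rw [norm_mul, Complex.norm_natCast]
    refine mul_le_mul_of_nonneg_left ((norm_sub_le _ _).trans ?_) (by positivity)
    linarith

/-- The strip is closed at Im τ = 0 because the labels on the positive axis are limits from the
lower half-plane. -/
theorem exists_strip_log {C : ℂ} (hC : C ≠ 0) :
    ∃ τ : ℂ, Complex.exp τ = C ∧ τ.re = Real.log ‖C‖ ∧ -(2 * Real.pi) < τ.im ∧ τ.im ≤ 0 := by
  have h1 := Complex.neg_pi_lt_arg C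
  have h2 := Complex.arg_le_pi C
  have hpi := Real.pi_pos
  rcases le_or_gt (Complex.arg C) 0 with h | h
  · refine ⟨Complex.log C, Complex.exp_log hC, Complex.log_re C, ?_, ?_⟩ <;>
      rw [Complex.log_im] <;> linarith
  · refine ⟨Complex.log C - 2 * Real.pi * Complex.I, ?_, ?_, ?_, ?_⟩
    · rw [Complex.exp_sub, Complex.exp_log hC, Complex.exp_two_pi_mul_I, div_one]
    · simp [Complex.log_re]
    · simp [Complex.log_im]; linarith
    · simp [Complex.log_im]; linarith

/-- The modulus of the product of the selected factors `1 + u_j` is fixed by the consistency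
condition. -/
theorem norm_prod_of_consistency (hp : 0 < p) (hpN : p < N) {γ : ℝ} {C : ℂ} (hC : C ≠ 0)
    (h : Consistency N p γ (negSelection N p) C) :
    (∏ j ∈ Finset.Icc 1 p, ‖1 + root N p j C‖) * ‖1 + root N p N C‖
      = 2 ^ p * Real.exp (γ * p) * ‖1 + root N p p C‖ := by
  set W := ∏ j ∈ negSelection N p, ‖1 + root N p j C‖ with hW
  set V := ∏ j ∈ negSelection N p, ‖1 - root N p j C‖ with hV
  have hWpos : 0 < W := Finset.prod_pos fun j hj => norm_pos_iff.2
    (one_add_ne_zero_of_root hpN hC (root_spec hp hpN hC (negSelection_mem hp hpN hj).1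
      (negSelection_mem hp hpN hj).2))
  have hcard : (negSelection N p).card = p := by
    rw [negSelection, Finset.card_insert_of_notMem (by simp; omega), Nat.card_Icc]; omega
  have hCpos : 0 < ‖C‖ := norm_pos_iff.2 hC
  set E := (2 : ℝ) ^ N * Real.exp (γ * N) with hE
  have hEpos : 0 < E := by positivity
  -- Multiplying the root equations over the selection gives this relation, and the consistency
  -- condition gives E V = |C| W. Eliminating V leaves W^N = E^p, free of C.
  have h1 : V ^ p * W ^ (N - p) = ‖C‖ ^ p := by
    rw [hV, hW, ← Finset.prod_pow, ← Finset.prod_pow, ← Finset.prod_mul_distrib,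
      Finset.prod_congr rfl fun j hj => norm_of_root (root_spec hp hpN hC
        (negSelection_mem hp hpN hj).1 (negSelection_mem hp hpN hj).2), Finset.prod_const, hcard]
  have h2 : E * V = ‖C‖ * W := by
    have h3 := eq_neg_of_add_eq_zero_left h.2
    have h4 := congrArg norm h3
    rw [norm_neg, norm_mul, norm_mul, norm_prod, norm_pow, Complex.norm_exp] at h4
    have h5 : ∏ j ∈ negSelection N p, ‖(root N p j C - 1) / (root N p j C + 1)‖ = V / W := by
      rw [hV, hW, ← Finset.prod_div_distrib]
      refine Finset.prod_congr rfl fun j _ => ?_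
      rw [norm_div, norm_sub_rev, add_comm]
    rw [h5] at h4
    simp only [Complex.norm_ofNat, Complex.mul_re, Complex.ofReal_re, Complex.natCast_re,
      Complex.ofReal_im, zero_mul, sub_zero] at h4
    rw [← h4, hE]; field_simp
  have h3 : W ^ N = (2 ^ p * Real.exp (γ * p)) ^ N := by
    have h4 : E ^ p = W ^ N := by
      have h5 : ‖C‖ ^ p * E ^ p = ‖C‖ ^ p * W ^ N := by
        calc ‖C‖ ^ p * E ^ p = (E * V) ^ p * W ^ (N - p) := by rw [← h1]; ring
          _ = ‖C‖ ^ p * (W ^ p * W ^ (N - p)) := by rw [h2]; ring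
          _ = ‖C‖ ^ p * W ^ N := by rw [← pow_add, Nat.add_sub_cancel' hpN.le]
      exact mul_left_cancel₀ (pow_pos hCpos p).ne' h5
    rw [← h4, hE, mul_pow, mul_pow, ← pow_mul, ← pow_mul, ← Real.exp_nat_mul, ← Real.exp_nat_mul,
      mul_comm N p]
    congr 2; ring
  have h4 : W = 2 ^ p * Real.exp (γ * p) :=
    (pow_left_inj₀ hWpos.le (by positivity) (by omega)).1 h3
  have h5 := congrArg norm (prod_negSelection hp hpN (fun j => 1 + root N p j C))
  rw [norm_mul, norm_mul, norm_prod, norm_prod] at h5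
  rw [mul_comm, ← h5, ← h4]

/-- Exponentiating p times the equation and taking moduli discards all branch information and yields
the same identity as the product form. -/
theorem norm_prod_of_logConsistency (hp : 0 < p) (hpN : p < N) {γ : ℝ} {C : ℂ} (hC : C ≠ 0)
    (h : LogConsistency N p γ C) :
    (∏ j ∈ Finset.Icc 1 p, ‖1 + root N p j C‖) * ‖1 + root N p N C‖
      = 2 ^ p * Real.exp (γ * p) * ‖1 + root N p p C‖ := by
  have hne : ∀ j, 1 ≤ j → j ≤ N → 1 + root N p j C ≠ 0 := fun j hj hjN =>
    one_add_ne_zero_of_root hpN hC (root_spec hp hpN hC hj hjN)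
  have hp0 : (p : ℂ) ≠ 0 := Nat.cast_ne_zero.2 hp.ne'
  rw [LogConsistency, G] at h
  have h1 : Complex.log ((root N p N C + 1) / (root N p p C + 1))
      + ∑ j ∈ Finset.Icc 1 p, Complex.log (1 + root N p j C)
      = p * Complex.log 2 + p * γ := by
    field_simp at h
    linear_combination h
  have h2 := congrArg Complex.exp h1
  have hN := hne N (by omega) le_rfl
  have hpp := hne p hp hpN.le
  rw [add_comm 1] at hN hpp
  rw [Complex.exp_add, Complex.exp_add, Complex.exp_log (div_ne_zero hN hpp), Complex.exp_sum,
    Finset.prod_congr rfl fun j hj => Complex.exp_log (hne j (Finset.mem_Icc.1 hj).1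
      ((Finset.mem_Icc.1 hj).2.trans hpN.le)), Complex.exp_nat_mul,
    Complex.exp_log two_ne_zero] at h2
  have h3 := congrArg norm h2
  rw [norm_mul, norm_div, norm_prod, norm_mul, norm_pow, Complex.norm_exp, div_mul_eq_mul_div,
    div_eq_iff (norm_pos_iff.2 hpp).ne', add_comm (root N p N C), add_comm (root N p p C)] at h3
  rw [mul_comm, h3]
  simp [mul_comm (γ : ℝ)]

theorem not_consistency_zero (hpN : p < N) {γ : ℝ} :
    ¬ Consistency N p γ (negSelection N p) 0 := by
  intro h
  refine h.1 N (by simp [negSelection]) ?_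
  rw [root, if_pos rfl, if_neg (by omega)]; simp

/-- At C = 0 the quotient vanishes and `Complex.log 0` is 0 by convention, so the equation would
read 0 = γ. -/
theorem not_logConsistency_zero (hp : 0 < p) (hpN : p < N) {γ : ℝ} (hγ : γ ≠ 0) :
    ¬ LogConsistency N p γ 0 := by
  intro h
  have hp0 : (p : ℂ) ≠ 0 := Nat.cast_ne_zero.2 hp.ne'
  have hN : root N p N 0 = -1 := by rw [root, if_pos rfl, if_neg (by omega)]
  have hj : ∀ j ∈ Finset.Icc 1 p, Complex.log (1 + root N p j 0) = Complex.log 2 := by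
    intro j hj
    rw [root, if_pos rfl, if_pos (Finset.mem_Icc.1 hj).2]; norm_num
  rw [LogConsistency, G, hN, Finset.sum_congr rfl hj] at h
  simp [hp0] at h
  exact hγ (by exact_mod_cast h.symm)

/-- Both consistency equations have the same unique solution, and its logarithm is close to
`leadingLog`. -/
theorem exists_unique_solution (hp : 4 ≤ p) (hpN : p + 4 ≤ N) (ha : 0 < a) (hb : 0 < b)
    (hap : a * p = (N - p : ℕ)) (hbp : b * (N - p : ℕ) = p) {γ : ℝ} (hγ : γ ≠ 0) {s : ℝ}
    (hsmall : ∀ τ : ℂ, τ.re ≤ s + 2 → ‖lobeVar p (N - p) τ‖ < ca.δ ∧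
      ‖lobeVar (N - p) p τ‖ < cb.δ ∧ ‖lobeShift ca cb N p τ‖ ≤ 1 / 4)
    (hT : leadingLog N p γ + 1 ≤ s)
    (happ : ∀ C : ℂ, C ≠ 0 → (∏ j ∈ Finset.Icc 1 p, ‖1 + root N p j C‖) * ‖1 + root N p N C‖
      = 2 ^ p * Real.exp (γ * p) * ‖1 + root N p p C‖ → Real.log ‖C‖ ≤ s) :
    ∃ t : ℝ, t ≤ s ∧ (t : ℂ) = leadingLog N p γ + lobeShift ca cb N p t ∧
      (∀ C : ℂ, LogConsistency N p γ C ↔ C = (Real.exp t : ℝ)) ∧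
      (∀ C : ℂ, Consistency N p γ (negSelection N p) C ↔ C = (Real.exp t : ℝ)) := by
  set T := leadingLog N p γ with hTdef
  set g := lobeShift ca cb N p with hg
  have hp0 : 0 < p := by omega
  have hdiff : ∀ τ : ℂ, τ.re ≤ s + 2 → DifferentiableAt ℂ g τ := fun τ hτ =>
    differentiableAt_lobeShift ca cb hp0 (hsmall τ hτ).1 (hsmall τ hτ).2.1
  -- existence of a real solution
  have hex : ∃ t : ℝ, t ≤ s ∧ (t : ℂ) = T + g t := by
    have hcont : ContinuousOn (fun t : ℝ => t - T - (g t).re) (Set.Icc (T - 1) (T + 1)) := by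
      intro t ht
      have h1 : ContinuousAt g (t : ℂ) :=
        (hdiff t (by rw [Complex.ofReal_re]; linarith [ht.2])).continuousAt
      have h2 : ContinuousAt (fun t : ℝ => (g t).re) t :=
        Complex.continuous_re.continuousAt.comp
          (h1.comp (f := fun t : ℝ => (t : ℂ)) Complex.continuous_ofReal.continuousAt)
      exact ((continuousAt_id.sub continuousAt_const).sub h2).continuousWithinAt
    have hb : ∀ t : ℝ, t ≤ s → |(g t).re| ≤ 1 / 4 := fun t ht =>
      (Complex.abs_re_le_norm _).trans (hsmall t (by rw [Complex.ofReal_re]; linarith)).2.2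
    have hlo := abs_le.1 (hb (T - 1) (by linarith))
    have hhi := abs_le.1 (hb (T + 1) hT)
    obtain ⟨t, ht, ht0⟩ := intermediate_value_Icc (by linarith : T - 1 ≤ T + 1) hcont
      (show (0 : ℝ) ∈ _ from ⟨by linarith [hlo.1], by linarith [hhi.2]⟩)
    -- The intermediate value theorem solved only the real part of the equation; the imaginary part
    -- holds since the shift is real.
    refine ⟨t, by linarith [ht.2], ?_⟩
    have hts := hsmall t (by rw [Complex.ofReal_re]; linarith [ht.2])
    have him := lobeShift_real_im ca cb hp0 hts.1 hts.2.1
    refine Complex.ext ?_ ?_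
    · simp only [Complex.add_re, Complex.ofReal_re]; simp only at ht0; linarith
    · simp only [Complex.add_im, Complex.ofReal_im, zero_add]; exact him.symm
  -- uniqueness
  have huniq : ∀ τ τ' : ℂ, τ.re ≤ s → τ'.re ≤ s → τ = T + g τ → τ' = T + g τ' → τ = τ' := by
    intro τ τ' h1 h2 h3 h4
    -- Cauchy's estimate on unit discs turns the bound 1/4 for g into one for its derivative; hence
    -- the margin in `hsmall` beyond `s`.
    have hderiv : ∀ x ∈ {x : ℂ | x.re ≤ s}, ‖deriv g x‖ ≤ 1 / 4 := by
      intro x hx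
      have hre : ∀ z ∈ Metric.closedBall x 1, z.re ≤ s + 2 := by
        intro z hz
        have h5 := (abs_le.1 (Complex.abs_re_le_norm (z - x))).2
        rw [← dist_eq_norm, Complex.sub_re] at h5
        have h6 : dist z x ≤ 1 := hz
        have h7 : x.re ≤ s := hx
        linarith
      have := Complex.norm_deriv_le_of_forall_mem_sphere_norm_le (f := g) (c := x) (R := 1)
        (C := 1 / 4) one_pos (DifferentiableOn.diffContOnCl_ball (U := Metric.closedBall x 1)
          (fun z hz => (hdiff z (hre z hz)).differentiableWithinAt) subset_rfl)
        (fun z hz => (hsmall z (hre z (Metric.sphere_subset_closedBall hz))).2.2)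
      simpa using this
    have hlip := Convex.norm_image_sub_le_of_norm_deriv_le (f := g) (C := 1 / 4)
      (s := {x : ℂ | x.re ≤ s}) (fun x hx => hdiff x (by
        have : x.re ≤ s := hx
        linarith)) hderiv (convex_halfSpace_re_le s) h1 h2
    have h5 : τ' - τ = g τ' - g τ := by linear_combination h4 - h3
    rw [← h5] at hlip
    have h6 : ‖τ' - τ‖ = 0 := by
      have := norm_nonneg (τ' - τ); linarith
    exact (sub_eq_zero.1 (norm_eq_zero.1 h6)).symm
  obtain ⟨t, hts, ht⟩ := hex
  have hlogiff : ∀ τ : ℂ, τ.re ≤ s → -(2 * Real.pi) < τ.im → τ.im ≤ 0 →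
      (LogConsistency N p γ (Complex.exp τ) ↔ τ = T + g τ) := by
    intro τ h0 h1 h2
    obtain ⟨h3, h4, h5⟩ := hsmall τ (by linarith)
    exact logConsistency_iff ca cb (by omega) (by omega) ha hb hap hbp h1 h2 h3 h4
  have hconiff : ∀ τ : ℂ, τ.re ≤ s → -(2 * Real.pi) < τ.im → τ.im ≤ 0 →
      (Consistency N p γ (negSelection N p) (Complex.exp τ) ↔ τ = T + g τ) := by
    intro τ h0 h1 h2
    obtain ⟨h3, h4, h5⟩ := hsmall τ (by linarith)
    exact consistency_iff ca cb hp hpN ha hb hap hbp h1 h2 h3 h4 (h5.trans (by norm_num))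
  have hpi := Real.pi_pos
  refine ⟨t, hts, ht, fun C => ⟨fun h => ?_, ?_⟩, fun C => ⟨fun h => ?_, ?_⟩⟩
  · have hC : C ≠ 0 := by
      rintro rfl; exact not_logConsistency_zero hp0 (by omega) hγ h
    obtain ⟨τ, rfl, hre, h1, h2⟩ := exists_strip_log hC
    have hτs : τ.re ≤ s := by
      rw [hre]; exact happ _ hC (norm_prod_of_logConsistency hp0 (by omega) hC h)
    have := huniq τ t hτs (by simpa using hts) ((hlogiff τ hτs h1 h2).1 h) ht
    rw [this, Complex.ofReal_exp]
  · rintro rfl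
    rw [Complex.ofReal_exp]
    exact (hlogiff t (by simpa using hts) (by simp [hpi]) (by simp)).2 ht
  · have hC : C ≠ 0 := by
      rintro rfl; exact not_consistency_zero (by omega) h
    obtain ⟨τ, rfl, hre, h1, h2⟩ := exists_strip_log hC
    have hτs : τ.re ≤ s := by
      rw [hre]; exact happ _ hC (norm_prod_of_consistency hp0 (by omega) hC h)
    have := huniq τ t hτs (by simpa using hts) ((hconiff τ hτs h1 h2).1 h) ht
    rw [this, Complex.ofReal_exp]
  · rintro rfl
    rw [Complex.ofReal_exp]
    exact (hconiff t (by simpa using hts) (by simp [hpi]) (by simp)).2 ht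

end

/-! ### Asymptotics -/

theorem norm_lobeVar_le {s N : ℕ} (t : ℕ) (hs : 1 ≤ s) (hsN : s ≤ N) {c : ℝ} (hc : 0 ≤ c) {τ : ℂ}
    (hτ : τ.re ≤ -c * (N : ℝ) ^ 2 + 2) : ‖lobeVar s t τ‖ ≤ Real.exp (2 - c * N) := by
  have hs1 : (1 : ℝ) ≤ s := by exact_mod_cast hs
  have hs2 : (s : ℝ) ≤ N := by exact_mod_cast hsN
  rw [norm_lobeVar, Real.exp_le_exp, div_le_iff₀ (by linarith)]
  have hL : 0 ≤ t * Real.log 2 := mul_nonneg (Nat.cast_nonneg t) (Real.log_nonneg one_le_two)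
  have h1 : c * N * s ≤ c * N * N := by gcongr
  nlinarith

section

variable {N p : ℕ} {a b : ℝ} (ca : LobeChart a) (cb : LobeChart b)

theorem norm_lobeShift_le_of_le (hp : 0 < p) (hpN : p < N) {ε : ℝ} (hε : 0 ≤ ε) {τ : ℂ}
    (hζ : ‖lobeVar p (N - p) τ‖ < ca.δ) (hξ : ‖lobeVar (N - p) p τ‖ < cb.δ)
    (hζε : ‖lobeVar p (N - p) τ‖ ≤ ε) (hξε : ‖lobeVar (N - p) p τ‖ ≤ ε) :
    ‖lobeShift ca cb N p τ‖ ≤ (ca.K + cb.K) * (N : ℝ) ^ 2 * ε := by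
  have hKa := ca.K_nonneg
  have hKb := cb.K_nonneg
  have h1 : (p : ℝ) ≤ (N : ℝ) ^ 2 := by
    exact_mod_cast hpN.le.trans (Nat.le_self_pow two_ne_zero N)
  have h2 : ((N - p : ℕ) : ℝ) * (1 + p) ≤ (N : ℝ) ^ 2 := by
    have : (N - p) * (1 + p) ≤ N ^ 2 := by
      rw [sq]; exact Nat.mul_le_mul (Nat.sub_le _ _) (by omega)
    exact_mod_cast this
  calc ‖lobeShift ca cb N p τ‖ ≤ p * (cb.K * ‖lobeVar (N - p) p τ‖)
        + (N - p : ℕ) * ((1 + p) * (ca.K * ‖lobeVar p (N - p) τ‖)) :=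
        norm_lobeShift_le ca cb hp hζ hξ
    _ ≤ p * (cb.K * ε) + (N - p : ℕ) * ((1 + p) * (ca.K * ε)) := by gcongr
    _ = p * (cb.K * ε) + ((N - p : ℕ) * (1 + p)) * (ca.K * ε) := by ring
    _ ≤ (N : ℝ) ^ 2 * (cb.K * ε) + (N : ℝ) ^ 2 * (ca.K * ε) := by gcongr
    _ = _ := by ring

/-- The local parameter of a lobe at a solution of the consistency equation. -/
theorem norm_lobeVar_sub_le {s t : ℕ} (hs : 1 ≤ s) {γ : ℝ} {τ g : ℂ}
    (hτ : τ = ((s * t * γ + ((s + t : ℕ) : ℝ) * Real.log 2 : ℝ) : ℂ) + g) (hg : ‖g‖ ≤ 1) :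
    ‖lobeVar s t τ - 2 * Real.exp (t * γ)‖ ≤ 4 * ‖g‖ * Real.exp (t * γ) := by
  have hs0 : (s : ℂ) ≠ 0 := Nat.cast_ne_zero.2 (by omega)
  have h1 : lobeVar s t τ = 2 * Real.exp (t * γ) * Complex.exp (g / s) := by
    have hL : Complex.exp (Real.log 2 : ℝ) = 2 := by
      rw [← Complex.ofReal_exp, Real.exp_log two_pos]; norm_num
    rw [lobeVar, Complex.ofReal_exp, ← hL, ← Complex.exp_add, ← Complex.exp_add, hτ]
    congr 1
    generalize Real.log 2 = L
    push_cast
    field_simp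
    ring
  have h2 : ‖g / s‖ ≤ ‖g‖ := by
    rw [norm_div, Complex.norm_natCast]
    exact div_le_self (norm_nonneg _) (by exact_mod_cast hs)
  have h3 := Complex.norm_exp_sub_one_le (h2.trans hg)
  have h4 : lobeVar s t τ - 2 * Real.exp (t * γ)
      = ((2 * Real.exp (t * γ) : ℝ) : ℂ) * (Complex.exp (g / s) - 1) := by
    rw [h1]; push_cast; ring
  rw [h4, norm_mul, Complex.norm_real, Real.norm_of_nonneg (by positivity)]
  calc 2 * Real.exp (t * γ) * ‖Complex.exp (g / s) - 1‖
      ≤ 2 * Real.exp (t * γ) * (2 * ‖g‖) := by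
        gcongr; exact h3.trans (by linarith)
    _ = _ := by ring

/-- Since ∑ω^k = 0, the linear terms of the first p roots cancel. The omitted root u_p leaves ζ ≈
2e^{(N - p)γ} and u_N leaves ξ ≈ 2e^{pγ}; the rest is the quadratic remainder of φ and the effect of
the shift. -/
theorem betheEigenvalue_bound (hp : 3 ≤ p) (hpN : p + 3 ≤ N) (ha : 0 < a) (hb : 0 < b)
    (hap : a * p = (N - p : ℕ)) (hbp : b * (N - p : ℕ) = p) {γ ε : ℝ} {t : ℝ} (hε : 0 ≤ ε)
    (ht : (t : ℂ) = leadingLog N p γ + lobeShift ca cb N p t)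
    (hζ : ‖lobeVar p (N - p) (t : ℂ)‖ < ca.δ) (hξ : ‖lobeVar (N - p) p (t : ℂ)‖ < cb.δ)
    (hζε : ‖lobeVar p (N - p) (t : ℂ)‖ ≤ ε) (hξε : ‖lobeVar (N - p) p (t : ℂ)‖ ≤ ε)
    (hg : ‖lobeShift ca cb N p t‖ ≤ 1 / 4) :
    ‖betheEigenvalue N p (negSelection N p) (Real.exp t : ℝ) -
      (-1 + Real.exp (p * γ) + Real.exp ((N - p : ℕ) * γ))‖ ≤
      4 * (ca.K + cb.K) * (N : ℝ) ^ 2 * ε *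
        (Real.exp (p * γ) + Real.exp ((N - p : ℕ) * γ)) := by
  have hp0 : 0 < p := by omega
  have hpN' : p < N := by omega
  have hpi := Real.pi_pos
  have hKa := ca.K_nonneg
  have hKb := cb.K_nonneg
  have h1 : -(2 * Real.pi) < (t : ℂ).im := by simp [hpi]
  have h2 : (t : ℂ).im ≤ 0 := by simp
  have hgε := norm_lobeShift_le_of_le ca cb hp0 hpN' hε hζ hξ hζε hξε
  set g := lobeShift ca cb N p t with hgdef
  set ζ := lobeVar p (N - p) (t : ℂ) with hζdef
  set ξ := lobeVar (N - p) p (t : ℂ) with hξdef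
  set X := Real.exp ((N - p : ℕ) * γ) with hX
  set Y := Real.exp (p * γ) with hY
  have hX0 : 0 < X := Real.exp_pos _
  have hY0 : 0 < Y := Real.exp_pos _
  have hζX : ‖ζ - 2 * X‖ ≤ 4 * ‖g‖ * X :=
    norm_lobeVar_sub_le (g := g) (by omega) (by
      rw [Nat.add_sub_cancel' hpN'.le]; exact ht) (by linarith)
  have hξY : ‖ξ - 2 * Y‖ ≤ 4 * ‖g‖ * Y :=
    norm_lobeVar_sub_le (g := g) (by omega) (by
      rw [Nat.sub_add_cancel hpN'.le, mul_comm ((N - p : ℕ) : ℝ)]; exact ht) (by linarith)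
  have hζ3 : ‖ζ‖ ≤ 3 * X := by
    have : ‖ζ‖ ≤ ‖ζ - 2 * X‖ + ‖(2 * X : ℂ)‖ := norm_le_norm_sub_add _ _
    have h3 : ‖(2 * X : ℂ)‖ = 2 * X := by
      rw [norm_mul, Complex.norm_real, Real.norm_of_nonneg hX0.le]; simp
    nlinarith
  have hξ3 : ‖ξ‖ ≤ 3 * Y := by
    have : ‖ξ‖ ≤ ‖ξ - 2 * Y‖ + ‖(2 * Y : ℂ)‖ := norm_le_norm_sub_add _ _
    have h3 : ‖(2 * Y : ℂ)‖ = 2 * Y := by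
      rw [norm_mul, Complex.norm_real, Real.norm_of_nonneg hY0.le]; simp
    nlinarith
  have hsum : ∑ k ∈ Finset.range p, ζ * unityRoot p ^ k = 0 := by
    rw [← Finset.mul_sum, (unityRoot_isPrimitive hp0).geom_sum_eq_zero (by omega), mul_zero]
  have hsel := sum_negSelection hp0 hpN' (fun j => root N p j (Complex.exp t) - 1)
  have hroots := sum_root_eq ca hp hpN' ha hap h1 h2 hζ (fun u => u - 1)
  have hlam : betheEigenvalue N p (negSelection N p) (Real.exp t : ℝ) - (-1 + Y + X)
      = 1 / 2 * ((cb.φ ξ - ξ) + (ξ - 2 * Y) + (ca.φ ζ - ζ) + (ζ - 2 * X)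
        - ∑ k ∈ Finset.range p, (ca.φ (ζ * unityRoot p ^ k) - ζ * unityRoot p ^ k)) := by
    have hS : ∑ k ∈ Finset.range p, (ca.φ (ζ * unityRoot p ^ k) - ζ * unityRoot p ^ k)
        = ∑ k ∈ Finset.range p, ca.φ (ζ * unityRoot p ^ k) := by
      rw [Finset.sum_sub_distrib, hsum, sub_zero]
    rw [betheEigenvalue, Complex.ofReal_exp, eq_sub_of_add_eq hsel, hroots,
      root_p_eq ca hp hpN' ha hap h1 h2 hζ, root_N_eq cb hp0 hpN hb hbp h1 h2 hξ, hS,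
      ← hζdef, ← hξdef]
    have : ∑ k ∈ Finset.range p, (1 - ca.φ (ζ * unityRoot p ^ k) - 1)
        = -∑ k ∈ Finset.range p, ca.φ (ζ * unityRoot p ^ k) := by
      rw [← Finset.sum_neg_distrib]; exact Finset.sum_congr rfl fun k _ => by ring
    rw [this]
    ring
  have hb1 : ‖cb.φ ξ - ξ‖ ≤ cb.K * (3 * Y * ε) := by
    refine (cb.norm_φ_sub_le ξ hξ).trans (mul_le_mul_of_nonneg_left ?_ hKb)
    rw [sq]; exact mul_le_mul hξ3 hξε (norm_nonneg _) (by positivity)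
  have hsq : ‖ζ‖ ^ 2 ≤ 3 * X * ε := by
    rw [sq]; exact mul_le_mul hζ3 hζε (norm_nonneg _) (by positivity)
  have hb2 : ‖ca.φ ζ - ζ‖ ≤ ca.K * (3 * X * ε) :=
    (ca.norm_φ_sub_le ζ hζ).trans (mul_le_mul_of_nonneg_left hsq hKa)
  have hb3 : ‖∑ k ∈ Finset.range p, (ca.φ (ζ * unityRoot p ^ k) - ζ * unityRoot p ^ k)‖
      ≤ p * (ca.K * (3 * X * ε)) := by
    refine (norm_sum_le_of_le _ (n := fun _ => ca.K * (3 * X * ε)) fun k _ => ?_).trans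
      (by simp)
    refine (ca.norm_φ_sub_le _ (by rwa [norm_mul_unityRoot_pow hp0])).trans
      (mul_le_mul_of_nonneg_left ?_ hKa)
    rwa [norm_mul_unityRoot_pow hp0]
  have htri : ‖(cb.φ ξ - ξ) + (ξ - 2 * Y) + (ca.φ ζ - ζ) + (ζ - 2 * X)
        - ∑ k ∈ Finset.range p, (ca.φ (ζ * unityRoot p ^ k) - ζ * unityRoot p ^ k)‖
      ≤ ‖cb.φ ξ - ξ‖ + ‖ξ - 2 * Y‖ + ‖ca.φ ζ - ζ‖ + ‖ζ - 2 * X‖ +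
        ‖∑ k ∈ Finset.range p, (ca.φ (ζ * unityRoot p ^ k) - ζ * unityRoot p ^ k)‖ :=
    (norm_sub_le _ _).trans (add_le_add_left norm_add₄_le _)
  have hN1 : 1 + (p : ℝ) ≤ (N : ℝ) ^ 2 := by
    have : 1 + p ≤ N ^ 2 := (by omega : 1 + p ≤ N).trans (Nat.le_self_pow two_ne_zero N)
    exact_mod_cast this
  have hN2 : (1 : ℝ) ≤ (N : ℝ) ^ 2 := by
    have : (0 : ℝ) ≤ p := Nat.cast_nonneg p
    linarith
  rw [hlam, norm_mul]
  have hhalf : ‖(1 / 2 : ℂ)‖ = 1 / 2 := by norm_num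
  rw [hhalf]
  set Q := (N : ℝ) ^ 2 with hQ
  have hgX : 4 * ‖g‖ * X ≤ 4 * ((ca.K + cb.K) * Q * ε) * X := by gcongr
  have hgY : 4 * ‖g‖ * Y ≤ 4 * ((ca.K + cb.K) * Q * ε) * Y := by gcongr
  have e1 : cb.K * (3 * Y * ε) ≤ Q * (cb.K * (3 * Y * ε)) :=
    le_mul_of_one_le_left (by positivity) hN2
  have e2 : (1 + (p : ℝ)) * (ca.K * (3 * X * ε)) ≤ Q * (ca.K * (3 * X * ε)) := by gcongr
  have e3 : 0 ≤ cb.K * Q * ε * X := by positivity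
  have e4 : 0 ≤ ca.K * Q * ε * Y := by positivity
  have e5 : 0 ≤ cb.K * Q * ε * Y := by positivity
  have e6 : 0 ≤ ca.K * Q * ε * X := by positivity
  linarith

end

/-! ### The thermodynamic limit -/

theorem tendsto_fst_thermodynamicLimit (ρ : ℚ) :
    Tendsto Prod.fst (thermodynamicLimit ρ) (atTop : Filter ℕ) :=
  tendsto_comap.mono_left inf_le_left

theorem eventually_density (ρ : ℚ) :
    ∀ᶠ q in thermodynamicLimit ρ, (q.2 : ℝ) = (ρ : ℝ) * q.1 := by
  have h : ∀ᶠ q in thermodynamicLimit ρ, (q.2 : ℚ) = ρ * q.1 :=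
    (inf_le_right : thermodynamicLimit ρ ≤ _) (mem_principal_self _)
  filter_upwards [h] with q hq
  exact_mod_cast hq

theorem tendsto_error (M : ℝ) {c : ℝ} (hc : 0 < c) :
    Tendsto (fun N : ℕ => M * (N : ℝ) ^ 2 * Real.exp (2 - c * N)) atTop (𝓝 0) := by
  have h1 := Real.tendsto_pow_mul_exp_neg_atTop_nhds_zero 2
  have h2 : Tendsto (fun N : ℕ => c * (N : ℝ)) atTop atTop :=
    tendsto_natCast_atTop_atTop.const_mul_atTop hc
  have h3 := (h1.comp h2).const_mul (M * Real.exp 2 / c ^ 2)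
  rw [mul_zero] at h3
  refine h3.congr fun N => ?_
  simp only [Function.comp_apply]
  rw [sub_eq_add_neg, Real.exp_add]
  field_simp

/-- Asymptotic description of the solution of the consistency equations. -/
theorem eventually_solution {γ : ℝ} (hγ : γ < 0) {ρ : ℚ} (hρ₀ : 0 < ρ) (hρ₁ : ρ < 1) :
    ∃ M c : ℝ, 0 < c ∧ ∀ᶠ q : ℕ × ℕ in thermodynamicLimit ρ, ∃ t : ℝ,
      (∀ C : ℂ, LogConsistency q.1 q.2 γ C ↔ C = (Real.exp t : ℝ)) ∧
      (∀ C : ℂ, Consistency q.1 q.2 γ (negSelection q.1 q.2) C ↔ C = (Real.exp t : ℝ)) ∧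
      t ≤ -c * q.1 ∧
      |t - ((q.1 : ℝ) ^ 2 * γ * ρ * (1 - ρ) + q.1 * Real.log 2)|
        ≤ M * (q.1 : ℝ) ^ 2 * Real.exp (2 - c * q.1) ∧
      ‖betheEigenvalue q.1 q.2 (negSelection q.1 q.2) (Real.exp t : ℝ) -
        (-1 + Real.exp (q.1 * γ * ρ) + Real.exp (q.1 * γ * (1 - ρ)))‖ ≤
        M * (q.1 : ℝ) ^ 2 * Real.exp (2 - c * q.1) *
          (Real.exp (q.1 * γ * ρ) + Real.exp (q.1 * γ * (1 - ρ))) := by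
  set r : ℝ := (ρ : ℝ) with hr
  have hr0 : 0 < r := by rw [hr]; exact_mod_cast hρ₀
  have hr1 : 0 < 1 - r := by
    have : r < 1 := by rw [hr]; exact_mod_cast hρ₁
    linarith
  obtain ⟨ca⟩ := exists_lobeChart (div_pos hr1 hr0)
  obtain ⟨cb⟩ := exists_lobeChart (div_pos hr0 hr1)
  have hKa := ca.K_nonneg
  have hKb := cb.K_nonneg
  set s₀ := -(r * (1 - r) * γ) with hs₀
  have hs₀pos : 0 < s₀ := by
    have := mul_pos_of_neg_of_neg (neg_neg_of_pos (mul_pos hr0 hr1)) hγ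
    rw [hs₀]; linarith
  -- The leading exponent is -8cN². The a priori bound works with κ = e^{-2cN}, as κ^(4N) =
  -- e^{-8cN²}, and gives |C| ≤ 8^N e^{-2cN²}; absorbing 8^N leaves e^{-cN²}.
  set c := s₀ / 8 with hc
  have hcpos : 0 < c := by positivity
  refine ⟨4 * (ca.K + cb.K), c, hcpos, ?_⟩
  have hlarge : ∀ x : ℝ, ∀ᶠ q in thermodynamicLimit ρ, x ≤ (q.1 : ℝ) := fun x =>
    (tendsto_natCast_atTop_atTop.comp (tendsto_fst_thermodynamicLimit ρ)).eventually_ge_atTop x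
  have herr : ∀ᶠ q : ℕ × ℕ in thermodynamicLimit ρ,
      (ca.K + cb.K) * (q.1 : ℝ) ^ 2 * Real.exp (2 - c * q.1) < 1 / 4 :=
    ((tendsto_error (ca.K + cb.K) hcpos).comp
      (tendsto_fst_thermodynamicLimit ρ)).eventually_lt_const (by norm_num)
  have hexp : ∀ᶠ q : ℕ × ℕ in thermodynamicLimit ρ,
      1 * (q.1 : ℝ) ^ 2 * Real.exp (2 - c * q.1) < min ca.δ cb.δ :=
    ((tendsto_error 1 hcpos).comp (tendsto_fst_thermodynamicLimit ρ)).eventually_lt_const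
      (lt_min ca.δ_pos cb.δ_pos)
  -- The thresholds ensure in turn p ≥ 4, N - p ≥ 4, N ≥ 1, 8^N ≤ e^{cN²}, `leadingLog` + 1 ≤ -cN²,
  -- and κ ≤ 1/2.
  filter_upwards [eventually_density ρ, herr, hexp, hlarge (4 / r), hlarge (4 / (1 - r)),
    hlarge 1, hlarge (Real.log 8 / c), hlarge ((Real.log 2 + 1) / (7 * c)),
    hlarge (Real.log 2 / (2 * c))] with q hq h1 h2 h3 h4 h5 h6 h7 h8
  obtain ⟨N, p⟩ := q
  simp only at hq h1 h2 h3 h4 h5 h6 h7 h8 ⊢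
  rw [← hr] at hq
  rw [div_le_iff₀ hr0] at h3
  rw [div_le_iff₀ hr1] at h4
  rw [div_le_iff₀ hcpos] at h6
  rw [div_le_iff₀ (by positivity)] at h7 h8
  have hp4 : 4 ≤ p := by
    have : (4 : ℝ) ≤ p := by rw [hq]; linarith
    exact_mod_cast this
  have hpN : p + 4 ≤ N := by
    have : (p : ℝ) + 4 ≤ N := by rw [hq]; linarith
    exact_mod_cast this
  have hp0 : 0 < p := by omega
  have hpN' : p < N := by omega
  have hn : ((N - p : ℕ) : ℝ) = (1 - r) * N := by
    rw [Nat.cast_sub hpN'.le, hq]; ring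
  have hap : (1 - r) / r * p = (N - p : ℕ) := by rw [hn, hq]; field_simp
  have hbp : r / (1 - r) * (N - p : ℕ) = p := by rw [hn, hq]; field_simp
  have hN0 : (0 : ℝ) < N := by linarith
  have hlead : leadingLog N p γ = (N : ℝ) ^ 2 * γ * r * (1 - r) + N * Real.log 2 := by
    rw [leadingLog, hn, hq]; ring
  have hlead' : leadingLog N p γ = -(8 * c) * (N : ℝ) ^ 2 + N * Real.log 2 := by
    rw [hlead, hc, hs₀]; ring
  set ε := Real.exp (2 - c * N) with hε
  have hε0 : 0 < ε := Real.exp_pos _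
  have hεδ : ε < min ca.δ cb.δ := by
    refine lt_of_le_of_lt ?_ h2
    rw [one_mul]
    exact le_mul_of_one_le_left hε0.le (one_le_pow₀ h5)
  have hvars : ∀ τ : ℂ, τ.re ≤ -c * (N : ℝ) ^ 2 + 2 →
      ‖lobeVar p (N - p) τ‖ ≤ ε ∧ ‖lobeVar (N - p) p τ‖ ≤ ε := fun τ hτ =>
    ⟨norm_lobeVar_le _ (by omega) (by omega) hcpos.le hτ,
      norm_lobeVar_le _ (by omega) (by omega) hcpos.le hτ⟩
  have hvarsδ : ∀ τ : ℂ, τ.re ≤ -c * (N : ℝ) ^ 2 + 2 →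
      ‖lobeVar p (N - p) τ‖ < ca.δ ∧ ‖lobeVar (N - p) p τ‖ < cb.δ := fun τ hτ =>
    ⟨(hvars τ hτ).1.trans_lt (hεδ.trans_le (min_le_left _ _)),
      (hvars τ hτ).2.trans_lt (hεδ.trans_le (min_le_right _ _))⟩
  have hshift : ∀ τ : ℂ, τ.re ≤ -c * (N : ℝ) ^ 2 + 2 →
      ‖lobeShift ca cb N p τ‖ ≤ (ca.K + cb.K) * (N : ℝ) ^ 2 * ε := fun τ hτ =>
    norm_lobeShift_le_of_le ca cb hp0 hpN' hε0.le (hvarsδ τ hτ).1 (hvarsδ τ hτ).2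
      (hvars τ hτ).1 (hvars τ hτ).2
  have happ : ∀ C : ℂ, C ≠ 0 →
      (∏ j ∈ Finset.Icc 1 p, ‖1 + root N p j C‖) * ‖1 + root N p N C‖
      = 2 ^ p * Real.exp (γ * p) * ‖1 + root N p p C‖ →
      Real.log ‖C‖ ≤ -c * (N : ℝ) ^ 2 := by
    intro C hC hprod
    have hκ : Real.exp (-(2 * c * N)) ≤ 1 / 2 := by
      have : Real.exp (-(2 * c * N)) ≤ Real.exp (-Real.log 2) :=
        Real.exp_le_exp.2 (by linarith)
      rwa [Real.exp_neg (Real.log 2), Real.exp_log two_pos, ← one_div] at this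
    have hκγ : Real.exp (-(2 * c * N)) ^ (4 * N) = Real.exp (γ * p) ^ (N - p) := by
      rw [← Real.exp_nat_mul, ← Real.exp_nat_mul, hn, hq, hc, hs₀]
      congr 1
      push_cast
      ring
    have h9 := norm_le_of_prod_eq hp0 hpN' hC (Real.exp_pos _) hκ hκγ hprod
    have h10 := Real.log_le_log (norm_pos_iff.2 hC) h9
    rw [Real.log_pow, Real.log_mul (by norm_num) (Real.exp_pos _).ne', Real.log_exp] at h10
    refine h10.trans ?_
    nlinarith
  obtain ⟨t, hts, ht, hlog, hcon⟩ := exists_unique_solution ca cb hp4 hpN (div_pos hr1 hr0)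
    (div_pos hr0 hr1) hap hbp hγ.ne (s := -c * (N : ℝ) ^ 2)
    (fun τ hτ => ⟨(hvarsδ τ hτ).1, (hvarsδ τ hτ).2, (hshift τ hτ).trans h1.le⟩)
    (by rw [hlead']; nlinarith) happ
  have hτ : (t : ℂ).re ≤ -c * (N : ℝ) ^ 2 + 2 := by rw [Complex.ofReal_re]; linarith
  refine ⟨t, hlog, hcon, hts.trans ?_, ?_, ?_⟩
  · have : (N : ℝ) ≤ (N : ℝ) ^ 2 := le_self_pow₀ h5 two_ne_zero
    have := mul_le_mul_of_nonneg_left this hcpos.le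
    linarith
  · have h9 : ((t - leadingLog N p γ : ℝ) : ℂ) = lobeShift ca cb N p t := by
      rw [Complex.ofReal_sub]; linear_combination ht
    have h10 : |t - leadingLog N p γ| = ‖lobeShift ca cb N p t‖ := by
      rw [← h9, Complex.norm_real, Real.norm_eq_abs]
    rw [← hlead, h10]
    refine (hshift t hτ).trans ?_
    have : 0 ≤ (ca.K + cb.K) * (N : ℝ) ^ 2 * ε := by positivity
    linarith
  · have h9 := betheEigenvalue_bound ca cb (by omega) (by omega) (div_pos hr1 hr0)
      (div_pos hr0 hr1) hap hbp hε0.le ht (hvarsδ t hτ).1 (hvarsδ t hτ).2 (hvars t hτ).1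
      (hvars t hτ).2 ((hshift t hτ).trans h1.le)
    have e1 : (p : ℝ) * γ = N * γ * r := by rw [hq]; ring
    have e2 : ((N - p : ℕ) : ℝ) * γ = N * γ * (1 - r) := by rw [hn]; ring
    rwa [e1, e2] at h9

end TASEP

end

/-! ### Assembly of the two statements -/

theorem proposition4p6 (γ : ℝ) (hγ : γ < 0) (ρ : ℚ) (hρ₀ : 0 < ρ) (hρ₁ : ρ < 1) :
    (∃ Cstar : ℕ × ℕ → ℝ,
      (∀ᶠ q in TASEP.thermodynamicLimit ρ, 0 < Cstar q ∧
        (∀ C : ℂ, TASEP.LogConsistency q.1 q.2 γ C ↔ C = (Cstar q : ℂ)) ∧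
        (∀ C : ℂ, TASEP.Consistency q.1 q.2 γ (TASEP.negSelection q.1 q.2) C ↔
          C = (Cstar q : ℂ))) ∧
      (∃ c : ℝ, 0 < c ∧
        Cstar =O[TASEP.thermodynamicLimit ρ] fun q => Real.exp (-c * (q.1 : ℝ))) ∧
      (fun q => Cstar q - Real.exp ((q.1 : ℝ) ^ 2 * γ * ρ * (1 - ρ)) * 2 ^ q.1)
        =o[TASEP.thermodynamicLimit ρ]
          fun q => Real.exp ((q.1 : ℝ) ^ 2 * γ * ρ * (1 - ρ)) * (2 : ℝ) ^ q.1) ∧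
    (TASEP.RootSelection γ ρ → ∀ lam : ℕ × ℕ → ℂ,
      (∀ᶠ q in TASEP.thermodynamicLimit ρ, TASEP.IsLargestEigenvalue q.1 q.2 γ (lam q)) →
      (fun q => lam q -
          (-1 + Complex.exp ((q.1 : ℂ) * γ * ρ) + Complex.exp ((q.1 : ℂ) * γ * (1 - ρ))))
        =o[TASEP.thermodynamicLimit ρ]
          fun q => Real.exp ((q.1 : ℝ) * γ * ρ) + Real.exp ((q.1 : ℝ) * γ * (1 - ρ))) := by
  obtain ⟨M, c, hc, hev⟩ := TASEP.eventually_solution hγ hρ₀ hρ₁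
  obtain ⟨t, ht⟩ := Filter.skolem.1 hev
  have herr : Tendsto (fun q : ℕ × ℕ => M * (q.1 : ℝ) ^ 2 * Real.exp (2 - c * q.1))
      (TASEP.thermodynamicLimit ρ) (𝓝 0) :=
    (TASEP.tendsto_error M hc).comp (TASEP.tendsto_fst_thermodynamicLimit ρ)
  refine ⟨⟨fun q => Real.exp (t q), ?_, ⟨c, hc, ?_⟩, ?_⟩, ?_⟩
  · filter_upwards [ht] with q hq
    exact ⟨Real.exp_pos _, hq.1, hq.2.1⟩
  · refine IsBigO.of_bound 1 ?_
    filter_upwards [ht] with q hq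
    rw [one_mul, Real.norm_of_nonneg (Real.exp_pos _).le,
      Real.norm_of_nonneg (Real.exp_pos _).le]
    exact Real.exp_le_exp.2 hq.2.2.1
  · refine isLittleO_iff.2 fun ε hε => ?_
    filter_upwards [ht, herr.eventually_lt_const (lt_min one_pos (half_pos hε))] with q hq he
    set L : ℝ := (q.1 : ℝ) ^ 2 * γ * ρ * (1 - ρ) + q.1 * Real.log 2 with hL
    have hA : Real.exp ((q.1 : ℝ) ^ 2 * γ * ρ * (1 - ρ)) * (2 : ℝ) ^ q.1 = Real.exp L := by
      rw [hL, Real.exp_add, Real.exp_nat_mul, Real.exp_log two_pos]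
    have hd := hq.2.2.2.1.trans_lt he
    -- The error in the logarithm tends to zero, so the relative error of C* is at most twice as
    -- large and also tends to zero.
    have h1 : |Real.exp (t q - L) - 1| ≤ 2 * |t q - L| :=
      Real.abs_exp_sub_one_le (hd.le.trans (min_le_left _ _))
    have h2 : Real.exp (t q) - Real.exp L = (Real.exp (t q - L) - 1) * Real.exp L := by
      rw [sub_mul, ← Real.exp_add, sub_add_cancel, one_mul]
    rw [hA, h2, norm_mul, Real.norm_eq_abs]
    refine mul_le_mul_of_nonneg_right ?_ (norm_nonneg _)
    have := hd.trans_le (min_le_right _ _)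
    linarith
  · intro hsel lam hlam
    refine isLittleO_iff.2 fun ε hε => ?_
    filter_upwards [ht, hsel, hlam, herr.eventually_lt_const hε] with q hq hs hl he
    obtain ⟨C, hC, hlC⟩ := hs _ hl
    -- The root selection provides only some solution C; uniqueness from part (a) forces C = C*.
    rw [(hq.2.1 C).1 hC] at hlC
    have h1 : Complex.exp ((q.1 : ℂ) * γ * ρ) = (Real.exp ((q.1 : ℝ) * γ * ρ) : ℝ) := by
      push_cast; rfl
    have h2 : Complex.exp ((q.1 : ℂ) * γ * (1 - ρ))
        = (Real.exp ((q.1 : ℝ) * γ * (1 - ρ)) : ℝ) := by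
      push_cast; rfl
    rw [h1, h2, hlC]
    refine hq.2.2.2.2.trans ?_
    rw [Real.norm_of_nonneg (by positivity)]
    exact mul_le_mul_of_nonneg_right he.le (by positivity)
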